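/- **Theorem.** Let $n\ge 3$ and $m>0$. Identify the configurations $q=(q_1,\dots,q_{n+1})$ of $n+1$ points of the plane with $\mathbb R^{2n+2}$, with the standard inner product. Give the first $n$ bodies mass $1$ and the last one mass $m$, let $I=\frac12\sum_i m_i|q_i|^2$, $U=\sum_{i<j}\frac{m_im_j}{|q_i-q_j|}$, $f=\sqrt I\,U$, and let $z_0$ be the central $+$ regular $n$-gon configuration $q_k=(\cos k\theta,\sin k\theta)$, $1\le k\le n$, $q_{n+1}=(0,0)$, $\theta=2\pi/n$. Let $H=D^2f(z_0)$. Call $z_0$ *degenerate* (for the mass $m$) if $\ker H$ is not contained in the plane spanned by the scaling direction $z_0$ and the infinitesimal rotation $(q_k^\perp)_k$ of $z_0$, where $(x,y)^\perp=(-y,x)$. The dihedral group $D_n=\langle r,s\rangle$ acts on $\mathbb R^{2n+2}$ by permuting the bodies and applying the corresponding rotation or reflection of the plane ($r$ is the rotation by $\theta$, $s$ the reflection in the first axis). Let $$v_l=(\cos(lk\theta)\,q_k)_k,\quad v_l'=(-\sin(lk\theta)\,q_k^\perp)_k,\quad w_l'=(\sin(lk\theta)\,q_k)_k,\quad w_l=(\cos(lk\theta)\,q_k^\perp)_k,$$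 with zero entry at the central body, and let $e_{2n+1},e_{2n+2}$ be the unit displacements of the central body. 1. (*Block structure*) The vectors $v_0$; $w_0$; $v_{n/2}$; $w_{n/2}$ (the last two only for $n$ even); $v_1,v_1',e_{2n+1}$; $w_1',w_1,e_{2n+2}$; and $v_l,v_l'$; $w_l',w_l$ for $2\le l<n/2$ form a basis of $\mathbb R^{2n+2}$. It is adapted to $D_n$: the lines of $v_0,w_0,v_{n/2},w_{n/2}$ are the one-dimensional representations with $(r,s)\mapsto(1,1),(1,-1),(-1,1),(-1,-1)$ respectively, and for $1\le l<n/2$ the pairs $(v_l,w_l')$ and $(v_l',w_l)$, as well as $(e_{2n+1},e_{2n+2})$ if $l=1$, transform by the two-dimensional representation $\rho_l$ in which $r$ is the rotation by $l\theta$ and $s=\mathrm{diag}(1,-1)$. In this basis $H$ is block-diagonal, with scalar blocks $\lambda_1,\lambda_2$ (on $v_0,w_0$) and, for $n$ even, $\lambda_3,\lambda_4$ (on $v_{n/2},w_{n/2}$); one and the same $3\times3$ block $A_1$ on $(v_1,v_1',e_{2n+1})$ and on $(w_1',w_1,e_{2n+2})$; and, for each $2\le l<n/2$, one and the same $2\times2$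 block $A_l$ on $(v_l,v_l')$ and on $(w_l',w_l)$. Moreover $\lambda_1=\lambda_2=0$. For $n$ even, $n\ge4$, write $A_{n/2}$ for the matrix of $H$ in the basis $(v_{n/2},w_{n/2})$; it is $\mathrm{diag}(\lambda_3,\lambda_4)$. 2. (*Degeneracy criterion*) $z_0$ is degenerate if and only if $\det A_1=0$ or $\det A_l=0$ for some $2\le l\le\lfloor n/2\rfloor$. 3. (*Modes $l\ge2$*) For each $2\le l\le\lfloor n/2\rfloor$ there is at most one $m>0$ for which $\det A_l=0$. 4. (*Mode $l=1$*) If $3\le n\le6$ there is exactly one $m>0$ with $\det A_1=0$; if $n\ge7$ there is none. 5. (*Number of degeneracy values*) The set of those $m>0$ for which $z_0$ is degenerate is finite. Its cardinality $N(n)$ equals the number of modes $1\le l\le\lfloor n/2\rfloor$ for which $\det A_l$ vanishes for some $m>0$, and $$N(3)=1,\qquad N(n)=\lfloor n/2\rfloor-1\ (4\le n\le 6),\qquad N(n)=\lfloor n/2\rfloor-2\ (7\le n\le9),\qquad N(n)=\lfloor n/2\rfloor-1\ (n\ge10).$$ In particular $N(n)$ increases with $n$ for $n\ge7$, in the sense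 that $N(n)\le N(n+1)$ and $N(n)<N(n+2)$. -/

import Mathlib

open scoped Gradient

/-! ### The `n`-body functions

The plane `ℝ²` is identified with `ℂ`, so that rotation by an angle `t` is multiplication by
`exp (i t)`.  There are `n + 1` bodies: the vertices `some k`, `k : ZMod n`, and the centre `none`. -/

/-- The labels of the bodies: `some k` is the `k`-th vertex, `none` is the central body. -/
abbrev Body (n : ℕ) : Type := Option (ZMod n)

/-- The configuration space `ℝ^(2n+2) = (ℝ²)^(n+1)` with its standard inner product. -/
abbrev Config (n : ℕ) : Type := PiLp 2 (fun _ : Body n => ℂ)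

/-- The masses: `1` at every vertex and `m` at the centre. -/
def mass (n : ℕ) (m : ℝ) : Body n → ℝ
  | some _ => 1
  | none => m

/-- The moment of inertia `I = (1/2) ∑ m_i |q_i|²`. -/
noncomputable def inertia (n : ℕ) [NeZero n] (m : ℝ) (q : Config n) : ℝ :=
  (1 / 2) * ∑ i : Body n, mass n m i * ‖q i‖ ^ 2

/-- The Newtonian potential `U = ∑_{i<j} m_i m_j / |q_i - q_j|`
(each unordered pair is met twice, whence the factor `1/2`). -/
noncomputable def potential (n : ℕ) [NeZero n] (m : ℝ) (q : Config n) : ℝ :=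
  (1 / 2) * ∑ i : Body n, ∑ j ∈ Finset.univ.erase i, mass n m i * mass n m j / ‖q i - q j‖

/-- The function `f = √I · U`. -/
noncomputable def sqrtIU (n : ℕ) [NeZero n] (m : ℝ) (q : Config n) : ℝ :=
  Real.sqrt (inertia n m q) * potential n m q

/-- The angle `2πk/n` of the `k`-th vertex. -/
noncomputable def vertexAngle (n : ℕ) (k : ZMod n) : ℝ := 2 * Real.pi * (k.val : ℝ) / n

/-- The `k`-th vertex `(cos (2πk/n), sin (2πk/n))` of the regular `n`-gon. -/
noncomputable def vertex (n : ℕ) (k : ZMod n) : ℂ := Complex.exp (Complex.I * vertexAngle n k)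

/-- The central + regular `n`-gon configuration `z₀`. -/
noncomputable def z0 (n : ℕ) : Config n :=
  WithLp.toLp 2 fun
    | some k => vertex n k
    | none => 0

/-- The Hessian `D²f(z₀)`, as a linear operator on the Euclidean space `ℝ^(2n+2)`: the derivative
at `z₀` of the gradient of `f = √I · U`. -/
noncomputable def hess (n : ℕ) [NeZero n] (m : ℝ) : Config n →L[ℝ] Config n :=
  fderiv ℝ (gradient (sqrtIU n m)) (z0 n)

/-- The infinitesimal rotation of `z₀` about the origin. -/
noncomputable def rotationDirection (n : ℕ) : Config n :=
  WithLp.toLp 2 fun i => Complex.I * z0 n i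

/-- `z₀` is (nontrivially) degenerate: the kernel of the Hessian has an element outside the plane
spanned by the scaling direction `z₀` and the rotation direction, which is the part of the kernel
forced by the invariance of `f` under scalings and rotations. -/
def Degenerate (n : ℕ) [NeZero n] (m : ℝ) : Prop :=
  ∃ v : Config n, hess n m v = 0 ∧ v ∉ Submodule.span ℝ {z0 n, rotationDirection n}

/-! ### The representation of the dihedral group -/

/-- `vertex n` turns addition modulo `n` into multiplication. -/
theorem vertex_add (n : ℕ) [NeZero n] (a b : ZMod n) :
    vertex n (a + b) = vertex n a * vertex n b := by
  have h : ∀ k : ZMod n, vertex n k = ZMod.stdAddChar k := by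
    intro k
    rw [ZMod.stdAddChar_apply, ZMod.toCircle_apply]
    unfold vertex vertexAngle
    congr 1
    push_cast
    ring
  rw [h, h, h, AddChar.map_add_eq_mul]

theorem vertex_zero (n : ℕ) [NeZero n] : vertex n 0 = 1 := by
  simp [vertex, vertexAngle]

theorem conj_vertex (n : ℕ) [NeZero n] (a : ZMod n) :
    (starRingEnd ℂ) (vertex n a) = vertex n (-a) := by
  have h1 : vertex n (-a) * vertex n a = 1 := by rw [← vertex_add]; simp [vertex_zero]
  have h2 : (starRingEnd ℂ) (vertex n a) * vertex n a = 1 := by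
    rw [mul_comm, Complex.mul_conj, Complex.normSq_eq_norm_sq]
    unfold vertex
    rw [mul_comm, Complex.norm_exp_ofReal_mul_I]
    simp
  have h3 : vertex n a ≠ 0 := Complex.exp_ne_zero _
  exact mul_right_cancel₀ h3 (h2.trans h1.symm)

/-- The rotation `r^a`: every position is rotated by `2πa/n`, and the vertex labels are shifted. -/
noncomputable def rotationAction (n : ℕ) [NeZero n] (a : ZMod n) : Config n →ₗ[ℝ] Config n where
  toFun z := WithLp.toLp 2 fun
    | some k => vertex n a * z (some (k - a))
    | none => vertex n a * z none
  map_add' x y := by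
    ext i
    cases i <;> simp [mul_add]
  map_smul' c x := by
    ext i
    cases i <;> simp [mul_left_comm]

/-- The reflection `s`: every position is reflected in the first coordinate axis, and the vertex
labels are reversed. -/
noncomputable def reflectionAction (n : ℕ) [NeZero n] : Config n →ₗ[ℝ] Config n where
  toFun z := WithLp.toLp 2 fun
    | some k => (starRingEnd ℂ) (z (some (-k)))
    | none => (starRingEnd ℂ) (z none)
  map_add' x y := by
    ext i
    cases i <;> simp
  map_smul' c x := by
    ext i
    cases i <;> simp

theorem rotationAction_zero (n : ℕ) [NeZero n] : rotationAction n 0 = 1 := by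
  ext z i
  cases i <;> simp [rotationAction, vertex_zero]

theorem rotationAction_mul (n : ℕ) [NeZero n] (a b : ZMod n) :
    rotationAction n a * rotationAction n b = rotationAction n (a + b) := by
  ext z i
  cases i <;> simp [rotationAction, vertex_add, mul_assoc, sub_sub]

theorem reflectionAction_mul_self (n : ℕ) [NeZero n] :
    reflectionAction n * reflectionAction n = 1 := by
  ext z i
  cases i <;> simp [reflectionAction]

theorem rotationAction_mul_reflectionAction (n : ℕ) [NeZero n] (a : ZMod n) :
    rotationAction n a * reflectionAction n = reflectionAction n * rotationAction n (-a) := by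
  ext z i
  cases i <;> simp [rotationAction, reflectionAction, conj_vertex, sub_eq_add_neg, add_comm]

/-- The underlying map of the representation of `D_n`; in Mathlib `sr a` is `s * r^a`. -/
noncomputable def dihedralAction (n : ℕ) [NeZero n] :
    DihedralGroup n → (Config n →ₗ[ℝ] Config n)
  | .r a => rotationAction n a
  | .sr a => reflectionAction n * rotationAction n a

/-- The representation of the dihedral group `D_n` on the configuration space `ℝ^(2n+2)` that
permutes the bodies and applies the corresponding rotation or reflection of the plane. -/
noncomputable def dihedralRep (n : ℕ) [NeZero n] : Representation ℝ (DihedralGroup n) (Config n) where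
  toFun := dihedralAction n
  map_one' := rotationAction_zero n
  map_mul' x y := by
    have h1 := rotationAction_mul n
    have h2 := reflectionAction_mul_self n
    have h3 := rotationAction_mul_reflectionAction n
    rcases x with a | a <;> rcases y with b | b
    · simp only [DihedralGroup.r_mul_r, dihedralAction, h1]
    · simp only [DihedralGroup.r_mul_sr, dihedralAction]
      rw [← mul_assoc, h3, mul_assoc, h1, neg_add_eq_sub]
    · simp only [DihedralGroup.sr_mul_r, dihedralAction]
      rw [mul_assoc, h1]
    · simp only [DihedralGroup.sr_mul_sr, dihedralAction]
      rw [mul_assoc, ← mul_assoc (rotationAction n a), h3, mul_assoc, h1, ← mul_assoc, h2, one_mul,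
        neg_add_eq_sub]

/-- The one-dimensional representation of `D_n` with `r ↦ a`, `s ↦ b`, where `a, b ∈ {1, -1}`. -/
def dihedralChar (n : ℕ) (a b : ℝ) : DihedralGroup n → ℝ
  | .r k => a ^ k.val
  | .sr k => b * a ^ k.val

/-- The two-dimensional representation `ρ_l` of `D_n`: `r^k` acts as the rotation by `2πlk/n` and
`s` acts as `diag(1, -1)`. -/
noncomputable def dihedralRho (n l : ℕ) : DihedralGroup n → Matrix (Fin 2) (Fin 2) ℝ
  | .r k => !![Real.cos (l * vertexAngle n k), -Real.sin (l * vertexAngle n k);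
               Real.sin (l * vertexAngle n k), Real.cos (l * vertexAngle n k)]
  | .sr k => !![1, 0; 0, -1] *
             !![Real.cos (l * vertexAngle n k), -Real.sin (l * vertexAngle n k);
                Real.sin (l * vertexAngle n k), Real.cos (l * vertexAngle n k)]

/-- The vector `v` spans a line on which `D_n` acts through `χ`. -/
def ActsByChar (n : ℕ) [NeZero n] (χ : DihedralGroup n → ℝ) (v : Config n) : Prop :=
  ∀ g, dihedralRep n g v = χ g • v

/-- In the ordered pair `(u 0, u 1)`, the group `D_n` acts through the matrices `ρ g`. -/
def ActsByMatrix (n : ℕ) [NeZero n] (ρ : DihedralGroup n → Matrix (Fin 2) (Fin 2) ℝ)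
    (u : Fin 2 → Config n) : Prop :=
  ∀ g j, dihedralRep n g (u j) = ∑ i, ρ g i j • u i

/-! ### The symmetry-adapted basis -/

/-- `v_l`: the vector with `k`-th entry `cos (lkθ) (cos kθ, sin kθ)`, `θ = 2π/n`. -/
noncomputable def modeV (n l : ℕ) : Config n :=
  WithLp.toLp 2 fun
    | some k => (Real.cos (l * vertexAngle n k) : ℂ) * vertex n k
    | none => 0

/-- `v_l'`: the vector with `k`-th entry `-sin (lkθ) (-sin kθ, cos kθ)`. -/
noncomputable def modeV' (n l : ℕ) : Config n :=
  WithLp.toLp 2 fun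
    | some k => -(Real.sin (l * vertexAngle n k) : ℂ) * (Complex.I * vertex n k)
    | none => 0

/-- `w_l`: the vector with `k`-th entry `cos (lkθ) (-sin kθ, cos kθ)`. -/
noncomputable def modeW (n l : ℕ) : Config n :=
  WithLp.toLp 2 fun
    | some k => (Real.cos (l * vertexAngle n k) : ℂ) * (Complex.I * vertex n k)
    | none => 0

/-- `w_l'`: the vector with `k`-th entry `sin (lkθ) (cos kθ, sin kθ)`. -/
noncomputable def modeW' (n l : ℕ) : Config n :=
  WithLp.toLp 2 fun
    | some k => (Real.sin (l * vertexAngle n k) : ℂ) * vertex n k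
    | none => 0

/-- `e_{2n+1}`: unit displacement of the central body along the first axis. -/
noncomputable def centerX (n : ℕ) : Config n :=
  WithLp.toLp 2 fun
    | some _ => 0
    | none => 1

/-- `e_{2n+2}`: unit displacement of the central body along the second axis. -/
noncomputable def centerY (n : ℕ) : Config n :=
  WithLp.toLp 2 fun
    | some _ => 0
    | none => Complex.I

/-- The Fourier modes `l` with `2 ≤ l < n/2`. -/
abbrev HighMode (n : ℕ) : Type := {l : Fin n // 2 ≤ l.val ∧ 2 * l.val < n}

/-- The blocks of the decomposition: the scalar blocks of the one-dimensional representations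
`φ₁, φ₂` and, when `n` is even, `φ₃, φ₄`; the two copies `A₁, B₁` of the `3 × 3` block; the two
copies `A_l, B_l` of the `2 × 2` block for `2 ≤ l < n/2`. -/
inductive BlockIndex (n : ℕ) : Type
  | phi1 : BlockIndex n
  | phi2 : BlockIndex n
  | phi3 : PLift (Even n) → BlockIndex n
  | phi4 : PLift (Even n) → BlockIndex n
  | A1 : BlockIndex n
  | B1 : BlockIndex n
  | A : HighMode n → BlockIndex n
  | B : HighMode n → BlockIndex n
  deriving DecidableEq, Fintype

/-- The size of a block. -/
def blockSize (n : ℕ) : BlockIndex n → ℕ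
  | .phi1 => 1
  | .phi2 => 1
  | .phi3 _ => 1
  | .phi4 _ => 1
  | .A1 => 3
  | .B1 => 3
  | .A _ => 2
  | .B _ => 2

/-- The symmetry-adapted vectors of each block. -/
noncomputable def blockVector (n : ℕ) : (β : BlockIndex n) → Fin (blockSize n β) → Config n
  | .phi1 => fun _ => modeV n 0
  | .phi2 => fun _ => modeW n 0
  | .phi3 _ => fun _ => modeV n (n / 2)
  | .phi4 _ => fun _ => modeW n (n / 2)
  | .A1 => ![modeV n 1, modeV' n 1, centerX n]
  | .B1 => ![modeW' n 1, modeW n 1, centerY n]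
  | .A l => ![modeV n l.1, modeV' n l.1]
  | .B l => ![modeW' n l.1, modeW n l.1]

/-- The index set of the symmetry-adapted basis. -/
abbrev AdaptedIndex (n : ℕ) : Type := Σ β : BlockIndex n, Fin (blockSize n β)

/-- The vectors of the blocks transform under `D_n` through its irreducible representations
`φ₁, …, φ₄` and `ρ_l`. -/
def IsSymmetryAdapted (n : ℕ) [NeZero n] : Prop :=
  ActsByChar n (dihedralChar n 1 1) (modeV n 0) ∧
  ActsByChar n (dihedralChar n 1 (-1)) (modeW n 0) ∧
  (Even n → ActsByChar n (dihedralChar n (-1) 1) (modeV n (n / 2)) ∧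
    ActsByChar n (dihedralChar n (-1) (-1)) (modeW n (n / 2))) ∧
  (∀ l : ℕ, 1 ≤ l → 2 * l < n →
    ActsByMatrix n (dihedralRho n l) ![modeV n l, modeW' n l] ∧
    ActsByMatrix n (dihedralRho n l) ![modeV' n l, modeW n l]) ∧
  ActsByMatrix n (dihedralRho n 1) ![centerX n, centerY n]

/-! ### The blocks of the Hessian -/

/-- The coefficients `⟪u_i, T u_j⟫ / ⟪u_i, u_i⟫`.  When the vectors `u_i` are nonzero and mutually
orthogonal and their span is `T`-invariant, this is the matrix of `T` in the basis `u` of it. -/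
noncomputable def coeffMatrix {n : ℕ} [NeZero n] {κ : Type} (T : Config n →L[ℝ] Config n)
    (u : κ → Config n) : Matrix κ κ ℝ :=
  Matrix.of fun i j => inner ℝ (u i) (T (u j)) / inner ℝ (u i) (u i)

/-- The scalar by which the Hessian acts on the line spanned by `v`. -/
noncomputable def scalarBlock (n : ℕ) [NeZero n] (m : ℝ) (v : Config n) : ℝ :=
  inner ℝ v (hess n m v) / inner ℝ v v

/-- The block `A₁` of the Hessian, in the basis `v₁, v₁', e_{2n+1}`. -/
noncomputable def blockA1 (n : ℕ) [NeZero n] (m : ℝ) : Matrix (Fin 3) (Fin 3) ℝ :=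
  coeffMatrix (hess n m) ![modeV n 1, modeV' n 1, centerX n]

/-- The block `A_l` of the Hessian for `2 ≤ l ≤ n/2`, in the basis `v_l, v_l'`.  If `l = n/2`
then `v_l' = 0`, and the mode is spanned by `v_l` and `w_l`. -/
noncomputable def blockA (n : ℕ) [NeZero n] (m : ℝ) (l : ℕ) : Matrix (Fin 2) (Fin 2) ℝ :=
  if 2 * l = n then coeffMatrix (hess n m) ![modeV n l, modeW n l]
  else coeffMatrix (hess n m) ![modeV n l, modeV' n l]

/-- The diagonal blocks of the Hessian in the symmetry-adapted basis: `B₁ = A₁` and `B_l = A_l`. -/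
noncomputable def hessBlock (n : ℕ) [NeZero n] (m : ℝ) :
    (β : BlockIndex n) → Matrix (Fin (blockSize n β)) (Fin (blockSize n β)) ℝ
  | .phi1 => Matrix.of fun _ _ => scalarBlock n m (modeV n 0)
  | .phi2 => Matrix.of fun _ _ => scalarBlock n m (modeW n 0)
  | .phi3 _ => Matrix.of fun _ _ => scalarBlock n m (modeV n (n / 2))
  | .phi4 _ => Matrix.of fun _ _ => scalarBlock n m (modeW n (n / 2))
  | .A1 => blockA1 n m
  | .B1 => blockA1 n m
  | .A l => blockA n m l.1
  | .B l => blockA n m l.1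

/-- The determinant of the block of the mode `l`. -/
noncomputable def modeDet (n : ℕ) [NeZero n] (m : ℝ) (l : ℕ) : ℝ :=
  if l = 1 then (blockA1 n m).det else (blockA n m l).det

/-- The set of positive degeneracy values of the central mass. -/
def degeneracyValues (n : ℕ) [NeZero n] : Set ℝ := {m : ℝ | 0 < m ∧ Degenerate n m}

/-- The set of modes `1 ≤ l ≤ n/2` whose block is singular for some positive central mass. -/
def degenerateModes (n : ℕ) [NeZero n] : Set ℕ :=
  {l : ℕ | 1 ≤ l ∧ l ≤ n / 2 ∧ ∃ m : ℝ, 0 < m ∧ modeDet n m l = 0}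

/-!
The Hessian maps the plane wave that displaces the `k`-th vertex by `α ζ^((l + 1) k)`, where
`ζ = exp (2πi/n)`, to a combination of waves of frequencies `l` and `-l`; the central body couples
to the frequencies `±1` only. In the real modes `v_l, v_l', w_l', w_l` this is the block
decomposition, and the entries of the blocks are expressed through the sums
`P_l = ½ ∑_t (1 - cos (l t θ)) / |1 - ζ^t|³` and `R_l = ½ ∑_t cos (l t θ) / |1 - ζ^t|`.

For `l ≥ 2` the determinant of the block is affine in the central mass `m` with a nonzero slope, so
it vanishes for exactly one real `m = m_l`. The second difference of `P` is `R`, and `R_l` decreases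
for `l ≤ n/2`, by half a cotangent at each step; hence `P_l` increases there, and so does `m_l`. The
values `m_l` are therefore distinct, and only the signs of `m_2` and `m_3` matter. These signs, and
that of the linear equation for `l = 1`, are read off closed forms in
`S = ∑_{0 < j < n} 1 / sin (π j / n)` and a few cotangents: from numerical enclosures for `n ≤ 10`
and from `1 / sin x ≥ 1 / x + x / 6` and harmonic numbers for larger `n`.
-/

/-! ### Newtonian systems in an inner product space -/

theorem eventually_injective {ι X : Type*} [Finite ι] [TopologicalSpace X] [T2Space X] {f : ι → X}
    (hf : Function.Injective f) : ∀ᶠ g in nhds f, Function.Injective g := by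
  have hne (i j : ι) (hij : i ≠ j) : ∀ᶠ g : ι → X in nhds f, g i ≠ g j :=
    (isOpen_ne_fun (continuous_apply i) (continuous_apply j)).mem_nhds (hf.ne hij)
  filter_upwards [Filter.eventually_all.2 fun i => Filter.eventually_all.2 fun j =>
    Filter.eventually_all.2 (hne i j)] with g hg i j hij
  exact not_imp_not.1 (hg i j) hij

section NewtonianSystem

variable {ι E : Type*} [NormedAddCommGroup E] [InnerProductSpace ℝ E]

theorem hasDerivAt_norm_of_ne_zero {c : ℝ → E} {c' : E} {t : ℝ} (hc : HasDerivAt c c' t)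
    (h0 : c t ≠ 0) : HasDerivAt (fun s => ‖c s‖) (inner ℝ (c t) c' / ‖c t‖) t := by
  have hn : ‖c t‖ ≠ 0 := norm_ne_zero_iff.2 h0
  have h := hc.norm_sq.sqrt (pow_ne_zero 2 hn)
  simp only [Real.sqrt_sq (norm_nonneg _)] at h
  exact h.congr_deriv (by field_simp)

theorem hasDerivAt_inv_norm {c : ℝ → E} {c' : E} {t : ℝ} (hc : HasDerivAt c c' t)
    (h0 : c t ≠ 0) : HasDerivAt (fun s => ‖c s‖⁻¹) (-(inner ℝ (c t) c' / ‖c t‖ ^ 3)) t :=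
  ((hasDerivAt_norm_of_ne_zero hc h0).inv (norm_ne_zero_iff.2 h0)).congr_deriv (by field_simp)

/-- The Hessian of `1 / ‖·‖` at `d`, applied to `e`. It takes the junk value `0` at `d = 0`, so
that sums over all pairs of bodies need not exclude the diagonal. -/
noncomputable def invNormHess (d e : E) : E :=
  (3 * inner ℝ d e / ‖d‖ ^ 5) • d - (‖d‖ ^ 3)⁻¹ • e

@[simp] theorem invNormHess_zero_left (e : E) : invNormHess 0 e = 0 := by simp [invNormHess]

@[simp] theorem invNormHess_zero_right (d : E) : invNormHess d 0 = 0 := by simp [invNormHess]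

theorem invNormHess_self (d : E) : invNormHess d d = (2 * (‖d‖ ^ 3)⁻¹) • d := by
  rcases eq_or_ne d 0 with rfl | hd
  · simp
  have hn : ‖d‖ ≠ 0 := norm_ne_zero_iff.2 hd
  rw [invNormHess, ← sub_smul, real_inner_self_eq_norm_sq]
  congr 1
  field_simp
  norm_num

theorem invNormHess_of_inner_eq_zero {d e : E} (h : inner ℝ d e = 0) :
    invNormHess d e = -((‖d‖ ^ 3)⁻¹ • e) := by
  simp [invNormHess, h]

theorem hasDerivAt_inv_norm_cube_smul {c : ℝ → E} {c' : E} {t : ℝ} (hc : HasDerivAt c c' t)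
    (h0 : c t ≠ 0) :
    HasDerivAt (fun s => -(‖c s‖ ^ 3)⁻¹ • c s) (invNormHess (c t) c') t := by
  have hn : ‖c t‖ ≠ 0 := norm_ne_zero_iff.2 h0
  refine ((((hasDerivAt_norm_of_ne_zero hc h0).fun_pow 3).fun_inv
    (pow_ne_zero 3 hn)).fun_neg.fun_smul hc).congr_deriv ?_
  rw [invNormHess, neg_smul, neg_add_eq_sub]
  congr 2
  push_cast
  field_simp

theorem hasDerivAt_line_apply (q v : PiLp 2 fun _ : ι => E) (i : ι) :
    HasDerivAt (fun t : ℝ => (q + t • v) i) (v i) 0 := by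
  simpa using ((hasDerivAt_id (0 : ℝ)).smul_const (v i)).const_add (q i)

theorem differentiableAt_inv_norm_sub_pow [Finite ι] {q : PiLp 2 fun _ : ι => E}
    (hq : Function.Injective q) (i j : ι) (k : ℕ) :
    DifferentiableAt ℝ (fun x : PiLp 2 fun _ : ι => E => (‖x i - x j‖ ^ k)⁻¹) q := by
  have := Fintype.ofFinite ι
  rcases eq_or_ne i j with rfl | hij
  · simp
  have hne : q i - q j ≠ 0 := sub_ne_zero.2 (hq.ne hij)
  have hd : DifferentiableAt ℝ (fun x : PiLp 2 fun _ : ι => E => x i - x j) q := by fun_prop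
  exact ((hd.norm ℝ hne).fun_pow k).fun_inv (pow_ne_zero k (norm_ne_zero_iff.2 hne))

variable [Fintype ι]

/-- The moment of inertia of bodies with masses `μ` at positions `q`. -/
noncomputable def momentOfInertia (μ : ι → ℝ) (q : PiLp 2 fun _ : ι => E) : ℝ :=
  1 / 2 * ∑ i, μ i * ‖q i‖ ^ 2

/-- The Newtonian potential of bodies with masses `μ` at positions `q`. Every unordered pair is met
twice, whence the factor `1 / 2`; the diagonal terms vanish because `x / 0 = 0`. -/
noncomputable def newtonPotential (μ : ι → ℝ) (q : PiLp 2 fun _ : ι => E) : ℝ :=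
  1 / 2 * ∑ i, ∑ j, μ i * μ j / ‖q i - q j‖

/-- The force exerted on the body `i` by the others; it is the `i`-th component of the gradient of
`newtonPotential μ`. -/
noncomputable def newtonForce (μ : ι → ℝ) (q : PiLp 2 fun _ : ι => E) (i : ι) : E :=
  ∑ j, (μ i * μ j) • -(‖q i - q j‖ ^ 3)⁻¹ • (q i - q j)

/-- The scale-invariant function `√I U`, whose critical points are the central configurations. -/
noncomputable def normalizedPotential (μ : ι → ℝ) (q : PiLp 2 fun _ : ι => E) : ℝ :=
  √(momentOfInertia μ q) * newtonPotential μ q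

/-- The gradient of `normalizedPotential μ` at the collision-free configurations. -/
noncomputable def normalizedForce (μ : ι → ℝ) (q : PiLp 2 fun _ : ι => E) : PiLp 2 fun _ : ι => E :=
  WithLp.toLp 2 fun i =>
    (newtonPotential μ q / (2 * √(momentOfInertia μ q)) * μ i) • q i
      + √(momentOfInertia μ q) • newtonForce μ q i

/-- The configuration `q` is central with multiplier `lam`: the force on every body is `-lam` times
its mass times its position. -/
def IsCentralConfiguration (μ : ι → ℝ) (lam : ℝ) (q : PiLp 2 fun _ : ι => E) : Prop :=
  ∀ i, newtonForce μ q i = -((lam * μ i) • q i)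

variable {μ : ι → ℝ} {lam : ℝ} {q : PiLp 2 fun _ : ι => E}

theorem two_mul_sum_sum_mul_inner_sub {c : ι → ι → ℝ} (hc : ∀ i j, c i j = c j i) (x y : ι → E) :
    2 * ∑ i, ∑ j, c i j * inner ℝ (x i - x j) (y i) =
      ∑ i, ∑ j, c i j * inner ℝ (x i - x j) (y i - y j) := by
  have hswap : ∑ i, ∑ j, c i j * inner ℝ (x i - x j) (y j) =
      -∑ i, ∑ j, c i j * inner ℝ (x i - x j) (y i) := by
    rw [Finset.sum_comm]
    simp only [← Finset.sum_neg_distrib]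
    refine Finset.sum_congr rfl fun i _ => Finset.sum_congr rfl fun j _ => ?_
    rw [hc, ← neg_sub (x i), inner_neg_left, mul_neg]
  simp only [inner_sub_right, mul_sub, Finset.sum_sub_distrib, hswap]
  ring

/-- Newton's third law, tested against a displacement `v`. -/
theorem sum_inner_newtonForce (q v : PiLp 2 fun _ : ι => E) :
    ∑ i, inner ℝ (newtonForce μ q i) (v i) =
      1 / 2 * ∑ i, ∑ j, -(μ i * μ j / ‖q i - q j‖ ^ 3) * inner ℝ (q i - q j) (v i - v j) := by
  rw [← two_mul_sum_sum_mul_inner_sub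
    (fun i j => by rw [norm_sub_rev, mul_comm (μ i)]) (q ·) (v ·)]
  simp only [newtonForce, sum_inner, real_inner_smul_left]
  rw [← mul_assoc, one_div, inv_mul_cancel₀ two_ne_zero, one_mul]
  exact Finset.sum_congr rfl fun i _ => Finset.sum_congr rfl fun j _ => by ring

theorem newtonPotential_eq_neg_sum_inner (q : PiLp 2 fun _ : ι => E) :
    newtonPotential μ q = -∑ i, inner ℝ (newtonForce μ q i) (q i) := by
  rw [sum_inner_newtonForce, newtonPotential, ← mul_neg]
  simp only [← Finset.sum_neg_distrib]
  congr 1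
  refine Finset.sum_congr rfl fun i _ => Finset.sum_congr rfl fun j _ => ?_
  rw [real_inner_self_eq_norm_sq]
  rcases eq_or_ne ‖q i - q j‖ 0 with h | h
  · simp [h]
  · field_simp

theorem IsCentralConfiguration.sum_inner_newtonForce (hc : IsCentralConfiguration μ lam q)
    (v : PiLp 2 fun _ : ι => E) :
    ∑ i, inner ℝ (newtonForce μ q i) (v i) = -(lam * ∑ i, μ i * inner ℝ (q i) (v i)) := by
  simp only [hc _, inner_neg_left, real_inner_smul_left, Finset.sum_neg_distrib, Finset.mul_sum,
    mul_assoc]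

theorem IsCentralConfiguration.newtonPotential_eq (hc : IsCentralConfiguration μ lam q) :
    newtonPotential μ q = lam * (2 * momentOfInertia μ q) := by
  rw [newtonPotential_eq_neg_sum_inner, hc.sum_inner_newtonForce, momentOfInertia]
  simp only [real_inner_self_eq_norm_sq]
  ring

theorem hasLineDerivAt_momentOfInertia (q v : PiLp 2 fun _ : ι => E) :
    HasLineDerivAt ℝ (momentOfInertia μ) (∑ i, μ i * inner ℝ (q i) (v i)) q v := by
  refine ((HasDerivAt.fun_sum (u := Finset.univ) fun i _ =>
    (hasDerivAt_line_apply q v i).norm_sq.const_mul (μ i)).const_mul (1 / 2 : ℝ)).congr_deriv ?_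
  rw [Finset.mul_sum]
  refine Finset.sum_congr rfl fun i _ => ?_
  simp only [zero_smul, add_zero]
  ring

theorem hasLineDerivAt_newtonPotential (hq : Function.Injective q) (v : PiLp 2 fun _ : ι => E) :
    HasLineDerivAt ℝ (newtonPotential μ) (∑ i, inner ℝ (newtonForce μ q i) (v i)) q v := by
  rw [sum_inner_newtonForce]
  refine (HasDerivAt.fun_sum fun i _ => HasDerivAt.fun_sum fun j _ => ?_).const_mul (1 / 2 : ℝ)
  rcases eq_or_ne i j with rfl | hij
  · simpa using hasDerivAt_const (0 : ℝ) (0 : ℝ)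
  have h := (hasDerivAt_inv_norm ((hasDerivAt_line_apply q v i).fun_sub
    (hasDerivAt_line_apply q v j)) (by simpa [sub_eq_zero] using hq.ne hij)).const_mul (μ i * μ j)
  simp only [zero_smul, add_zero] at h
  exact h.congr_deriv (by ring)

theorem hasLineDerivAt_newtonForce (hq : Function.Injective q) (v : PiLp 2 fun _ : ι => E) (i : ι) :
    HasLineDerivAt ℝ (fun x => newtonForce μ x i)
      (∑ j, (μ i * μ j) • invNormHess (q i - q j) (v i - v j)) q v := by
  refine HasDerivAt.fun_sum fun j _ => ?_
  rcases eq_or_ne i j with rfl | hij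
  · simpa using hasDerivAt_const (0 : ℝ) (0 : E)
  simpa using (hasDerivAt_inv_norm_cube_smul ((hasDerivAt_line_apply q v i).fun_sub
    (hasDerivAt_line_apply q v j)) (by simpa [sub_eq_zero] using hq.ne hij)).fun_const_smul
    (μ i * μ j)

theorem differentiable_momentOfInertia : Differentiable ℝ (momentOfInertia (E := E) μ) := by
  have hsq (i : ι) : Differentiable ℝ fun q : PiLp 2 fun _ : ι => E => ‖q i‖ ^ 2 :=
    Differentiable.norm_sq ℝ (by fun_prop)
  unfold momentOfInertia
  fun_prop

theorem differentiableAt_newtonPotential (hq : Function.Injective q) :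
    DifferentiableAt ℝ (newtonPotential μ) q := by
  refine (DifferentiableAt.fun_sum fun i _ => DifferentiableAt.fun_sum fun j _ => ?_).const_mul _
  simpa [div_eq_mul_inv] using
    (differentiableAt_inv_norm_sub_pow hq i j 1).const_mul (μ i * μ j)

theorem differentiableAt_newtonForce (hq : Function.Injective q) (i : ι) :
    DifferentiableAt ℝ (fun x => newtonForce μ x i) q :=
  DifferentiableAt.fun_sum fun j _ => ((differentiableAt_inv_norm_sub_pow hq i j 3).fun_neg.fun_smul
    (by fun_prop)).fun_const_smul _

theorem differentiableAt_sqrt_momentOfInertia (hI : 0 < momentOfInertia μ q) :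
    DifferentiableAt ℝ (fun x => √(momentOfInertia μ x)) q :=
  (differentiable_momentOfInertia q).sqrt hI.ne'

theorem differentiableAt_normalizedForce (hq : Function.Injective q)
    (hI : 0 < momentOfInertia μ q) : DifferentiableAt ℝ (normalizedForce μ) q := by
  have hs := differentiableAt_sqrt_momentOfInertia hI
  have hinv := (hs.const_mul 2).fun_inv (by positivity)
  refine (differentiableAt_piLp 2).2 fun i => ?_
  simp only [normalizedForce, div_eq_mul_inv]
  exact ((((differentiableAt_newtonPotential hq).fun_mul hinv).mul_const _).fun_smul
    (by fun_prop)).fun_add (hs.fun_smul (differentiableAt_newtonForce hq i))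

theorem IsCentralConfiguration.hasLineDerivAt_normalizedForce
    (hc : IsCentralConfiguration μ lam q) (hq : Function.Injective q)
    (hI : 0 < momentOfInertia μ q) (v : PiLp 2 fun _ : ι => E) (i : ι) :
    HasLineDerivAt ℝ (fun x => normalizedForce μ x i)
      (√(momentOfInertia μ q) • ((lam * μ i) • v i
        + ∑ j, (μ i * μ j) • invNormHess (q i - q j) (v i - v j)
        - (3 * lam * (∑ j, μ j * inner ℝ (q j) (v j)) / (2 * momentOfInertia μ q) * μ i) • q i))
      q v := by
  have hI' : HasDerivAt (fun t : ℝ => √(momentOfInertia μ (q + t • v))) _ 0 :=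
    HasDerivAt.sqrt (hasLineDerivAt_momentOfInertia q v) (by simpa using hI.ne')
  have hU : HasDerivAt (fun t : ℝ => newtonPotential μ (q + t • v)) _ 0 :=
    hasLineDerivAt_newtonPotential hq v
  have hF : HasDerivAt (fun t : ℝ => newtonForce μ (q + t • v) i) _ 0 :=
    hasLineDerivAt_newtonForce hq v i
  have hs : 0 < √(momentOfInertia μ q) := Real.sqrt_pos.2 hI
  refine ((((hU.fun_div (hI'.const_mul 2) (by simpa using hs.ne')).mul_const (μ i)).fun_smul
    (hasDerivAt_line_apply q v i)).fun_add (hI'.fun_smul hF)).congr_deriv ?_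
  simp only [zero_smul, add_zero, hc.newtonPotential_eq, hc.sum_inner_newtonForce, hc i]
  generalize ∑ j, (μ i * μ j) • invNormHess (q i - q j) (v i - v j) = X
  generalize ∑ j, μ j * inner ℝ (q j) (v j) = A
  have hsq : momentOfInertia μ q = √(momentOfInertia μ q) ^ 2 := (Real.sq_sqrt hI.le).symm
  generalize √(momentOfInertia μ q) = s at *
  rw [hsq]
  match_scalars <;> field_simp
  ring

variable [CompleteSpace E]

theorem hasGradientAt_normalizedPotential (hq : Function.Injective q)
    (hI : 0 < momentOfInertia μ q) :
    HasGradientAt (normalizedPotential μ) (normalizedForce μ q) q := by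
  have hd : DifferentiableAt ℝ (normalizedPotential μ) q :=
    (differentiableAt_sqrt_momentOfInertia hI).mul (differentiableAt_newtonPotential hq)
  refine hasGradientAt_iff_hasFDerivAt.2 (hd.hasFDerivAt.congr_fderiv ?_)
  ext v
  have hline := (HasDerivAt.sqrt (hasLineDerivAt_momentOfInertia (μ := μ) q v)
    (by simpa using hI.ne')).mul (hasLineDerivAt_newtonPotential (μ := μ) hq v)
  rw [(hd.hasFDerivAt.hasLineDerivAt v).unique hline, InnerProductSpace.toDual_apply_apply,
    PiLp.inner_apply]
  simp only [normalizedForce, inner_add_left, real_inner_smul_left, zero_smul, add_zero,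
    Finset.sum_add_distrib, mul_assoc, ← Finset.mul_sum]
  ring

theorem gradient_normalizedPotential_eventuallyEq (hq : Function.Injective q)
    (hI : 0 < momentOfInertia μ q) :
    gradient (normalizedPotential μ) =ᶠ[nhds q] normalizedForce μ := by
  filter_upwards [(PiLp.continuous_ofLp 2 fun _ : ι => E).continuousAt.eventually
    (eventually_injective hq),
    (differentiable_momentOfInertia q).continuousAt.eventually_const_lt hI] with x hx hIx
  exact (hasGradientAt_normalizedPotential hx hIx).gradient

namespace IsCentralConfiguration

theorem hessian_apply (hc : IsCentralConfiguration μ lam q)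
    (hq : Function.Injective q) (hI : 0 < momentOfInertia μ q) (v : PiLp 2 fun _ : ι => E) (i : ι) :
    fderiv ℝ (gradient (normalizedPotential μ)) q v i =
      √(momentOfInertia μ q) • ((lam * μ i) • v i
        + ∑ j, (μ i * μ j) • invNormHess (q i - q j) (v i - v j)
        - (3 * lam * (∑ j, μ j * inner ℝ (q j) (v j)) / (2 * momentOfInertia μ q) * μ i) •
          q i) := by
  rw [(gradient_normalizedPotential_eventuallyEq hq hI).fderiv_eq]
  have hd := (differentiableAt_normalizedForce hq hI).hasFDerivAt
  have hi := ((hasFDerivWithinAt_piLp 2).1 hd.hasFDerivWithinAt i).hasFDerivAt Filter.univ_mem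
  exact (hi.hasLineDerivAt v).unique (hc.hasLineDerivAt_normalizedForce hq hI v i)

theorem hessian_apply_self (hc : IsCentralConfiguration μ lam q)
    (hq : Function.Injective q) (hI : 0 < momentOfInertia μ q) :
    fderiv ℝ (gradient (normalizedPotential μ)) q q = 0 := by
  ext i
  have hsum : ∑ j, (μ i * μ j) • invNormHess (q i - q j) (q i - q j) =
      (-2 : ℝ) • newtonForce μ q i := by
    simp only [newtonForce, Finset.smul_sum, invNormHess_self, smul_smul]
    exact Finset.sum_congr rfl fun j _ => by congr 1; ring
  have hin : ∑ j, μ j * inner ℝ (q j) (q j) = 2 * momentOfInertia μ q := by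
    simp only [real_inner_self_eq_norm_sq, momentOfInertia]
    ring
  rw [hc.hessian_apply hq hI, hsum, hin, hc i, mul_div_cancel_right₀ _ (by positivity),
    PiLp.zero_apply]
  module

theorem hessian_apply_skew (hc : IsCentralConfiguration μ lam q)
    (hq : Function.Injective q) (hI : 0 < momentOfInertia μ q) {J : E →ₗ[ℝ] E}
    (hJ : ∀ x, inner ℝ x (J x) = 0) :
    fderiv ℝ (gradient (normalizedPotential μ)) q (WithLp.toLp 2 fun i => J (q i)) = 0 := by
  ext i
  have hsum : ∑ j, (μ i * μ j) • invNormHess (q i - q j) (J (q i) - J (q j)) =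
      J (newtonForce μ q i) := by
    simp only [newtonForce, map_sum, map_smul, ← map_sub, neg_smul, smul_neg, map_neg,
      invNormHess_of_inner_eq_zero (hJ _)]
  simp only [hc.hessian_apply hq hI, hsum, hc i, hJ, PiLp.zero_apply, map_neg, map_smul]
  simp

end IsCentralConfiguration

end NewtonianSystem

/-! ### The centred polygon and its plane waves -/

section Polygon

open ComplexConjugate

variable {n : ℕ} [NeZero n] {m : ℝ}

theorem potential_eq_newtonPotential (n : ℕ) [NeZero n] (m : ℝ) :
    potential n m = newtonPotential (mass n m) := by
  funext q
  rw [potential, newtonPotential]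
  congr 1
  refine Finset.sum_congr rfl fun i _ => Finset.sum_erase _ ?_
  rw [sub_self, norm_zero, div_zero]

theorem sqrtIU_eq_normalizedPotential (n : ℕ) [NeZero n] (m : ℝ) :
    sqrtIU n m = normalizedPotential (mass n m) := by
  funext q
  rw [sqrtIU, potential_eq_newtonPotential]
  rfl

theorem vertex_eq_stdAddChar (k : ZMod n) : vertex n k = ZMod.stdAddChar k := by
  rw [ZMod.stdAddChar_apply, ZMod.toCircle_apply]
  unfold vertex vertexAngle
  congr 1
  push_cast
  ring

theorem vertex_injective : Function.Injective (vertex n) := by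
  intro k l h
  rw [vertex_eq_stdAddChar, vertex_eq_stdAddChar] at h
  exact ZMod.injective_stdAddChar h

omit [NeZero n] in
theorem vertex_ne_zero (k : ZMod n) : vertex n k ≠ 0 := Complex.exp_ne_zero _

omit [NeZero n] in
theorem norm_vertex (k : ZMod n) : ‖vertex n k‖ = 1 := by
  rw [vertex, mul_comm, Complex.norm_exp_ofReal_mul_I]

theorem vertex_neg_mul_vertex (k : ZMod n) : vertex n (-k) * vertex n k = 1 := by
  rw [← vertex_add, neg_add_cancel, vertex_zero]

theorem norm_vertex_sub_vertex_add (k t : ZMod n) :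
    ‖vertex n k - vertex n (k + t)‖ = ‖1 - vertex n t‖ := by
  rw [vertex_add, ← mul_one_sub, norm_mul, norm_vertex, one_mul]

theorem conj_one_sub_vertex (t : ZMod n) : conj (1 - vertex n t) = 1 - vertex n (-t) := by
  rw [map_sub, map_one, conj_vertex]

theorem norm_one_sub_vertex_neg (t : ZMod n) : ‖1 - vertex n (-t)‖ = ‖1 - vertex n t‖ := by
  rw [← conj_one_sub_vertex, Complex.norm_conj]

theorem sum_vertex_mul {l : ZMod n} (hl : l ≠ 0) : ∑ t, vertex n (l * t) = 0 := by
  simpa [hl, vertex_eq_stdAddChar, mul_comm] using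
    AddChar.sum_mulShift l (ZMod.isPrimitive_stdAddChar n)

theorem z0_injective : Function.Injective (z0 n) := by
  rintro (_ | i) (_ | j) h
  · rfl
  · exact absurd h.symm (vertex_ne_zero j)
  · exact absurd h (vertex_ne_zero i)
  · exact congrArg some (vertex_injective h)

theorem momentOfInertia_z0 : momentOfInertia (mass n m) (z0 n) = n / 2 := by
  simp [momentOfInertia, z0, Fintype.sum_option, mass, norm_vertex, ZMod.card]
  ring

/-- The sum `P_l = ½ ∑_t (1 - cos (l t θ)) / |1 - ζ^t|³` over the chords of the polygon issuing
from one vertex, `ζ = exp (iθ)`; the term `t = 0` vanishes because `x / 0 = 0`. -/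
noncomputable def chordSum (n : ℕ) [NeZero n] (l : ZMod n) : ℝ :=
  1 / 2 * ∑ t : ZMod n, (‖1 - vertex n t‖ ^ 3)⁻¹ * (1 - (vertex n (l * t)).re)

@[simp] theorem chordSum_zero : chordSum n 0 = 0 := by simp [chordSum, vertex_zero]

theorem chordSum_neg (l : ZMod n) : chordSum n (-l) = chordSum n l := by
  simp only [chordSum, neg_mul, ← conj_vertex, Complex.conj_re]

theorem sum_inv_norm_cube_mul_one_sub_vertex (l : ZMod n) :
    ∑ t : ZMod n, ((‖1 - vertex n t‖ ^ 3)⁻¹ : ℝ) * (1 - vertex n (l * t)) =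
      ((2 * chordSum n l : ℝ) : ℂ) := by
  set S := ∑ t : ZMod n, ((‖1 - vertex n t‖ ^ 3)⁻¹ : ℝ) * (1 - vertex n (l * t)) with hS
  have hconj : conj S = S := by
    rw [hS, map_sum, ← Equiv.sum_comp (Equiv.neg (ZMod n))]
    refine Finset.sum_congr rfl fun t _ => ?_
    rw [map_mul, conj_one_sub_vertex, Complex.conj_ofReal, Equiv.neg_apply, mul_neg, neg_neg,
      norm_one_sub_vertex_neg]
  rw [← Complex.conj_eq_iff_re.1 hconj, hS, Complex.re_sum, chordSum, ← mul_assoc,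
    mul_one_div_cancel two_ne_zero, one_mul]
  simp only [Complex.re_ofReal_mul, Complex.sub_re, Complex.one_re]

theorem isCentralConfiguration_z0 (hn : 2 ≤ n) (m : ℝ) :
    IsCentralConfiguration (mass n m) (m + 2 * chordSum n 1) (z0 n) := by
  have : Fact (1 < n) := ⟨hn⟩
  rintro (_ | k)
  · have hsum : ∑ t : ZMod n, vertex n t = 0 := by simpa using sum_vertex_mul (n := n) one_ne_zero
    simp [newtonForce, Fintype.sum_option, z0, mass, norm_vertex, ← Finset.mul_sum, hsum]
  · have hpair (t : ZMod n) : -(‖1 - vertex n t‖ ^ 3)⁻¹ • (vertex n k - vertex n (k + t)) =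
        -vertex n k * (((‖1 - vertex n t‖ ^ 3)⁻¹ : ℝ) * (1 - vertex n t)) := by
      rw [vertex_add, Complex.real_smul]
      push_cast
      ring
    have hsum := sum_inv_norm_cube_mul_one_sub_vertex (n := n) 1
    simp only [one_mul] at hsum
    rw [newtonForce, Fintype.sum_option, ← Equiv.sum_comp (Equiv.addLeft k)]
    simp only [z0, mass, Equiv.coe_addLeft, norm_vertex_sub_vertex_add, sub_zero, norm_vertex,
      mul_one, one_smul, one_mul, hpair, ← Finset.mul_sum, hsum]
    simp
    ring

theorem momentOfInertia_z0_pos : 0 < momentOfInertia (mass n m) (z0 n) := by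
  rw [momentOfInertia_z0]
  have : 0 < n := NeZero.pos n
  positivity

theorem hess_z0 (hn : 2 ≤ n) (m : ℝ) : hess n m (z0 n) = 0 := by
  rw [hess, sqrtIU_eq_normalizedPotential]
  exact (isCentralConfiguration_z0 hn m).hessian_apply_self z0_injective momentOfInertia_z0_pos

theorem hess_rotationDirection (hn : 2 ≤ n) (m : ℝ) : hess n m (rotationDirection n) = 0 := by
  rw [hess, sqrtIU_eq_normalizedPotential]
  refine (isCentralConfiguration_z0 hn m).hessian_apply_skew z0_injective momentOfInertia_z0_pos
    (J := LinearMap.mulLeft ℝ Complex.I) fun x => ?_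
  rw [LinearMap.mulLeft_apply, Complex.inner, mul_assoc, Complex.mul_conj, Complex.I_mul_re,
    Complex.ofReal_im, neg_zero]

/-- The configuration with entry `α ζ^((l + 1) k)` at the `k`-th vertex: a wave with frequency `l`
in the frame that moves along the polygon. -/
noncomputable def planeWave (n : ℕ) [NeZero n] (l : ZMod n) : ℂ →ₗ[ℝ] Config n where
  toFun α := WithLp.toLp 2 fun
    | some k => α * vertex n ((l + 1) * k)
    | none => 0
  map_add' α β := by
    ext i
    cases i <;> simp [add_mul]
  map_smul' c α := by
    ext i
    cases i <;> simp [mul_assoc]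

/-- The displacement of the central body. -/
noncomputable def centerWave (n : ℕ) : ℂ →ₗ[ℝ] Config n where
  toFun c := WithLp.toLp 2 fun
    | some _ => 0
    | none => c
  map_add' α β := by
    ext i
    cases i <;> simp
  map_smul' c α := by
    ext i
    cases i <;> simp

@[simp] theorem planeWave_some (l : ZMod n) (α : ℂ) (k : ZMod n) :
    planeWave n l α (some k) = α * vertex n ((l + 1) * k) := rfl

@[simp] theorem planeWave_none (l : ZMod n) (α : ℂ) : planeWave n l α none = 0 := rfl

omit [NeZero n] in
@[simp] theorem centerWave_some (c : ℂ) (k : ZMod n) : centerWave n c (some k) = 0 := rfl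

omit [NeZero n] in
@[simp] theorem centerWave_none (c : ℂ) : centerWave n c none = c := rfl

omit [NeZero n] in
@[simp] theorem z0_some (k : ZMod n) : z0 n (some k) = vertex n k := rfl

omit [NeZero n] in
@[simp] theorem z0_none : z0 n none = 0 := rfl

theorem invNormHess_complex (d e : ℂ) :
    invNormHess d e = ((2 * ‖d‖ ^ 3)⁻¹ : ℝ) * (e + 3 * (d ^ 2 / (‖d‖ ^ 2 : ℝ)) * conj e) := by
  rcases eq_or_ne d 0 with rfl | hd
  · simp
  have hn : (‖d‖ : ℂ) ≠ 0 := by exact_mod_cast norm_ne_zero_iff.2 hd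
  have hinner : ((inner ℝ d e : ℝ) : ℂ) = (e * conj d + conj e * d) / 2 := by
    rw [Complex.inner, Complex.re_eq_add_conj]
    simp
  have hnorm : conj d * d = (‖d‖ : ℂ) ^ 2 := Complex.conj_mul' d
  rw [invNormHess, Complex.real_smul, Complex.real_smul]
  push_cast
  rw [hinner]
  field_simp
  linear_combination 3 * e * hnorm

theorem invNormHess_of_norm_eq_one {d : ℂ} (hd : ‖d‖ = 1) (e : ℂ) :
    invNormHess d e = 1 / 2 * (e + 3 * d ^ 2 * conj e) := by
  simp [invNormHess_complex, hd]

/-- On the unit circle `(a - b)² / |a - b|² = -a b`. -/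
theorem invNormHess_vertex_sub (k t : ZMod n) (e : ℂ) :
    invNormHess (vertex n k - vertex n (k + t)) e =
      ((‖1 - vertex n t‖ ^ 3)⁻¹ : ℝ) / 2 * (e - 3 * (vertex n k ^ 2 * vertex n t) * conj e) := by
  rw [invNormHess_complex, norm_vertex_sub_vertex_add]
  rcases eq_or_ne ‖1 - vertex n t‖ 0 with h | h
  · simp [h]
  have hsq : ((‖1 - vertex n t‖ ^ 2 : ℝ) : ℂ) = (1 - vertex n t) * (1 - vertex n (-t)) := by
    rw [← conj_one_sub_vertex, Complex.mul_conj']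
    push_cast
    rfl
  have hne : ((‖1 - vertex n t‖ ^ 2 : ℝ) : ℂ) ≠ 0 := by exact_mod_cast pow_ne_zero 2 h
  have hdir : (vertex n k - vertex n (k + t)) ^ 2 / (‖1 - vertex n t‖ ^ 2 : ℝ) =
      -(vertex n k ^ 2 * vertex n t) := by
    rw [div_eq_iff hne, hsq, vertex_add]
    linear_combination (-(vertex n k ^ 2 * (1 - vertex n t))) * vertex_neg_mul_vertex t
  rw [hdir, mul_inv]
  push_cast
  ring

theorem conj_planeWave_some (l : ZMod n) (α : ℂ) (k : ZMod n) :
    conj (planeWave n l α (some k)) = conj α * vertex n (-((l + 1) * k)) := by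
  rw [planeWave_some, map_mul, conj_vertex]

theorem sq_vertex_mul_conj_planeWave_some (l : ZMod n) (α : ℂ) (k : ZMod n) :
    vertex n k ^ 2 * conj (planeWave n l α (some k)) = planeWave n (-l) (conj α) (some k) := by
  rw [conj_planeWave_some, planeWave_some, mul_left_comm, sq, ← vertex_add, ← vertex_add]
  ring_nf

theorem sum_invNormHess_planeWave (l k : ZMod n) (α : ℂ) :
    ∑ j : ZMod n, invNormHess (vertex n k - vertex n j)
        (planeWave n l α (some k) - planeWave n l α (some j)) =
      planeWave n l (chordSum n (l + 1) * α) (some k) +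
        planeWave n (-l) (3 * (chordSum n 1 - chordSum n l) * conj α) (some k) := by
  let K (r t : ZMod n) : ℂ := ((‖1 - vertex n t‖ ^ 3)⁻¹ : ℝ) * (1 - vertex n (r * t))
  have hpair (t : ZMod n) : invNormHess (vertex n k - vertex n (k + t))
      (planeWave n l α (some k) - planeWave n l α (some (k + t))) =
        α / 2 * vertex n ((l + 1) * k) * K (l + 1) t +
          3 / 2 * conj α * vertex n ((-l + 1) * k) * (K 1 t - K (-l) t) := by
    have hshift : vertex n ((l + 1) * (k + t)) =
        vertex n ((l + 1) * k) * vertex n ((l + 1) * t) := by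
      rw [← vertex_add, mul_add]
    have hcross : vertex n t * vertex n (-((l + 1) * t)) = vertex n (-l * t) := by
      rw [← vertex_add]
      ring_nf
    have hdiff : planeWave n l α (some k) - planeWave n l α (some (k + t)) =
        planeWave n l α (some k) * (1 - vertex n ((l + 1) * t)) := by
      rw [planeWave_some, planeWave_some, hshift]
      ring
    have hconj := sq_vertex_mul_conj_planeWave_some l α k
    rw [invNormHess_vertex_sub, hdiff, map_mul, conj_one_sub_vertex]
    simp only [K, one_mul, planeWave_some] at hconj ⊢
    linear_combination ((‖1 - vertex n t‖ ^ 3)⁻¹ : ℝ) / 2 * (-3) *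
      ((vertex n t - vertex n t * vertex n (-((l + 1) * t))) * hconj -
        conj α * vertex n ((-l + 1) * k) * hcross)
  rw [← Equiv.sum_comp (Equiv.addLeft k)]
  simp only [Equiv.coe_addLeft, hpair, Finset.sum_add_distrib, ← Finset.mul_sum,
    Finset.sum_sub_distrib, K, sum_inv_norm_cube_mul_one_sub_vertex, chordSum_neg]
  simp only [planeWave_some]
  push_cast
  ring

/-- The factor by which the Hessian multiplies a wave with frequency `l`, up to `√(n/2)`. -/
noncomputable def diagCoeff (n : ℕ) [NeZero n] (m : ℝ) (l : ZMod n) : ℝ :=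
  chordSum n (l + 1) + 2 * chordSum n 1 + 3 * m / 2

/-- The factor of the wave with frequency `-l` and conjugate amplitude that the Hessian produces
from a wave with frequency `l`, up to `√(n/2)`. -/
noncomputable def conjCoeff (n : ℕ) [NeZero n] (m : ℝ) (l : ZMod n) : ℝ :=
  3 * (chordSum n 1 - chordSum n l) + 3 * m / 2

theorem conjCoeff_neg (l : ZMod n) : conjCoeff n m (-l) = conjCoeff n m l := by
  rw [conjCoeff, conjCoeff, chordSum_neg]

theorem sum_inner_z0_planeWave {l : ZMod n} (hl : l ≠ 0) (α : ℂ) :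
    ∑ i, mass n m i * inner ℝ (z0 n i) (planeWave n l α i) = 0 := by
  have hterm (k : ZMod n) : inner ℝ (vertex n k) (α * vertex n ((l + 1) * k)) =
      (α * vertex n (l * k)).re := by
    rw [Complex.inner, conj_vertex, mul_assoc, ← vertex_add]
    ring_nf
  simp only [Fintype.sum_option, z0_none, inner_zero_left, mul_zero, mass, one_mul, z0_some,
    planeWave_some, hterm, ← Complex.re_sum, ← Finset.mul_sum, sum_vertex_mul hl, Complex.zero_re,
    add_zero]

theorem sum_inner_z0_centerWave (c : ℂ) :
    ∑ i, mass n m i * inner ℝ (z0 n i) (centerWave n c i) = 0 := by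
  simp [Fintype.sum_option]

theorem hess_apply_of_sum_inner_eq_zero (hn : 2 ≤ n) {v : Config n}
    (hv : ∑ i, mass n m i * inner ℝ (z0 n i) (v i) = 0) (i : Body n) :
    hess n m v i = √(n / 2) • (((m + 2 * chordSum n 1) * mass n m i) • v i +
      ((mass n m i * m) • invNormHess (z0 n i) (v i - v none) +
        ∑ k, mass n m i • invNormHess (z0 n i - vertex n k) (v i - v (some k)))) := by
  rw [hess, sqrtIU_eq_normalizedPotential, (isCentralConfiguration_z0 hn m).hessian_apply
    z0_injective momentOfInertia_z0_pos, hv, momentOfInertia_z0, Fintype.sum_option]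
  simp [mass]

theorem hess_planeWave (hn : 2 ≤ n) {l : ZMod n} (hl : l ≠ 0) (α : ℂ) :
    hess n m (planeWave n l α) = √(n / 2) •
      (planeWave n l (diagCoeff n m l * α) + planeWave n (-l) (conjCoeff n m l * conj α) -
        centerWave n (m / 2 * ∑ k, (α * vertex n ((l + 1) * k) +
          3 * (conj α * vertex n ((-l + 1) * k))))) := by
  ext i
  rw [hess_apply_of_sum_inner_eq_zero hn (sum_inner_z0_planeWave hl α), PiLp.smul_apply]
  congr 1
  rcases i with _ | k
  · have hpair (k : ZMod n) : m • invNormHess (0 - vertex n k) (0 - planeWave n l α (some k)) =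
        -(m / 2 * (α * vertex n ((l + 1) * k) + 3 * (conj α * vertex n ((-l + 1) * k)))) := by
      rw [zero_sub, invNormHess_of_norm_eq_one (by rw [norm_neg, norm_vertex]), zero_sub, neg_sq,
        map_neg, Complex.real_smul]
      have hconj := sq_vertex_mul_conj_planeWave_some l α k
      simp only [planeWave_some] at hconj ⊢
      linear_combination (3 / 2) * m * -hconj
    simp only [z0_none, planeWave_none, mass, hpair, PiLp.add_apply, PiLp.sub_apply,
      centerWave_none, Finset.sum_neg_distrib, Finset.mul_sum]
    simp
  · have hconj := sq_vertex_mul_conj_planeWave_some l α k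
    simp only [mass, one_smul, z0_some, sum_invNormHess_planeWave, planeWave_none, sub_zero,
      invNormHess_of_norm_eq_one (norm_vertex k), PiLp.add_apply, PiLp.sub_apply, centerWave_some,
      Complex.real_smul, diagCoeff, conjCoeff]
    simp only [planeWave_some] at hconj ⊢
    push_cast
    linear_combination (3 / 2) * m * hconj

theorem hess_planeWave_of_ne (hn : 2 ≤ n) {l : ZMod n} (h0 : l ≠ 0) (h1 : l ≠ 1) (h2 : l ≠ -1)
    (α : ℂ) :
    hess n m (planeWave n l α) = √(n / 2) •
      (planeWave n l (diagCoeff n m l * α) + planeWave n (-l) (conjCoeff n m l * conj α)) := by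
  have hpos : l + 1 ≠ 0 := fun h => h2 (eq_neg_of_add_eq_zero_left h)
  have hneg : -l + 1 ≠ 0 := fun h => h1 (neg_add_eq_zero.1 h)
  simp [hess_planeWave hn h0, Finset.sum_add_distrib, ← Finset.mul_sum, sum_vertex_mul hpos,
    sum_vertex_mul hneg]

omit [NeZero n] in
theorem two_ne_zero_zmod (hn : 3 ≤ n) : (2 : ZMod n) ≠ 0 := by
  intro h
  have : n ∣ 2 := (ZMod.natCast_eq_zero_iff 2 n).1 (by exact_mod_cast h)
  exact absurd (Nat.le_of_dvd two_pos this) (by omega)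

theorem hess_planeWave_one (hn : 3 ≤ n) (α : ℂ) :
    hess n m (planeWave n 1 α) = √(n / 2) •
      (planeWave n 1 (diagCoeff n m 1 * α) + planeWave n (-1) (conjCoeff n m 1 * conj α) -
        centerWave n (3 * m * n / 2 * conj α)) := by
  have : Fact (1 < n) := ⟨by omega⟩
  have h2 : (1 + 1 : ZMod n) ≠ 0 := one_add_one_eq_two (R := ZMod n) ▸ two_ne_zero_zmod hn
  rw [hess_planeWave (by omega) one_ne_zero]
  simp only [Finset.sum_add_distrib, ← Finset.mul_sum, sum_vertex_mul h2, neg_add_cancel, zero_mul,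
    vertex_zero, Finset.sum_const, Finset.card_univ, ZMod.card, nsmul_eq_mul]
  ring_nf

theorem hess_planeWave_neg_one (hn : 3 ≤ n) (α : ℂ) :
    hess n m (planeWave n (-1) α) = √(n / 2) •
      (planeWave n (-1) (diagCoeff n m (-1) * α) + planeWave n 1 (conjCoeff n m 1 * conj α) -
        centerWave n (m * n / 2 * α)) := by
  have : Fact (1 < n) := ⟨by omega⟩
  have h2 : (1 + 1 : ZMod n) ≠ 0 := one_add_one_eq_two (R := ZMod n) ▸ two_ne_zero_zmod hn
  rw [hess_planeWave (by omega) (neg_ne_zero.2 one_ne_zero), neg_neg, conjCoeff_neg]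
  simp only [Finset.sum_add_distrib, ← Finset.mul_sum, sum_vertex_mul h2, neg_add_cancel, zero_mul,
    vertex_zero, Finset.sum_const, Finset.card_univ, ZMod.card, nsmul_eq_mul]
  ring_nf

theorem hess_centerWave (hn : 3 ≤ n) (c : ℂ) :
    hess n m (centerWave n c) = √(n / 2) •
      (centerWave n ((m + 2 * chordSum n 1 + n / 2) * m * c) - planeWave n 1 (3 * m / 2 * conj c) -
        planeWave n (-1) (m / 2 * c)) := by
  ext i
  rw [hess_apply_of_sum_inner_eq_zero (by omega) (sum_inner_z0_centerWave c), PiLp.smul_apply]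
  congr 1
  rcases i with _ | k
  · have hpair (k : ZMod n) : m • invNormHess (0 - vertex n k) (c - 0) =
        m / 2 * c + 3 * m / 2 * conj c * vertex n (2 * k) := by
      rw [zero_sub, invNormHess_of_norm_eq_one (by rw [norm_neg, norm_vertex]), neg_sq, sub_zero,
        sq, ← vertex_add, ← two_mul, Complex.real_smul]
      ring
    simp only [z0_none, centerWave_none, centerWave_some, mass, hpair, Finset.sum_add_distrib,
      ← Finset.mul_sum, sum_vertex_mul (two_ne_zero_zmod hn)]
    simp [ZMod.card]
    ring
  · have hsq : vertex n ((1 + 1) * k) = vertex n k ^ 2 := by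
      rw [sq, ← vertex_add, one_add_one_eq_two, two_mul]
    simp [mass, invNormHess_of_norm_eq_one (norm_vertex k), hsq, vertex_zero]
    ring

end Polygon

/-! ### Radial and tangential modes -/

section Modes

open ComplexConjugate

variable {n : ℕ} [NeZero n] {m : ℝ}

/-- The displacements of the vertices along their position vectors with the amplitudes
`Re (ω ζ^(-lk))`, so that `ω = 1` gives `v_l` and `ω = i` gives `w_l'`. -/
noncomputable def radialMode (n : ℕ) [NeZero n] (l : ZMod n) : ℂ →ₗ[ℝ] Config n where
  toFun ω := WithLp.toLp 2 fun
    | some k => ((ω * vertex n (-(l * k))).re : ℂ) * vertex n k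
    | none => 0
  map_add' α β := by
    ext i
    cases i <;> simp [add_mul]
  map_smul' c α := by
    ext i
    cases i <;> simp [mul_assoc]

/-- The displacements of the vertices perpendicular to their position vectors with the amplitudes
`Im (ω ζ^(-lk))`, so that `ω = 1` gives `v_l'` and `ω = i` gives `w_l`. -/
noncomputable def tangentialMode (n : ℕ) [NeZero n] (l : ZMod n) : ℂ →ₗ[ℝ] Config n where
  toFun ω := WithLp.toLp 2 fun
    | some k => ((ω * vertex n (-(l * k))).im : ℂ) * (Complex.I * vertex n k)
    | none => 0
  map_add' α β := by
    ext i
    cases i <;> simp [add_mul]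
  map_smul' c α := by
    ext i
    cases i <;> simp [mul_assoc]

@[simp] theorem radialMode_some (l : ZMod n) (ω : ℂ) (k : ZMod n) :
    radialMode n l ω (some k) = ((ω * vertex n (-(l * k))).re : ℂ) * vertex n k := rfl

@[simp] theorem radialMode_none (l : ZMod n) (ω : ℂ) : radialMode n l ω none = 0 := rfl

@[simp] theorem tangentialMode_some (l : ZMod n) (ω : ℂ) (k : ZMod n) :
    tangentialMode n l ω (some k) =
      ((ω * vertex n (-(l * k))).im : ℂ) * (Complex.I * vertex n k) := rfl

@[simp] theorem tangentialMode_none (l : ZMod n) (ω : ℂ) : tangentialMode n l ω none = 0 := rfl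

theorem radialMode_eq_planeWave (l : ZMod n) (ω : ℂ) :
    radialMode n l ω = planeWave n l (conj ω / 2) + planeWave n (-l) (ω / 2) := by
  ext i
  rcases i with _ | k
  · simp
  · simp only [radialMode_some, PiLp.add_apply, planeWave_some, Complex.re_eq_add_conj, map_mul,
      conj_vertex, add_mul, neg_mul, one_mul, vertex_add, neg_neg]
    ring

theorem tangentialMode_eq_planeWave (l : ZMod n) (ω : ℂ) :
    tangentialMode n l ω = planeWave n l (-(conj ω / 2)) + planeWave n (-l) (ω / 2) := by
  ext i
  rcases i with _ | k
  · simp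
  · simp only [tangentialMode_some, PiLp.add_apply, planeWave_some, Complex.im_eq_sub_conj, map_mul,
      conj_vertex, add_mul, neg_mul, one_mul, vertex_add, neg_neg]
    field_simp
    ring

theorem planeWave_eq_radialMode_sub_tangentialMode (l : ZMod n) (α : ℂ) :
    planeWave n l α = radialMode n l (conj α) - tangentialMode n l (conj α) := by
  simp only [radialMode_eq_planeWave, tangentialMode_eq_planeWave, Complex.conj_conj,
    add_sub_add_right_eq_sub, ← map_sub]
  ring_nf

theorem radialMode_neg (l : ZMod n) (ω : ℂ) : radialMode n (-l) ω = radialMode n l (conj ω) := by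
  rw [radialMode_eq_planeWave, radialMode_eq_planeWave, neg_neg, Complex.conj_conj, add_comm]

theorem tangentialMode_neg (l : ZMod n) (ω : ℂ) :
    tangentialMode n (-l) ω = -tangentialMode n l (conj ω) := by
  rw [tangentialMode_eq_planeWave, tangentialMode_eq_planeWave, neg_neg, Complex.conj_conj, map_neg,
    map_neg, neg_add, neg_neg, add_comm]

theorem vertex_natCast_mul (l : ℕ) (k : ZMod n) : vertex n (l * k) =
    Real.cos (l * vertexAngle n k) + Real.sin (l * vertexAngle n k) * Complex.I := by
  rw [← nsmul_eq_mul, vertex_eq_stdAddChar, AddChar.map_nsmul_eq_pow, ← vertex_eq_stdAddChar,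
    vertex, ← Complex.exp_nat_mul, Complex.ofReal_cos, Complex.ofReal_sin, ← Complex.exp_mul_I]
  push_cast
  ring_nf

theorem re_vertex_natCast_mul (l : ℕ) (k : ZMod n) :
    (vertex n (l * k)).re = Real.cos (l * vertexAngle n k) := by
  rw [vertex_natCast_mul]
  simp [-Complex.ofReal_cos, -Complex.ofReal_sin]

theorem im_vertex_natCast_mul (l : ℕ) (k : ZMod n) :
    (vertex n (l * k)).im = Real.sin (l * vertexAngle n k) := by
  rw [vertex_natCast_mul]
  simp [-Complex.ofReal_cos, -Complex.ofReal_sin]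

theorem modeV_eq_radialMode (l : ℕ) : modeV n l = radialMode n l 1 := by
  ext i
  rcases i with _ | k <;> simp [modeV, ← conj_vertex, re_vertex_natCast_mul]

theorem modeW'_eq_radialMode (l : ℕ) : modeW' n l = radialMode n l Complex.I := by
  ext i
  rcases i with _ | k <;> simp [modeW', ← conj_vertex, im_vertex_natCast_mul]

theorem modeV'_eq_tangentialMode (l : ℕ) : modeV' n l = tangentialMode n l 1 := by
  ext i
  rcases i with _ | k <;> simp [modeV', ← conj_vertex, im_vertex_natCast_mul]

theorem modeW_eq_tangentialMode (l : ℕ) : modeW n l = tangentialMode n l Complex.I := by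
  ext i
  rcases i with _ | k <;> simp [modeW, ← conj_vertex, re_vertex_natCast_mul]

omit [NeZero n] in
theorem centerX_eq_centerWave : centerX n = centerWave n 1 := by
  ext i
  cases i <;> rfl

omit [NeZero n] in
theorem centerY_eq_centerWave : centerY n = centerWave n Complex.I := by
  ext i
  cases i <;> rfl

theorem apply_eq_re_smul_add_im_smul {E : Type*} [AddCommGroup E] [Module ℝ E] (φ : ℂ →ₗ[ℝ] E)
    (ω : ℂ) : φ ω = ω.re • φ 1 + ω.im • φ Complex.I := by
  rw [← map_smul, ← map_smul, ← map_add]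
  simp

theorem inner_radialMode_tangentialMode (l l' : ZMod n) (ω ω' : ℂ) :
    inner ℝ (radialMode n l ω) (tangentialMode n l' ω') = 0 := by
  refine Finset.sum_eq_zero fun i _ => ?_
  rcases i with _ | k
  · simp
  · simp only [radialMode_some, tangentialMode_some, ← Complex.real_smul, real_inner_smul_left,
      real_inner_smul_right, Complex.inner, mul_assoc, Complex.mul_conj, Complex.I_mul_re,
      Complex.ofReal_im, neg_zero, mul_zero]

theorem inner_radialMode_centerWave (l : ZMod n) (ω c : ℂ) :
    inner ℝ (radialMode n l ω) (centerWave n c) = 0 := by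
  simp [PiLp.inner_apply, Fintype.sum_option]

theorem inner_tangentialMode_centerWave (l : ZMod n) (ω c : ℂ) :
    inner ℝ (tangentialMode n l ω) (centerWave n c) = 0 := by
  simp [PiLp.inner_apply, Fintype.sum_option]

/-! ### The action of the dihedral group -/

/-- `φ` intertwines the action of `D_n` on `ℂ` in which `r` is the rotation by `lθ` and `s` is the
complex conjugation with the action on configurations. -/
def IsDihedralEquivariant (l : ZMod n) (φ : ℂ →ₗ[ℝ] Config n) : Prop :=
  (∀ a ω, rotationAction n a (φ ω) = φ (vertex n (l * a) * ω)) ∧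
    ∀ ω, reflectionAction n (φ ω) = φ (conj ω)

theorem isDihedralEquivariant_radialMode (l : ZMod n) :
    IsDihedralEquivariant l (radialMode n l) := by
  refine ⟨fun a ω => ?_, fun ω => ?_⟩ <;> ext i <;> rcases i with _ | k
  · simp [rotationAction]
  · have hsub : -(l * (k - a)) = l * a + -(l * k) := by ring
    change vertex n a * radialMode n l ω (some (k - a)) = _
    rw [radialMode_some, radialMode_some, mul_left_comm, ← vertex_add, add_sub_cancel, hsub,
      vertex_add, mul_left_comm, mul_assoc]
  · simp [reflectionAction]
  · change conj (radialMode n l ω (some (-k))) = _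
    rw [radialMode_some, radialMode_some, map_mul, Complex.conj_ofReal, conj_vertex, neg_neg,
      mul_neg, neg_neg, ← Complex.conj_re, map_mul, conj_vertex]

theorem isDihedralEquivariant_tangentialMode (l : ZMod n) :
    IsDihedralEquivariant l (tangentialMode n l) := by
  refine ⟨fun a ω => ?_, fun ω => ?_⟩ <;> ext i <;> rcases i with _ | k
  · simp [rotationAction]
  · have hsub : -(l * (k - a)) = l * a + -(l * k) := by ring
    change vertex n a * tangentialMode n l ω (some (k - a)) = _
    rw [tangentialMode_some, tangentialMode_some, mul_left_comm, mul_left_comm (vertex n a),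
      ← vertex_add, add_sub_cancel, hsub, vertex_add, mul_left_comm ω, ← mul_assoc (vertex n _)]
  · simp [reflectionAction]
  · change conj (tangentialMode n l ω (some (-k))) = _
    rw [tangentialMode_some, tangentialMode_some, map_mul, map_mul, Complex.conj_ofReal,
      conj_vertex, neg_neg, Complex.conj_I, mul_neg, neg_neg, ← conj_vertex n (l * k), ← map_mul,
      Complex.conj_im]
    push_cast
    ring

theorem isDihedralEquivariant_centerWave : IsDihedralEquivariant 1 (centerWave n) := by
  refine ⟨fun a ω => ?_, fun ω => ?_⟩ <;> ext i <;>
    cases i <;> simp [rotationAction, reflectionAction]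

theorem IsDihedralEquivariant.actsByMatrix {l : ℕ} {φ : ℂ →ₗ[ℝ] Config n}
    (hφ : IsDihedralEquivariant l φ) : ActsByMatrix n (dihedralRho n l) ![φ 1, φ Complex.I] := by
  have hr (a : ZMod n) (ω : ℂ) : dihedralRep n (.r a) (φ ω) =
      (Real.cos (l * vertexAngle n a) * ω.re - Real.sin (l * vertexAngle n a) * ω.im) • φ 1 +
        (Real.cos (l * vertexAngle n a) * ω.im + Real.sin (l * vertexAngle n a) * ω.re) •
          φ Complex.I := by
    rw [← re_vertex_natCast_mul, ← im_vertex_natCast_mul, ← Complex.mul_re, ← Complex.mul_im,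
      ← apply_eq_re_smul_add_im_smul]
    exact hφ.1 a ω
  have hsr (a : ZMod n) (ω : ℂ) : dihedralRep n (.sr a) (φ ω) =
      (Real.cos (l * vertexAngle n a) * ω.re - Real.sin (l * vertexAngle n a) * ω.im) • φ 1 -
        (Real.cos (l * vertexAngle n a) * ω.im + Real.sin (l * vertexAngle n a) * ω.re) •
          φ Complex.I := by
    have hmul : dihedralRep n (.sr a) (φ ω) = reflectionAction n (dihedralRep n (.r a) (φ ω)) := rfl
    rw [hmul, hr, map_add, map_smul, map_smul, hφ.2, hφ.2, map_one, Complex.conj_I, map_neg,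
      smul_neg, ← sub_eq_add_neg]
  rintro (a | a) j <;> fin_cases j <;>
    simp [hr, hsr, dihedralRho, Fin.sum_univ_two, sub_eq_add_neg]

theorem IsDihedralEquivariant.actsByChar {l : ZMod n} {φ : ℂ →ₗ[ℝ] Config n}
    (hφ : IsDihedralEquivariant l φ) {e b : ℝ} (he : ∀ a, vertex n (l * a) = (e ^ a.val : ℝ))
    {ω : ℂ} (hb : conj ω = b * ω) : ActsByChar n (dihedralChar n e b) (φ ω) := by
  rintro (a | a)
  · change rotationAction n a (φ ω) = e ^ a.val • φ ω
    rw [hφ.1, he, ← map_smul, Complex.real_smul]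
  · change reflectionAction n (rotationAction n a (φ ω)) = (b * e ^ a.val) • φ ω
    rw [hφ.1, hφ.2, he, ← map_smul, Complex.real_smul, map_mul, Complex.conj_ofReal, hb]
    push_cast
    ring_nf

theorem vertex_half_mul (hn : Even n) (k : ZMod n) :
    vertex n ((n / 2 : ℕ) * k) = ((-1) ^ k.val : ℝ) := by
  have hn0 : (n : ℝ) ≠ 0 := NeZero.ne _
  have hangle : ((n / 2 : ℕ) : ℝ) * vertexAngle n k = k.val * Real.pi := by
    rw [Nat.cast_div hn.two_dvd two_ne_zero, vertexAngle]
    push_cast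
    field_simp
  rw [vertex_natCast_mul, hangle, Real.sin_nat_mul_pi, Real.cos_nat_mul_pi]
  simp

theorem isSymmetryAdapted : IsSymmetryAdapted n := by
  have hone : conj (1 : ℂ) = (1 : ℝ) * 1 := by simp
  have hI : conj Complex.I = (-1 : ℝ) * Complex.I := by simp
  have hzero (k : ZMod n) : vertex n ((0 : ℕ) * k) = ((1 : ℝ) ^ k.val : ℝ) := by simp [vertex_zero]
  have hcenter : IsDihedralEquivariant ((1 : ℕ) : ZMod n) (centerWave n) := by
    rw [Nat.cast_one]
    exact isDihedralEquivariant_centerWave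
  simp only [IsSymmetryAdapted, modeV_eq_radialMode, modeW'_eq_radialMode, modeW_eq_tangentialMode,
    modeV'_eq_tangentialMode, centerX_eq_centerWave, centerY_eq_centerWave]
  exact ⟨(isDihedralEquivariant_radialMode _).actsByChar hzero hone,
    (isDihedralEquivariant_tangentialMode _).actsByChar hzero hI,
    fun hn => ⟨(isDihedralEquivariant_radialMode _).actsByChar (vertex_half_mul hn) hone,
      (isDihedralEquivariant_tangentialMode _).actsByChar (vertex_half_mul hn) hI⟩,
    fun l _ _ => ⟨(isDihedralEquivariant_radialMode _).actsByMatrix,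
      (isDihedralEquivariant_tangentialMode _).actsByMatrix⟩,
    hcenter.actsByMatrix⟩

end Modes

/-! ### The blocks of the Hessian -/

section Blocks

open ComplexConjugate

variable {n : ℕ} [NeZero n] {m : ℝ}

/-- The matrix of the Hessian on a radial and a tangential mode of frequency `l ≠ 0, ±1` with the
same amplitude. -/
noncomputable def modeBlock (n : ℕ) [NeZero n] (m : ℝ) (l : ZMod n) : Matrix (Fin 2) (Fin 2) ℝ :=
  let a := diagCoeff n m l
  let d := diagCoeff n m (-l)
  let b := conjCoeff n m l
  √(n / 2) • !![(a + d) / 2 + b, (d - a) / 2; (d - a) / 2, (a + d) / 2 - b]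

/-- The matrix of the Hessian on a radial mode of frequency `1`, a tangential mode of frequency `1`
and a displacement of the central body with the same amplitude. -/
noncomputable def firstBlock (n : ℕ) [NeZero n] (m : ℝ) : Matrix (Fin 3) (Fin 3) ℝ :=
  let a := diagCoeff n m 1
  let d := diagCoeff n m (-1)
  let b := conjCoeff n m 1
  √(n / 2) • !![(a + d) / 2 + b, (d - a) / 2, -2 * m;
    (d - a) / 2, (a + d) / 2 - b, m;
    -m * n, m * n / 2, (m + 2 * chordSum n 1 + n / 2) * m]

theorem hess_radialMode_tangentialMode (hn : 2 ≤ n) {l : ZMod n} (h0 : l ≠ 0) (h1 : l ≠ 1)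
    (h2 : l ≠ -1) (ω : ℂ) (j : Fin 2) :
    hess n m (![radialMode n l ω, tangentialMode n l ω] j) =
      ∑ i, modeBlock n m l i j • ![radialMode n l ω, tangentialMode n l ω] i := by
  have hneg := hess_planeWave_of_ne (m := m) hn (l := -l) (neg_ne_zero.2 h0)
    (fun h => h2 (neg_eq_iff_eq_neg.1 h)) (fun h => h1 (neg_injective h))
  rw [Fin.sum_univ_two]
  fin_cases j <;>
    simp only [modeBlock, radialMode_eq_planeWave, tangentialMode_eq_planeWave, Fin.zero_eta,
      Fin.mk_one, Matrix.cons_val_zero, Matrix.cons_val_one, Matrix.smul_apply, Matrix.of_apply,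
      Matrix.cons_val', Matrix.cons_val_fin_one, smul_eq_mul, mul_smul, map_add,
      hess_planeWave_of_ne hn h0 h1 h2, hneg, neg_neg, conjCoeff_neg, ← smul_add] <;>
    congr 1 <;> ext i <;> rcases i with _ | k <;>
    simp [map_ofNat (starRingEnd ℂ)] <;> ring

theorem hess_radialMode_tangentialMode_centerWave (hn : 3 ≤ n) (ω : ℂ) (j : Fin 3) :
    hess n m (![radialMode n 1 ω, tangentialMode n 1 ω, centerWave n ω] j) =
      ∑ i, firstBlock n m i j • ![radialMode n 1 ω, tangentialMode n 1 ω, centerWave n ω] i := by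
  have hB : conjCoeff n m 1 = 3 * m / 2 := by rw [conjCoeff, sub_self, mul_zero, zero_add]
  rw [Fin.sum_univ_three]
  fin_cases j <;>
    simp only [firstBlock, radialMode_eq_planeWave, tangentialMode_eq_planeWave, Fin.zero_eta,
      Fin.mk_one, Fin.reduceFinMk, Matrix.cons_val_zero, Matrix.cons_val_one, Matrix.cons_val,
      Matrix.smul_apply, Matrix.of_apply, Matrix.cons_val', Matrix.cons_val_fin_one, smul_eq_mul,
      mul_smul, map_add, hess_planeWave_one hn, hess_planeWave_neg_one hn, hess_centerWave hn,
      ← smul_add] <;>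
    congr 1 <;> ext i <;> rcases i with _ | k <;>
    simp [hB, map_ofNat (starRingEnd ℂ)] <;> ring

omit [NeZero n] in
theorem natCast_ne_zero_of_lt {a : ℕ} (h0 : 0 < a) (h1 : a < n) : (a : ZMod n) ≠ 0 := fun h =>
  Nat.not_dvd_of_pos_of_lt h0 h1 ((ZMod.natCast_eq_zero_iff a n).1 h)

omit [NeZero n] in
theorem natCast_mode_ne {l : ℕ} (hl : 2 ≤ l) (hl' : 2 * l ≤ n) :
    (l : ZMod n) ≠ 0 ∧ (l : ZMod n) ≠ 1 ∧ (l : ZMod n) ≠ -1 := by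
  refine ⟨natCast_ne_zero_of_lt (by omega) (by omega), fun h => ?_, fun h => ?_⟩
  · refine natCast_ne_zero_of_lt (n := n) (a := l - 1) (by omega) (by omega) ?_
    rw [Nat.cast_sub (by omega), h, Nat.cast_one, sub_self]
  · refine natCast_ne_zero_of_lt (n := n) (a := l + 1) (by omega) (by omega) ?_
    rw [Nat.cast_add, h, Nat.cast_one, neg_add_cancel]

theorem hess_modeV_modeV' {l : ℕ} (hl : 2 ≤ l) (hl' : 2 * l ≤ n) (j : Fin 2) :
    hess n m (![modeV n l, modeV' n l] j) =
      ∑ i, modeBlock n m l i j • ![modeV n l, modeV' n l] i := by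
  obtain ⟨h0, h1, h2⟩ := natCast_mode_ne hl hl'
  rw [modeV_eq_radialMode, modeV'_eq_tangentialMode]
  exact hess_radialMode_tangentialMode (by omega) h0 h1 h2 1 j

theorem hess_modeW'_modeW {l : ℕ} (hl : 2 ≤ l) (hl' : 2 * l ≤ n) (j : Fin 2) :
    hess n m (![modeW' n l, modeW n l] j) =
      ∑ i, modeBlock n m l i j • ![modeW' n l, modeW n l] i := by
  obtain ⟨h0, h1, h2⟩ := natCast_mode_ne hl hl'
  rw [modeW'_eq_radialMode, modeW_eq_tangentialMode]
  exact hess_radialMode_tangentialMode (by omega) h0 h1 h2 Complex.I j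

theorem hess_modeV_modeV'_centerX (hn : 3 ≤ n) (j : Fin 3) :
    hess n m (![modeV n 1, modeV' n 1, centerX n] j) =
      ∑ i, firstBlock n m i j • ![modeV n 1, modeV' n 1, centerX n] i := by
  rw [modeV_eq_radialMode, modeV'_eq_tangentialMode, centerX_eq_centerWave, Nat.cast_one]
  exact hess_radialMode_tangentialMode_centerWave hn 1 j

theorem hess_modeW'_modeW_centerY (hn : 3 ≤ n) (j : Fin 3) :
    hess n m (![modeW' n 1, modeW n 1, centerY n] j) =
      ∑ i, firstBlock n m i j • ![modeW' n 1, modeW n 1, centerY n] i := by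
  rw [modeW'_eq_radialMode, modeW_eq_tangentialMode, centerY_eq_centerWave, Nat.cast_one]
  exact hess_radialMode_tangentialMode_centerWave hn Complex.I j

theorem coeffMatrix_eq {κ : Type} [Fintype κ] {T : Config n →L[ℝ] Config n} {u : κ → Config n}
    {M : Matrix κ κ ℝ} (hu : ∀ i, u i ≠ 0) (ho : Pairwise fun i j => inner ℝ (u i) (u j) = 0)
    (hT : ∀ j, T (u j) = ∑ i, M i j • u i) : coeffMatrix T u = M := by
  ext i j
  have hinner : inner ℝ (u i) (T (u j)) = M i j * inner ℝ (u i) (u i) := by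
    rw [hT, inner_sum, Finset.sum_eq_single i, inner_smul_right]
    · intro k _ hk
      rw [inner_smul_right, ho hk.symm, mul_zero]
    · simp
  rw [coeffMatrix, Matrix.of_apply, hinner,
    mul_div_cancel_right₀ _ (inner_self_ne_zero.2 (hu i))]

theorem coeffMatrix_pair {T : Config n →L[ℝ] Config n} {u v : Config n} (hu : u ≠ 0) (hv : v ≠ 0)
    (h : inner ℝ u v = 0) {M : Matrix (Fin 2) (Fin 2) ℝ}
    (hT : ∀ j, T (![u, v] j) = ∑ i, M i j • ![u, v] i) : coeffMatrix T ![u, v] = M := by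
  have h' : inner ℝ v u = 0 := by rw [real_inner_comm, h]
  refine coeffMatrix_eq (fun i => ?_) (fun i j hij => ?_) hT
  · fin_cases i <;> assumption
  · fin_cases i <;> fin_cases j <;> first | exact absurd rfl hij | assumption

theorem modeV_ne_zero (l : ℕ) : modeV n l ≠ 0 := fun h => by
  simpa [modeV, vertexAngle, vertex_zero] using congrArg (· (some 0)) h

theorem modeW_ne_zero (l : ℕ) : modeW n l ≠ 0 := fun h => by
  simpa [modeW, vertexAngle, vertex_zero] using congrArg (· (some 0)) h

theorem sin_mul_vertexAngle_one_pos {l : ℕ} (hl : 0 < l) (hl' : 2 * l < n) :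
    0 < Real.sin (l * vertexAngle n 1) := by
  have : Fact (1 < n) := ⟨by omega⟩
  have hn0 : (0 : ℝ) < n := by exact_mod_cast NeZero.pos n
  have hl1 : (2 * l : ℝ) < n := by exact_mod_cast hl'
  rw [vertexAngle, ZMod.val_one]
  refine Real.sin_pos_of_pos_of_lt_pi (by positivity) ?_
  rw [mul_div_assoc', div_lt_iff₀ hn0]
  push_cast
  nlinarith [Real.pi_pos]

theorem modeV'_ne_zero {l : ℕ} (hl : 0 < l) (hl' : 2 * l < n) : modeV' n l ≠ 0 := fun h => by
  have hs : (Real.sin (l * vertexAngle n 1) : ℂ) ≠ 0 := by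
    exact_mod_cast (sin_mul_vertexAngle_one_pos hl hl').ne'
  exact mul_ne_zero (neg_ne_zero.2 hs) (mul_ne_zero Complex.I_ne_zero (vertex_ne_zero 1))
    (congrArg (· (some 1)) h)

omit [NeZero n] in
theorem centerX_ne_zero : centerX n ≠ 0 := fun h => one_ne_zero (congrArg (· none) h)

theorem blockA1_eq (hn : 3 ≤ n) : blockA1 n m = firstBlock n m := by
  have h1 := modeV_ne_zero (n := n) 1
  have h2 := modeV'_ne_zero (n := n) one_pos (by omega)
  have h3 := centerX_ne_zero (n := n)
  have h12 : inner ℝ (modeV n 1) (modeV' n 1) = 0 := by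
    rw [modeV_eq_radialMode, modeV'_eq_tangentialMode, inner_radialMode_tangentialMode]
  have h13 : inner ℝ (modeV n 1) (centerX n) = 0 := by
    rw [modeV_eq_radialMode, centerX_eq_centerWave, inner_radialMode_centerWave]
  have h23 : inner ℝ (modeV' n 1) (centerX n) = 0 := by
    rw [modeV'_eq_tangentialMode, centerX_eq_centerWave, inner_tangentialMode_centerWave]
  have h21 := (real_inner_comm _ _).trans h12
  have h31 := (real_inner_comm _ _).trans h13
  have h32 := (real_inner_comm _ _).trans h23
  refine coeffMatrix_eq (fun i => ?_) (fun i j hij => ?_) (hess_modeV_modeV'_centerX hn)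
  · fin_cases i <;> assumption
  · fin_cases i <;> fin_cases j <;> first | exact absurd rfl hij | assumption

theorem blockA_eq {l : ℕ} (hl : 2 ≤ l) (hl' : 2 * l < n) :
    blockA n m l = modeBlock n m l := by
  rw [blockA, if_neg hl'.ne]
  refine coeffMatrix_pair (modeV_ne_zero l) (modeV'_ne_zero (by omega) hl') ?_
    (hess_modeV_modeV' hl hl'.le)
  rw [modeV_eq_radialMode, modeV'_eq_tangentialMode]
  exact inner_radialMode_tangentialMode _ _ _ _

theorem sin_mul_vertexAngle_eq_zero {l : ℕ} (h : l = 0 ∨ 2 * l = n) (k : ZMod n) :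
    Real.sin (l * vertexAngle n k) = 0 := by
  rcases h with h | h
  · simp [h]
  · have hl : n / 2 = l := by omega
    have him := im_vertex_natCast_mul (n := n) l k
    rw [← hl, vertex_half_mul ⟨l, by omega⟩, Complex.ofReal_im] at him
    rw [← hl, ← him]

theorem modeV'_eq_zero {l : ℕ} (h : l = 0 ∨ 2 * l = n) : modeV' n l = 0 := by
  ext i
  rcases i with _ | k
  · rfl
  · simp only [modeV', sin_mul_vertexAngle_eq_zero h, Complex.ofReal_zero, neg_zero, zero_mul,
      PiLp.zero_apply]

theorem modeW'_eq_zero {l : ℕ} (h : l = 0 ∨ 2 * l = n) : modeW' n l = 0 := by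
  ext i
  rcases i with _ | k
  · rfl
  · simp only [modeW', sin_mul_vertexAngle_eq_zero h, Complex.ofReal_zero, zero_mul,
      PiLp.zero_apply]

theorem hess_modeV_half (hn : 3 ≤ n) {l : ℕ} (hl : 2 * l = n) :
    hess n m (modeV n l) = modeBlock n m l 0 0 • modeV n l := by
  have h := hess_modeV_modeV' (m := m) (l := l) (by omega) hl.le 0
  simpa [Fin.sum_univ_two, modeV'_eq_zero (Or.inr hl)] using h

theorem hess_modeW_half (hn : 3 ≤ n) {l : ℕ} (hl : 2 * l = n) :
    hess n m (modeW n l) = modeBlock n m l 1 1 • modeW n l := by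
  have h := hess_modeW'_modeW (m := m) (l := l) (by omega) hl.le 1
  simpa [Fin.sum_univ_two, modeW'_eq_zero (Or.inr hl)] using h

theorem scalarBlock_eq {v : Config n} {c : ℝ} (hv : v ≠ 0) (h : hess n m v = c • v) :
    scalarBlock n m v = c := by
  rw [scalarBlock, h, inner_smul_right, mul_div_cancel_right₀ _ (inner_self_ne_zero.2 hv)]

theorem blockA_half (hn : 3 ≤ n) {l : ℕ} (hl : 2 * l = n) : blockA n m l =
    Matrix.diagonal ![scalarBlock n m (modeV n l), scalarBlock n m (modeW n l)] := by
  have hV := hess_modeV_half (m := m) hn hl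
  have hW := hess_modeW_half (m := m) hn hl
  rw [blockA, if_pos hl, scalarBlock_eq (modeV_ne_zero l) hV, scalarBlock_eq (modeW_ne_zero l) hW]
  refine coeffMatrix_pair (modeV_ne_zero l) (modeW_ne_zero l) ?_ fun j => ?_
  · rw [modeV_eq_radialMode, modeW_eq_tangentialMode]
    exact inner_radialMode_tangentialMode _ _ _ _
  · fin_cases j <;> simp [Fin.sum_univ_two, hV, hW]

theorem det_blockA {l : ℕ} (hl : 2 ≤ l) (hl' : 2 * l ≤ n) :
    (blockA n m l).det =
      n / 2 * (diagCoeff n m l * diagCoeff n m (-l) - conjCoeff n m l ^ 2) := by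
  have hsq : √(n / 2 : ℝ) ^ 2 = n / 2 := Real.sq_sqrt (by positivity)
  rcases hl'.lt_or_eq with h | h
  · rw [blockA_eq hl h, modeBlock, Matrix.det_smul, Matrix.det_fin_two_of, Fintype.card_fin, hsq]
    ring
  · have hn : 3 ≤ n := by omega
    have hneg : (-l : ZMod n) = l := by
      rw [neg_eq_iff_add_eq_zero, ← two_mul]
      rw [← Nat.cast_two, ← Nat.cast_mul, h, ZMod.natCast_self]
    rw [blockA_half hn h, Matrix.det_diagonal, Fin.prod_univ_two, ← hsq, hneg,
      Matrix.cons_val_zero, Matrix.cons_val_one, Matrix.cons_val_fin_one,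
      scalarBlock_eq (modeV_ne_zero l) (hess_modeV_half hn h),
      scalarBlock_eq (modeW_ne_zero l) (hess_modeW_half hn h)]
    simp [modeBlock, hneg]
    ring

theorem det_blockA1 (hn : 3 ≤ n) : (blockA1 n m).det = √(n / 2) ^ 3 * (m * (m + 2 * chordSum n 1) *
    ((chordSum n 2 + 2 * chordSum n 1) * (n / 2 + 2 * chordSum n 1) +
      3 * m / 2 * (chordSum n 2 + 4 * chordSum n 1 - n))) := by
  rw [blockA1_eq hn, firstBlock, Matrix.det_smul, Matrix.det_fin_three, Fintype.card_fin]
  simp only [diagCoeff, conjCoeff, one_add_one_eq_two, neg_add_cancel, chordSum_zero, sub_self,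
    Matrix.of_apply, Matrix.cons_val_zero, Matrix.cons_val_one, Matrix.cons_val, Matrix.cons_val',
    Matrix.cons_val_fin_one]
  ring

end Blocks

/-! ### The symmetry-adapted basis -/

section Basis

variable {n : ℕ} [NeZero n]

theorem config_eq_sum (x : Config n) : x = centerWave n (x none) + ∑ l : ZMod n,
    planeWave n l ((n : ℂ)⁻¹ * ∑ j, x (some j) * vertex n (-j) * vertex n (-(l * j))) := by
  ext i
  rcases i with _ | k
  · simp
  · have hterm (l : ZMod n) : planeWave n l
        ((n : ℂ)⁻¹ * ∑ j, x (some j) * vertex n (-j) * vertex n (-(l * j))) (some k) =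
        (n : ℂ)⁻¹ * vertex n k * ∑ j, x (some j) * vertex n (-j) * vertex n ((k - j) * l) := by
      rw [planeWave_some, mul_assoc, mul_assoc, Finset.sum_mul, Finset.mul_sum (a := vertex n k)]
      refine congrArg ((n : ℂ)⁻¹ * ·) (Finset.sum_congr rfl fun j _ => ?_)
      rw [mul_assoc, ← vertex_add, mul_left_comm, ← vertex_add]
      ring_nf
    have horth (j : ZMod n) (hj : j ≠ k) :
        ∑ l, x (some j) * vertex n (-j) * vertex n ((k - j) * l) = 0 := by
      rw [← Finset.mul_sum, sum_vertex_mul (sub_ne_zero.2 hj.symm), mul_zero]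
    have hn0 : (n : ℂ) ≠ 0 := by exact_mod_cast NeZero.ne n
    simp only [PiLp.add_apply, centerWave_some, zero_add, WithLp.ofLp_sum, Finset.sum_apply, hterm]
    rw [← Finset.mul_sum, Finset.sum_comm, Fintype.sum_eq_single k horth]
    simp only [sub_self, zero_mul, vertex_zero, mul_one, Finset.sum_const, Finset.card_univ,
      ZMod.card, nsmul_eq_mul]
    field_simp
    rw [mul_assoc, mul_comm (vertex n k), vertex_neg_mul_vertex, mul_one]

omit [NeZero n] in
theorem blockVector_mem_span (β : BlockIndex n) (i : Fin (blockSize n β)) : blockVector n β i ∈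
    Submodule.span ℝ (Set.range fun x : AdaptedIndex n => blockVector n x.1 x.2) :=
  Submodule.subset_span ⟨⟨β, i⟩, rfl⟩

theorem modes_mem_span_blockVector (hn : 3 ≤ n) {S : Submodule ℝ (Config n)}
    (hS : ∀ β i, blockVector n β i ∈ S) {l : ℕ} (hl : l ≤ n / 2) :
    (modeV n l ∈ S ∧ modeW' n l ∈ S) ∧ modeV' n l ∈ S ∧ modeW n l ∈ S := by
  by_cases h0 : l = 0
  · rw [modeV'_eq_zero (.inl h0), modeW'_eq_zero (.inl h0), h0]
    exact ⟨⟨hS .phi1 (0 : Fin 1), S.zero_mem⟩, S.zero_mem, hS .phi2 (0 : Fin 1)⟩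
  by_cases h1 : l = 1
  · rw [h1]
    exact ⟨⟨hS .A1 (0 : Fin 3), hS .B1 (0 : Fin 3)⟩, hS .A1 (1 : Fin 3), hS .B1 (1 : Fin 3)⟩
  by_cases h2 : 2 * l = n
  · have he : Even n := ⟨l, by omega⟩
    have hhalf : l = n / 2 := by omega
    rw [modeV'_eq_zero (.inr h2), modeW'_eq_zero (.inr h2), hhalf]
    exact ⟨⟨hS (.phi3 ⟨he⟩) (0 : Fin 1), S.zero_mem⟩, S.zero_mem, hS (.phi4 ⟨he⟩) (0 : Fin 1)⟩
  · let L : HighMode n := ⟨⟨l, by omega⟩, by constructor <;> simp only <;> omega⟩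
    exact ⟨⟨hS (.A L) (0 : Fin 2), hS (.B L) (0 : Fin 2)⟩, hS (.A L) (1 : Fin 2),
      hS (.B L) (1 : Fin 2)⟩

theorem span_blockVector (hn : 3 ≤ n) :
    Submodule.span ℝ (Set.range fun x : AdaptedIndex n => blockVector n x.1 x.2) = ⊤ := by
  set S := Submodule.span ℝ (Set.range fun x : AdaptedIndex n => blockVector n x.1 x.2)
  have hmem {φ : ℂ →ₗ[ℝ] Config n} (h1 : φ 1 ∈ S) (hI : φ Complex.I ∈ S) (ω : ℂ) : φ ω ∈ S := by
    rw [apply_eq_re_smul_add_im_smul]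
    exact S.add_mem (S.smul_mem _ h1) (S.smul_mem _ hI)
  have hnat (l : ℕ) (hl : l ≤ n / 2) (ω : ℂ) :
      radialMode n l ω ∈ S ∧ tangentialMode n l ω ∈ S := by
    obtain ⟨⟨h1, h2⟩, h3, h4⟩ := modes_mem_span_blockVector hn blockVector_mem_span hl
    rw [modeV_eq_radialMode] at h1
    rw [modeW'_eq_radialMode] at h2
    rw [modeV'_eq_tangentialMode] at h3
    rw [modeW_eq_tangentialMode] at h4
    exact ⟨hmem h1 h2 ω, hmem h3 h4 ω⟩
  have hall (l : ZMod n) (ω : ℂ) : radialMode n l ω ∈ S ∧ tangentialMode n l ω ∈ S := by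
    have hle := ZMod.natAbs_valMinAbs_le l
    rw [← ZMod.coe_valMinAbs l]
    rcases Int.natAbs_eq l.valMinAbs with h | h <;> rw [h]
    · rw [Int.cast_natCast]
      exact hnat _ hle ω
    · rw [Int.cast_neg, Int.cast_natCast, radialMode_neg, tangentialMode_neg, S.neg_mem_iff]
      exact hnat _ hle _
  rw [eq_top_iff]
  intro x _
  rw [config_eq_sum x]
  refine S.add_mem (hmem ?_ ?_ _) (S.sum_mem fun l _ => ?_)
  · exact centerX_eq_centerWave ▸ blockVector_mem_span .A1 (2 : Fin 3)
  · exact centerY_eq_centerWave ▸ blockVector_mem_span .B1 (2 : Fin 3)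
  · rw [planeWave_eq_radialMode_sub_tangentialMode]
    exact S.sub_mem (hall l _).1 (hall l _).2

omit [NeZero n] in
theorem card_highMode : Fintype.card (HighMode n) = (n - 1) / 2 - 1 := by
  have hfilter : (Finset.univ.filter fun l : Fin n => 2 ≤ l.val ∧ 2 * l.val < n).map
      Fin.valEmbedding = Finset.Ico 2 ((n - 1) / 2 + 1) := by
    ext l
    simp only [Finset.mem_map, Finset.mem_filter, Finset.mem_univ, true_and, Fin.valEmbedding_apply,
      Finset.mem_Ico]
    constructor
    · rintro ⟨a, ⟨h1, h2⟩, rfl⟩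
      omega
    · rintro ⟨h1, h2⟩
      exact ⟨⟨l, by omega⟩, ⟨h1, by simp only; omega⟩, rfl⟩
  rw [Fintype.card_subtype, ← Finset.card_map Fin.valEmbedding, hfilter, Nat.card_Ico]
  omega

/-- The blocks grouped by their type, for counting them. -/
def blockIndexEquiv (n : ℕ) : BlockIndex n ≃
    (Bool ⊕ Bool) ⊕ ((PLift (Even n) ⊕ PLift (Even n)) ⊕ (HighMode n ⊕ HighMode n)) where
  toFun
    | .phi1 => .inl (.inl true)
    | .phi2 => .inl (.inl false)
    | .A1 => .inl (.inr true)
    | .B1 => .inl (.inr false)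
    | .phi3 h => .inr (.inl (.inl h))
    | .phi4 h => .inr (.inl (.inr h))
    | .A l => .inr (.inr (.inl l))
    | .B l => .inr (.inr (.inr l))
  invFun
    | .inl (.inl true) => .phi1
    | .inl (.inl false) => .phi2
    | .inl (.inr true) => .A1
    | .inl (.inr false) => .B1
    | .inr (.inl (.inl h)) => .phi3 h
    | .inr (.inl (.inr h)) => .phi4 h
    | .inr (.inr (.inl l)) => .A l
    | .inr (.inr (.inr l)) => .B l
  left_inv x := by cases x <;> rfl
  right_inv x := by
    rcases x with (_ | _) | ((_ | _) | (_ | _)) <;> (try rfl) <;> rename_i b <;> cases b <;> rfl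

omit [NeZero n] in
theorem card_adaptedIndex (hn : 3 ≤ n) : Fintype.card (AdaptedIndex n) = 2 * n + 2 := by
  rw [Fintype.card_sigma, ← Equiv.sum_comp (blockIndexEquiv n).symm]
  simp only [Fintype.sum_sum_type, Fintype.card_fin, Fintype.sum_bool]
  simp only [blockIndexEquiv, Equiv.coe_fn_symm_mk, blockSize, Finset.sum_const, Finset.card_univ,
    smul_eq_mul, card_highMode]
  by_cases he : Even n
  · have : Fintype.card (PLift (Even n)) = 1 := Fintype.card_eq_one_iff.2 ⟨⟨he⟩, fun _ => rfl⟩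
    rw [this]
    obtain ⟨r, hr⟩ := he
    omega
  · have : Fintype.card (PLift (Even n)) = 0 := Fintype.card_eq_zero_iff.2 ⟨fun h => he h.down⟩
    rw [this]
    have := Nat.not_even_iff.1 he
    omega

theorem finrank_config : Module.finrank ℝ (Config n) = 2 * n + 2 := by
  rw [LinearEquiv.finrank_eq (WithLp.linearEquiv 2 ℝ (Body n → ℂ)), Module.finrank_pi_fintype]
  simp [Complex.finrank_real_complex, ZMod.card]
  ring

/-- The vectors `blockVector` as a basis of the configuration space. -/
noncomputable def adaptedBasis (hn : 3 ≤ n) : Module.Basis (AdaptedIndex n) ℝ (Config n) :=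
  basisOfTopLeSpanOfCardEqFinrank (fun x : AdaptedIndex n => blockVector n x.1 x.2)
    (span_blockVector hn).ge (by rw [card_adaptedIndex hn, finrank_config])

theorem adaptedBasis_apply (hn : 3 ≤ n) (x : AdaptedIndex n) :
    adaptedBasis hn x = blockVector n x.1 x.2 := by
  rw [adaptedBasis, coe_basisOfTopLeSpanOfCardEqFinrank]

end Basis

/-! ### Kernels of block diagonal operators -/

section BlockDiagonal

variable {K V o : Type*} {κ : o → Type*} [Field K] [AddCommGroup V] [Module K V]
  [∀ β, Fintype (κ β)] {b : Module.Basis (Σ β, κ β) K V} {T : V →ₗ[K] V}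
  {A : ∀ β, Matrix (κ β) (κ β) K}

theorem repr_sum_smul_block (β : o) (c : κ β → K) (i : κ β) :
    b.repr (∑ j, c j • b ⟨β, j⟩) ⟨β, i⟩ = c i := by
  classical
  simp [Finsupp.single_apply]

theorem repr_sum_smul_block_of_ne {β γ : o} (h : γ ≠ β) (c : κ γ → K) (i : κ β) :
    b.repr (∑ j, c j • b ⟨γ, j⟩) ⟨β, i⟩ = 0 := by
  simp [h]

theorem toMatrix_eq_blockDiagonal' [Fintype o] [DecidableEq o] [∀ β, DecidableEq (κ β)]
    (hT : ∀ γ j, T (b ⟨γ, j⟩) = ∑ i, A γ i j • b ⟨γ, i⟩) :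
    LinearMap.toMatrix b b T = Matrix.blockDiagonal' A := by
  ext ⟨β, i⟩ ⟨γ, j⟩
  rw [LinearMap.toMatrix_apply, hT]
  rcases eq_or_ne γ β with rfl | h
  · rw [repr_sum_smul_block, Matrix.blockDiagonal'_apply_eq]
  · rw [repr_sum_smul_block_of_ne h, Matrix.blockDiagonal'_apply_ne _ _ _ h.symm]

theorem map_sum_smul_block (hT : ∀ γ j, T (b ⟨γ, j⟩) = ∑ i, A γ i j • b ⟨γ, i⟩) (β : o)
    (c : κ β → K) : T (∑ j, c j • b ⟨β, j⟩) = ∑ i, (A β).mulVec c i • b ⟨β, i⟩ := by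
  simp only [map_sum, map_smul, hT, Finset.smul_sum, Matrix.mulVec, dotProduct, Finset.sum_smul,
    smul_smul, mul_comm (c _)]
  exact Finset.sum_comm

theorem mulVec_repr_block [Finite o] (hT : ∀ γ j, T (b ⟨γ, j⟩) = ∑ i, A γ i j • b ⟨γ, i⟩) (x : V)
    (β : o) : ((A β).mulVec fun j => b.repr x ⟨β, j⟩) = fun i => b.repr (T x) ⟨β, i⟩ := by
  have := Fintype.ofFinite o
  funext i
  conv_rhs => rw [← b.sum_repr x, Fintype.sum_sigma, map_sum, map_sum, Finsupp.finsetSum_apply]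
  simp only [map_sum_smul_block hT _ fun j => b.repr x ⟨_, j⟩]
  rw [Fintype.sum_eq_single β fun γ hγ => repr_sum_smul_block_of_ne hγ _ _, repr_sum_smul_block]

theorem exists_mem_ker_notMem_span_iff [Finite o] [∀ β, DecidableEq (κ β)]
    (hT : ∀ γ j, T (b ⟨γ, j⟩) = ∑ i, A γ i j • b ⟨γ, i⟩) (s : Set o) :
    (∃ v, T v = 0 ∧ v ∉ Submodule.span K (b '' (Sigma.fst ⁻¹' s))) ↔
      ∃ β ∉ s, (A β).det = 0 := by
  simp only [b.mem_span_image]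
  constructor
  · rintro ⟨v, hv, hsupp⟩
    obtain ⟨⟨β, j⟩, hj, hβ⟩ := Set.not_subset.1 hsupp
    refine ⟨β, hβ, Matrix.exists_mulVec_eq_zero_iff.1 ⟨fun j => b.repr v ⟨β, j⟩, fun h => ?_, ?_⟩⟩
    · exact Finsupp.mem_support_iff.1 hj (congrFun h j)
    · rw [mulVec_repr_block hT, hv, map_zero]
      rfl
  · rintro ⟨β, hβ, hdet⟩
    obtain ⟨c, hc, hAc⟩ := Matrix.exists_mulVec_eq_zero_iff.2 hdet
    refine ⟨∑ j, c j • b ⟨β, j⟩, ?_, fun h => hc (funext fun i => ?_)⟩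
    · rw [map_sum_smul_block hT, hAc]
      simp
    · by_contra hi
      refine hβ (h (a := ⟨β, i⟩) (Finsupp.mem_support_iff.2 ?_))
      rwa [repr_sum_smul_block]

end BlockDiagonal

/-! ### The degeneracy criterion -/

section Degeneracy

variable {n : ℕ} [NeZero n] {m : ℝ}

omit [NeZero n] in
theorem z0_eq_modeV : z0 n = modeV n 0 := by
  ext i
  rcases i with _ | k
  · rfl
  · simp [modeV]

omit [NeZero n] in
theorem rotationDirection_eq_modeW : rotationDirection n = modeW n 0 := by
  ext i
  rcases i with _ | k
  · simp [rotationDirection, modeW]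
  · simp [rotationDirection, modeW]

theorem scalarBlock_modeV_zero (hn : 2 ≤ n) : scalarBlock n m (modeV n 0) = 0 :=
  scalarBlock_eq (modeV_ne_zero 0) (by rw [← z0_eq_modeV, hess_z0 hn, zero_smul])

theorem scalarBlock_modeW_zero (hn : 2 ≤ n) : scalarBlock n m (modeW n 0) = 0 :=
  scalarBlock_eq (modeW_ne_zero 0)
    (by rw [← rotationDirection_eq_modeW, hess_rotationDirection hn, zero_smul])

theorem hess_eq_scalarBlock_smul {v : Config n} (hv : v ≠ 0) {c : ℝ} (h : hess n m v = c • v) :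
    hess n m v = scalarBlock n m v • v := by
  rw [scalarBlock_eq hv h, h]

theorem hess_blockVector (hn : 3 ≤ n) (β : BlockIndex n) (j : Fin (blockSize n β)) :
    hess n m (blockVector n β j) = ∑ i, hessBlock n m β i j • blockVector n β i := by
  have hscalar {v : Config n} (h : hess n m v = scalarBlock n m v • v) :
      hess n m v = ∑ _i : Fin 1, scalarBlock n m v • v := by
    rwa [Fin.sum_univ_one]
  cases β with
  | phi1 =>
    refine hscalar (v := modeV n 0) ?_
    rw [scalarBlock_modeV_zero (by omega), ← z0_eq_modeV, hess_z0 (by omega), zero_smul]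
  | phi2 =>
    refine hscalar (v := modeW n 0) ?_
    rw [scalarBlock_modeW_zero (by omega), ← rotationDirection_eq_modeW,
      hess_rotationDirection (by omega), zero_smul]
  | phi3 he =>
    exact hscalar (hess_eq_scalarBlock_smul (modeV_ne_zero _)
      (hess_modeV_half hn (Nat.two_mul_div_two_of_even he.down)))
  | phi4 he =>
    exact hscalar (hess_eq_scalarBlock_smul (modeW_ne_zero _)
      (hess_modeW_half hn (Nat.two_mul_div_two_of_even he.down)))
  | A1 =>
    have h := hess_modeV_modeV'_centerX (m := m) hn j
    rwa [← blockA1_eq hn] at h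
  | B1 =>
    have h := hess_modeW'_modeW_centerY (m := m) hn j
    rwa [← blockA1_eq hn] at h
  | A l =>
    have h := hess_modeV_modeV' (m := m) l.2.1 l.2.2.le j
    rwa [← blockA_eq l.2.1 l.2.2] at h
  | B l =>
    have h := hess_modeW'_modeW (m := m) l.2.1 l.2.2.le j
    rwa [← blockA_eq l.2.1 l.2.2] at h

theorem hess_adaptedBasis (hn : 3 ≤ n) (β : BlockIndex n) (j : Fin (blockSize n β)) :
    hess n m (adaptedBasis hn ⟨β, j⟩) =
      ∑ i, hessBlock n m β i j • adaptedBasis hn ⟨β, i⟩ := by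
  simp only [adaptedBasis_apply]
  exact hess_blockVector hn β j

theorem toMatrix_hess (hn : 3 ≤ n) :
    LinearMap.toMatrix (adaptedBasis hn) (adaptedBasis hn) (hess n m : Config n →ₗ[ℝ] Config n) =
      Matrix.blockDiagonal' (hessBlock n m) :=
  toMatrix_eq_blockDiagonal' (hess_adaptedBasis hn)

theorem adaptedBasis_image_phi (hn : 3 ≤ n) :
    adaptedBasis hn '' (Sigma.fst ⁻¹' {.phi1, .phi2}) = {z0 n, rotationDirection n} := by
  have hphi : (Sigma.fst ⁻¹' {.phi1, .phi2} : Set (AdaptedIndex n)) =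
      {⟨.phi1, (0 : Fin 1)⟩, ⟨.phi2, (0 : Fin 1)⟩} := by
    ext ⟨β, i⟩
    simp only [Set.mem_preimage, Set.mem_insert_iff, Set.mem_singleton_iff]
    constructor
    · rintro (rfl | rfl)
      · exact Or.inl (congrArg (Sigma.mk _) (Fin.fin_one_eq_zero i))
      · exact Or.inr (congrArg (Sigma.mk _) (Fin.fin_one_eq_zero i))
    · exact Or.imp (congrArg Sigma.fst) (congrArg Sigma.fst)
  rw [hphi, Set.image_pair, adaptedBasis_apply, adaptedBasis_apply, z0_eq_modeV,
    rotationDirection_eq_modeW]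
  rfl

theorem degenerate_iff_hessBlock (hn : 3 ≤ n) : Degenerate n m ↔
    ∃ β ∉ ({.phi1, .phi2} : Set (BlockIndex n)), (hessBlock n m β).det = 0 := by
  rw [← exists_mem_ker_notMem_span_iff (hess_adaptedBasis hn), adaptedBasis_image_phi]
  rfl

theorem det_blockA_half_eq_zero_iff (he : Even n) (hn : 3 ≤ n) : (blockA n m (n / 2)).det = 0 ↔
    (hessBlock n m (.phi3 ⟨he⟩)).det = 0 ∨ (hessBlock n m (.phi4 ⟨he⟩)).det = 0 := by
  have hdet (v : Config n) :
      Matrix.det (Matrix.of fun _ _ : Fin 1 => scalarBlock n m v) = scalarBlock n m v :=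
    Matrix.det_fin_one _
  rw [blockA_half hn (Nat.two_mul_div_two_of_even he), Matrix.det_diagonal, Fin.prod_univ_two,
    mul_eq_zero]
  exact or_congr (iff_of_eq (congrArg (· = 0) (hdet _).symm))
    (iff_of_eq (congrArg (· = 0) (hdet _).symm))

theorem degenerate_iff (hn : 3 ≤ n) : Degenerate n m ↔
    (blockA1 n m).det = 0 ∨ ∃ l : ℕ, 2 ≤ l ∧ l ≤ n / 2 ∧ (blockA n m l).det = 0 := by
  rw [degenerate_iff_hessBlock hn]
  constructor
  · rintro ⟨β, hβ, hdet⟩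
    cases β with
    | phi1 => exact absurd (Or.inl rfl) hβ
    | phi2 => exact absurd (Or.inr rfl) hβ
    | phi3 he =>
      have := he.down.two_dvd
      exact Or.inr ⟨n / 2, by omega, le_rfl, (det_blockA_half_eq_zero_iff he.down hn).2 (.inl hdet)⟩
    | phi4 he =>
      have := he.down.two_dvd
      exact Or.inr ⟨n / 2, by omega, le_rfl, (det_blockA_half_eq_zero_iff he.down hn).2 (.inr hdet)⟩
    | A1 | B1 => exact Or.inl hdet
    | A l | B l => exact Or.inr ⟨l.1, l.2.1, by have := l.2.2; omega, hdet⟩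
  · rintro (h | ⟨l, hl, hl', h⟩)
    · exact ⟨.A1, by simp, h⟩
    rcases (by omega : 2 * l < n ∨ 2 * l = n) with h2 | h2
    · exact ⟨.A ⟨⟨l, by omega⟩, hl, h2⟩, by simp, h⟩
    · have he : Even n := ⟨l, by omega⟩
      obtain rfl : l = n / 2 := by omega
      rcases (det_blockA_half_eq_zero_iff he hn).1 h with h | h
      · exact ⟨.phi3 ⟨he⟩, by simp, h⟩
      · exact ⟨.phi4 ⟨he⟩, by simp, h⟩

end Degeneracy

/-! ### Monotonicity of the chord sums -/

section ChordSums

variable {n : ℕ} [NeZero n]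

omit [NeZero n] in
theorem norm_one_sub_vertex_sq (t : ZMod n) : ‖1 - vertex n t‖ ^ 2 = 2 - 2 * (vertex n t).re := by
  rw [norm_sub_sq_real, norm_one, norm_vertex, Complex.inner, map_one, mul_one]
  ring

omit [NeZero n] in
theorem sin_pi_mul_div_pos {j : ℕ} (h0 : 0 < j) (hj : j < n) :
    0 < Real.sin (Real.pi * (j / n)) := by
  have hn : (0 : ℝ) < n := Nat.cast_pos.2 (h0.trans hj)
  have hj' : (j / n : ℝ) < 1 := (div_lt_one hn).2 (Nat.cast_lt.2 hj)
  exact Real.sin_pos_of_pos_of_lt_pi (by positivity) (mul_lt_of_lt_one_right Real.pi_pos hj')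

theorem sin_pi_mul_val_div_nonneg (t : ZMod n) : 0 ≤ Real.sin (Real.pi * (t.val / n)) := by
  rcases (ZMod.val t).eq_zero_or_pos with h | h
  · simp [h]
  · exact (sin_pi_mul_div_pos h (ZMod.val_lt t)).le

omit [NeZero n] in
theorem vertexAngle_eq_two_mul (t : ZMod n) : vertexAngle n t = 2 * (Real.pi * (t.val / n)) := by
  rw [vertexAngle]
  ring

theorem norm_one_sub_vertex (t : ZMod n) :
    ‖1 - vertex n t‖ = 2 * Real.sin (Real.pi * (t.val / n)) := by
  have h := re_vertex_natCast_mul 1 t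
  rw [Nat.cast_one, one_mul, Nat.cast_one, one_mul, vertexAngle_eq_two_mul, Real.cos_two_mul] at h
  rw [← sq_eq_sq₀ (norm_nonneg _) (mul_nonneg two_pos.le (sin_pi_mul_val_div_nonneg t)),
    norm_one_sub_vertex_sq, h]
  linear_combination -4 * Real.sin_sq_add_cos_sq (Real.pi * (t.val / n))

theorem sum_zmod_val {M : Type*} [AddCommMonoid M] (f : ℕ → M) :
    ∑ t : ZMod n, f t.val = ∑ j ∈ Finset.range n, f j := by
  obtain ⟨k, rfl⟩ := Nat.exists_eq_succ_of_ne_zero (NeZero.ne n)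
  exact Fin.sum_univ_eq_sum_range f (k + 1)

/-- The sum `R_l = ½ ∑_t cos (l t θ) / |1 - ζ^t|` over the chords of the polygon issuing from one
vertex, the second difference of `P_l`. -/
noncomputable def inverseChordSum (n : ℕ) [NeZero n] (l : ZMod n) : ℝ :=
  1 / 2 * ∑ t : ZMod n, ‖1 - vertex n t‖⁻¹ * (vertex n (l * t)).re

theorem inverseChordSum_neg (l : ZMod n) : inverseChordSum n (-l) = inverseChordSum n l := by
  simp only [inverseChordSum, neg_mul, ← conj_vertex, Complex.conj_re]

theorem re_vertex_add_mul_add_re_vertex_sub_mul (l t : ZMod n) :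
    (vertex n ((l + 1) * t)).re + (vertex n ((l - 1) * t)).re =
      2 * (vertex n t).re * (vertex n (l * t)).re := by
  rw [add_one_mul, sub_one_mul, sub_eq_add_neg, vertex_add, vertex_add, ← conj_vertex,
    Complex.mul_re, Complex.mul_re, Complex.conj_re, Complex.conj_im]
  ring

theorem chordSum_second_difference (l : ZMod n) :
    chordSum n (l + 1) + chordSum n (l - 1) - 2 * chordSum n l = inverseChordSum n l := by
  have hterm (t : ZMod n) : (‖1 - vertex n t‖ ^ 3)⁻¹ * (1 - (vertex n ((l + 1) * t)).re) +
      (‖1 - vertex n t‖ ^ 3)⁻¹ * (1 - (vertex n ((l - 1) * t)).re) -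
        2 * ((‖1 - vertex n t‖ ^ 3)⁻¹ * (1 - (vertex n (l * t)).re)) =
      ‖1 - vertex n t‖⁻¹ * (vertex n (l * t)).re := by
    rcases eq_or_ne ‖1 - vertex n t‖ 0 with hz | hz
    · simp [hz]
    have h := norm_one_sub_vertex_sq t
    field_simp
    linear_combination -re_vertex_add_mul_add_re_vertex_sub_mul l t - (vertex n (l * t)).re * h
  rw [inverseChordSum, ← Finset.sum_congr rfl fun t _ => hterm t, Finset.sum_sub_distrib,
    Finset.sum_add_distrib, ← Finset.mul_sum, chordSum, chordSum, chordSum]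
  ring

theorem inverseChordSum_zero : inverseChordSum n 0 = 2 * chordSum n 1 := by
  rw [← chordSum_second_difference, zero_add, zero_sub, chordSum_neg, chordSum_zero]
  ring

/-- The cotangents `cot ((2 l + 1) π / (2 n))`, half of which is the decrement of `R_l`. -/
noncomputable def oddCot (n l : ℕ) : ℝ := Real.cot (Real.pi * ((2 * l + 1) / (2 * n)))

theorem sum_sin_odd_mul_pi_div {l : ℕ} (hl : l < n) :
    ∑ j ∈ Finset.range n, Real.sin ((2 * l + 1) * (Real.pi * (j / n))) = oddCot n l := by
  have hn : (0 : ℝ) < n := Nat.cast_pos.2 (NeZero.pos n)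
  have hl' : (l : ℝ) + 1 ≤ n := mod_cast hl
  set x : ℝ := (2 * l + 1) * Real.pi / n with hx
  have hhalf : Real.pi * ((2 * l + 1) / (2 * n)) = x / 2 := by rw [hx]; field_simp
  have hsin : Real.sin (x / 2) ≠ 0 := by
    refine (Real.sin_pos_of_pos_of_lt_pi (by positivity) ?_).ne'
    rw [← hhalf, mul_lt_iff_lt_one_right Real.pi_pos, div_lt_one (by positivity)]
    linarith
  have hnx : n * x / 2 = l * Real.pi + Real.pi / 2 := by rw [hx]; field_simp
  have hcos : Real.cos (n * x / 2) = 0 := by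
    rw [hnx, Real.cos_add_pi_div_two, Real.sin_nat_mul_pi, neg_zero]
  have h := Real.sin_mul_sum_sin n x 0
  rw [show ((n : ℝ) - 1) * x / 2 + 0 = n * x / 2 - x / 2 by ring, Real.sin_sub, hcos] at h
  rw [oddCot, hhalf, Real.cot_eq_cos_div_sin, eq_div_iff hsin, mul_comm]
  have harg (j : ℕ) : (2 * l + 1) * (Real.pi * (j / n)) = x * j + 0 := by rw [hx]; ring
  simp only [harg]
  rw [h]
  linear_combination Real.cos (x / 2) * Real.sin_sq_add_cos_sq (n * x / 2) -
    Real.cos (x / 2) * Real.cos (n * x / 2) * hcos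

theorem inverseChordSum_add_one {l : ℕ} (hl : l < n) :
    inverseChordSum n (l + 1) = inverseChordSum n l - oddCot n l / 2 := by
  have hterm (t : ZMod n) : ‖1 - vertex n t‖⁻¹ * (vertex n ((l + 1) * t)).re =
      ‖1 - vertex n t‖⁻¹ * (vertex n (l * t)).re -
        Real.sin ((2 * l + 1) * (Real.pi * (t.val / n))) := by
    rw [← Nat.cast_succ, re_vertex_natCast_mul, re_vertex_natCast_mul, norm_one_sub_vertex,
      vertexAngle_eq_two_mul, eq_sub_iff_add_eq', ← eq_sub_iff_add_eq, ← mul_sub,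
      Real.cos_sub_cos]
    set y := Real.pi * (t.val / n) with hy
    have hsum : (l * (2 * y) + (l.succ : ℝ) * (2 * y)) / 2 = (2 * l + 1) * y := by
      push_cast
      ring
    have hdiff : (l * (2 * y) - (l.succ : ℝ) * (2 * y)) / 2 = -y := by
      push_cast
      ring
    rw [hsum, hdiff, Real.sin_neg]
    rcases (ZMod.val t).eq_zero_or_pos with h | h
    · simp [hy, h]
    · have hy : Real.sin y ≠ 0 := (sin_pi_mul_div_pos h (ZMod.val_lt t)).ne'
      field_simp
  rw [inverseChordSum, Finset.sum_congr rfl fun t _ => hterm t, Finset.sum_sub_distrib,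
    sum_zmod_val fun j => Real.sin ((2 * l + 1) * (Real.pi * (j / n))),
    sum_sin_odd_mul_pi_div hl, inverseChordSum]
  ring

omit [NeZero n] in
theorem oddCot_pos {l : ℕ} (hl : 2 * l + 1 < n) : 0 < oddCot n l := by
  have hl' : (2 * l : ℝ) + 1 < n := mod_cast hl
  have hlt : Real.pi * ((2 * l + 1) / (2 * n)) < Real.pi / 2 := by
    rw [mul_div_assoc', div_lt_div_iff₀ (by linarith) two_pos]
    nlinarith [Real.pi_pos]
  have hpos : 0 < Real.pi * ((2 * l + 1) / (2 * n)) :=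
    mul_pos Real.pi_pos (div_pos (by positivity) (by linarith))
  rw [oddCot, Real.cot_eq_cos_div_sin]
  exact div_pos (Real.cos_pos_of_mem_Ioo ⟨by linarith, hlt⟩)
    (Real.sin_pos_of_pos_of_lt_pi hpos (by linarith))

theorem inverseChordSum_add_one_lt {l : ℕ} (hl : 2 * l + 1 < n) :
    inverseChordSum n (l + 1) < inverseChordSum n l := by
  rw [inverseChordSum_add_one (by omega)]
  linarith [oddCot_pos hl]

theorem inverseChordSum_lt_of_two_mul_le {l i : ℕ} (hli : l < i) (hi : 2 * i ≤ n) :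
    inverseChordSum n i < inverseChordSum n l := by
  induction i, hli using Nat.le_induction with
  | base =>
    rw [Nat.cast_succ]
    exact inverseChordSum_add_one_lt (by omega)
  | succ i _ ih =>
    rw [Nat.cast_succ]
    exact (inverseChordSum_add_one_lt (by omega)).trans (ih (by omega))

omit [NeZero n] in
theorem natCast_sub_self {i : ℕ} (hi : i ≤ n) : ((n - i : ℕ) : ZMod n) = -i := by
  rw [Nat.cast_sub hi, ZMod.natCast_self, zero_sub]

theorem inverseChordSum_lt_of_add_lt {l i : ℕ} (hli : l < i) (hi : i + l < n) :
    inverseChordSum n i < inverseChordSum n l := by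
  rcases le_or_gt (2 * i) n with h | h
  · exact inverseChordSum_lt_of_two_mul_le hli h
  · rw [← inverseChordSum_neg, ← natCast_sub_self (by omega)]
    exact inverseChordSum_lt_of_two_mul_le (by omega) (by omega)

omit [NeZero n] in
theorem one_sub_re_vertex_nonneg (t : ZMod n) : 0 ≤ 1 - (vertex n t).re :=
  sub_nonneg.2 ((Complex.re_le_norm _).trans (norm_vertex t).le)

theorem chordSum_nonneg (l : ZMod n) : 0 ≤ chordSum n l :=
  mul_nonneg one_half_pos.le
    (Finset.sum_nonneg fun _ _ => mul_nonneg (by positivity) (one_sub_re_vertex_nonneg _))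

theorem chordSum_one_pos (hn : 2 ≤ n) : 0 < chordSum n 1 := by
  have : Fact (1 < n) := ⟨hn⟩
  have hne : 0 < ‖1 - vertex n 1‖ := by
    rw [norm_pos_iff, sub_ne_zero, ← vertex_zero (n := n)]
    exact vertex_injective.ne zero_ne_one
  refine mul_pos one_half_pos (Finset.sum_pos'
    (fun t _ => mul_nonneg (by positivity) (one_sub_re_vertex_nonneg _)) ⟨1, Finset.mem_univ _, ?_⟩)
  have h : 0 < 1 - (vertex n 1).re := by nlinarith [norm_one_sub_vertex_sq (n := n) 1]
  rw [one_mul]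
  positivity

/-- The forward difference of the sequence `P_l`. -/
noncomputable def chordStep (n : ℕ) [NeZero n] (l : ZMod n) : ℝ := chordSum n (l + 1) - chordSum n l

theorem chordStep_add_one_sub (l : ZMod n) :
    chordStep n (l + 1) - chordStep n l = inverseChordSum n (l + 1) := by
  rw [← chordSum_second_difference, chordStep, chordStep, add_sub_cancel_right]
  ring

theorem chordStep_neg_one_sub (l : ZMod n) : chordStep n (-1 - l) = -chordStep n l := by
  rw [chordStep, chordStep, show -1 - l + 1 = -l by ring, show -1 - l = -(l + 1) by ring,
    chordSum_neg, chordSum_neg, neg_sub]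

theorem chordStep_add_sub (l : ZMod n) (k : ℕ) : chordStep n (l + k) - chordStep n l =
    ∑ i ∈ Finset.range k, inverseChordSum n (l + i + 1) := by
  rw [← add_zero l, ← Nat.cast_zero, add_assoc, ← Nat.cast_add, zero_add,
    ← Finset.sum_range_sub fun i : ℕ => chordStep n (l + i)]
  simp only [Nat.cast_zero, add_zero, Nat.cast_succ, ← add_assoc, chordStep_add_one_sub]

/-- Summing the second differences from `l` to `n - 1 - l`, where the first difference changes
sign. -/
theorem neg_two_mul_chordStep_le {l : ℕ} (hl : 2 * l + 1 ≤ n) :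
    -2 * chordStep n l ≤ (n - 1 - 2 * l) * inverseChordSum n l := by
  have hcast : ((n - 1 - 2 * l : ℕ) : ZMod n) = -1 - 2 * l := by
    rw [Nat.sub_sub, natCast_sub_self (by omega)]
    push_cast
    ring
  have h := chordStep_add_sub (l : ZMod n) (n - 1 - 2 * l)
  rw [hcast, show (l + (-1 - 2 * l) : ZMod n) = -1 - l by ring, chordStep_neg_one_sub] at h
  have hle : ∑ i ∈ Finset.range (n - 1 - 2 * l), inverseChordSum n (l + i + 1) ≤
      (n - 1 - 2 * l : ℕ) • inverseChordSum n l := by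
    refine (Finset.sum_le_card_nsmul _ _ _ fun i hi => ?_).trans_eq (by rw [Finset.card_range])
    have := Finset.mem_range.1 hi
    exact mod_cast (inverseChordSum_lt_of_add_lt (l := l) (i := l + i + 1) (by omega)
      (by omega)).le
  rw [← h, nsmul_eq_mul, Nat.sub_sub, Nat.cast_sub (by omega)] at hle
  push_cast at hle
  linarith

theorem chordStep_pos {l : ℕ} (hl : 2 * l + 1 < n) : 0 < chordStep n l := by
  induction l with
  | zero =>
    rw [chordStep, Nat.cast_zero, zero_add, chordSum_zero, sub_zero]
    exact chordSum_one_pos (by omega)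
  | succ l ih =>
    have hdiff := chordStep_add_one_sub (l : ZMod n)
    have hle := neg_two_mul_chordStep_le hl.le
    have hl' : 2 * (l + 1 : ℝ) + 1 < n := mod_cast hl
    push_cast at hle ⊢
    nlinarith [ih (by omega)]

theorem neg_two_mul_chordStep_le_inverseChordSum {l : ℕ} (hl : 2 * l + 1 < n) :
    -2 * chordStep n l ≤ inverseChordSum n l := by
  have hle := neg_two_mul_chordStep_le hl.le
  have hpos := chordStep_pos hl
  have hl' : 2 * (l : ℝ) + 1 + 1 ≤ n := mod_cast hl
  by_contra! h
  nlinarith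

theorem chordSum_one_le {l : ℕ} (hl : 1 ≤ l) (hl' : 2 * l ≤ n) : chordSum n 1 ≤ chordSum n l := by
  induction l, hl using Nat.le_induction with
  | base => rw [Nat.cast_one]
  | succ l _ ih =>
    have hpos := chordStep_pos (n := n) (l := l) (by omega)
    rw [chordStep, sub_pos] at hpos
    rw [Nat.cast_succ]
    exact (ih (by omega)).trans hpos.le

end ChordSums

/-! ### The mass at which a mode is singular -/

section SingularMass

variable {n : ℕ} [NeZero n] {m : ℝ}

/-- The mass for which the block of the mode `l ≥ 2` is singular: the determinant of that block is
affine in the mass. -/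
noncomputable def singularMass (n : ℕ) [NeZero n] (l : ZMod n) : ℝ :=
  (4 * chordSum n l - 10 * chordSum n 1 - inverseChordSum n l +
    (chordSum n (l + 1) - chordSum n (l - 1)) ^ 2 /
      (8 * chordSum n l - 2 * chordSum n 1 + inverseChordSum n l)) / 6

theorem singularMass_den_pos {l : ℕ} (hl : 1 ≤ l) (hl' : 2 * l ≤ n) :
    0 < 8 * chordSum n l - 2 * chordSum n 1 + inverseChordSum n l := by
  rw [← chordSum_second_difference]
  have hnext := chordSum_nonneg (l + 1 : ZMod n)
  have hprev := chordSum_nonneg (l - 1 : ZMod n)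
  have hle := chordSum_one_le hl hl'
  have hpos := chordSum_one_pos (n := n) (by omega)
  linarith

theorem det_blockA_eq_zero_iff {l : ℕ} (hl : 2 ≤ l) (hl' : 2 * l ≤ n) :
    (blockA n m l).det = 0 ↔ m = singularMass n l := by
  have hden := singularMass_den_pos (n := n) (by omega) hl'
  have hn : (n / 2 : ℝ) ≠ 0 := by simp [NeZero.ne n]
  have hprev : chordSum n (-l + 1) = chordSum n (l - 1) := by rw [← chordSum_neg]; congr 1; ring
  rw [det_blockA hl hl', mul_eq_zero, or_iff_right hn, singularMass, ← sub_eq_zero (a := m)]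
  have hR := chordSum_second_difference (l : ZMod n)
  set D := 8 * chordSum n l - 2 * chordSum n 1 + inverseChordSum n l
  have hD' : D = chordSum n (l + 1) + chordSum n (l - 1) + 6 * chordSum n l - 2 * chordSum n 1 := by
    linarith
  have key : diagCoeff n m l * diagCoeff n m (-l) - conjCoeff n m l ^ 2 =
      3 / 2 * D * (m - (4 * chordSum n l - 10 * chordSum n 1 - inverseChordSum n l +
        (chordSum n (l + 1) - chordSum n (l - 1)) ^ 2 / D) / 6) := by
    rw [diagCoeff, diagCoeff, conjCoeff, hprev, ← hR]
    field_simp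
    rw [hD']
    ring
  rw [key, mul_eq_zero, or_iff_right (by positivity)]

theorem singularMass_lt_add_one {l : ℕ} (hl : 1 ≤ l) (hl' : 2 * (l + 1) ≤ n) :
    singularMass n l < singularMass n (l + 1) := by
  have hden := singularMass_den_pos (n := n) hl (by omega)
  have hden' := singularMass_den_pos (n := n) (l := l + 1) (by omega) hl'
  have hR := inverseChordSum_add_one_lt (n := n) (l := l) (by omega)
  have hg := chordStep_pos (n := n) (l := l) (by omega)
  have hg' := chordStep_pos (n := n) (l := l - 1) (by omega)
  have hRg := neg_two_mul_chordStep_le_inverseChordSum (n := n) (l := l) (by omega)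
  have hone := chordSum_one_le (n := n) hl (by omega)
  have hprev := chordSum_nonneg (l - 1 : ZMod n)
  have hsecond := chordSum_second_difference (l : ZMod n)
  rw [Nat.cast_sub hl, Nat.cast_one, chordStep, sub_add_cancel] at hg'
  rw [chordStep] at hg hRg
  have hquot : (chordSum n (l + 1) - chordSum n (l - 1)) ^ 2 /
      (8 * chordSum n l - 2 * chordSum n 1 + inverseChordSum n l) <
        4 * (chordSum n (l + 1) - chordSum n l) := by
    rw [div_lt_iff₀ hden]
    nlinarith
  have hquot' : 0 ≤ (chordSum n (l + 1 + 1) - chordSum n (l + 1 - 1)) ^ 2 /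
      (8 * chordSum n (l + 1) - 2 * chordSum n 1 + inverseChordSum n (l + 1)) := by
    rw [← Nat.cast_succ] at *
    exact div_nonneg (sq_nonneg _) hden'.le
  rw [singularMass, singularMass]
  linarith

theorem singularMass_lt_of_lt {l i : ℕ} (hl : 1 ≤ l) (hli : l < i) (hi : 2 * i ≤ n) :
    singularMass n l < singularMass n i := by
  induction i, hli using Nat.le_induction with
  | base =>
    rw [Nat.cast_succ]
    exact singularMass_lt_add_one hl hi
  | succ i hli ih =>
    rw [Nat.cast_succ]
    exact (ih (by omega)).trans (singularMass_lt_add_one (by omega) hi)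

end SingularMass

/-! ### Closed forms in terms of cosecants and cotangents -/

section ClosedForms

variable {n : ℕ} [NeZero n] {m : ℝ}

/-- The sum `S = ∑_{0 < j < n} 1 / sin (π j / n)`; the summand `j = 0` is `0⁻¹ = 0`. -/
noncomputable def cscSum (n : ℕ) : ℝ := ∑ j ∈ Finset.range n, (Real.sin (Real.pi * (j / n)))⁻¹

theorem chordSum_one : chordSum n 1 = cscSum n / 8 := by
  have h := inverseChordSum_zero (n := n)
  rw [inverseChordSum] at h
  simp only [zero_mul, vertex_zero, Complex.one_re, mul_one, norm_one_sub_vertex, mul_inv] at h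
  rw [sum_zmod_val fun j => (2 : ℝ)⁻¹ * (Real.sin (Real.pi * (j / n)))⁻¹, ← Finset.mul_sum,
    ← cscSum] at h
  linarith

theorem inverseChordSum_one : inverseChordSum n 1 = cscSum n / 4 - oddCot n 0 / 2 := by
  have h := inverseChordSum_add_one (NeZero.pos n)
  rw [Nat.cast_zero, zero_add, inverseChordSum_zero, chordSum_one] at h
  linarith

theorem inverseChordSum_two (hn : 2 ≤ n) :
    inverseChordSum n 2 = cscSum n / 4 - oddCot n 0 / 2 - oddCot n 1 / 2 := by
  have h := inverseChordSum_add_one hn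
  rwa [Nat.cast_one, one_add_one_eq_two, inverseChordSum_one] at h

theorem inverseChordSum_three (hn : 3 ≤ n) :
    inverseChordSum n 3 = cscSum n / 4 - oddCot n 0 / 2 - oddCot n 1 / 2 - oddCot n 2 / 2 := by
  have h := inverseChordSum_add_one hn
  rwa [Nat.cast_two, two_add_one_eq_three, inverseChordSum_two (by omega)] at h

theorem chordSum_two : chordSum n 2 = cscSum n / 2 - oddCot n 0 / 2 := by
  have h := chordSum_second_difference (n := n) 1
  rw [sub_self, chordSum_zero, chordSum_one, inverseChordSum_one, one_add_one_eq_two] at h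
  linarith

theorem chordSum_three (hn : 2 ≤ n) :
    chordSum n 3 = 9 / 8 * cscSum n - 3 / 2 * oddCot n 0 - oddCot n 1 / 2 := by
  have h := chordSum_second_difference (n := n) 2
  rw [two_add_one_eq_three, show (2 - 1 : ZMod n) = 1 by norm_num, chordSum_one, chordSum_two,
    inverseChordSum_two hn] at h
  linarith

/-- A quadratic form in the trigonometric sums of the polygon that has the sign of the mass at which
the mode `2` is singular. -/
noncomputable def secondModeSign (n : ℕ) : ℝ :=
  3 / 4 * cscSum n ^ 2 - 45 / 16 * cscSum n * oddCot n 0 + 9 / 4 * oddCot n 0 ^ 2 +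
    3 / 16 * cscSum n * oddCot n 1

theorem secondModeSign_eq (hn : 4 ≤ n) : secondModeSign n =
    3 / 2 * (8 * chordSum n 2 - 2 * chordSum n 1 + inverseChordSum n 2) * singularMass n 2 := by
  have hden := (singularMass_den_pos (n := n) (l := 2) one_le_two (by omega)).ne'
  rw [Nat.cast_two] at hden
  set D := 8 * chordSum n 2 - 2 * chordSum n 1 + inverseChordSum n 2 with hD
  rw [singularMass, ← hD, two_add_one_eq_three,
    show (2 - 1 : ZMod n) = 1 by norm_num]
  field_simp
  rw [hD, chordSum_three (by omega), inverseChordSum_two (by omega), chordSum_two, chordSum_one,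
    secondModeSign]
  ring

theorem singularMass_two_pos_iff (hn : 4 ≤ n) : 0 < singularMass n 2 ↔ 0 < secondModeSign n := by
  have hden := singularMass_den_pos (n := n) (l := 2) one_le_two (by omega)
  rw [Nat.cast_two] at hden
  rw [secondModeSign_eq hn, mul_pos_iff_of_pos_left (by positivity)]

theorem le_singularMass_three (hn : 6 ≤ n) :
    3 * cscSum n - 11 / 2 * oddCot n 0 - 3 / 2 * oddCot n 1 + oddCot n 2 / 2 ≤
      6 * singularMass n 3 := by
  have hden := singularMass_den_pos (n := n) (l := 3) (by omega) (by omega)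
  rw [Nat.cast_ofNat] at hden
  have hquot := div_nonneg (sq_nonneg (chordSum n (3 + 1) - chordSum n (3 - 1))) hden.le
  rw [singularMass, mul_div_cancel₀ _ (by norm_num)]
  have hR := inverseChordSum_three (n := n) (by omega)
  have hP := chordSum_three (n := n) (by omega)
  have hP' := chordSum_one (n := n)
  linarith

theorem det_blockA1_eq_zero_iff (hn : 3 ≤ n) (hm : 0 < m) : (blockA1 n m).det = 0 ↔
    (cscSum n * 3 / 4 - oddCot n 0 / 2) * (n / 2 + cscSum n / 4) =
      3 * m / 2 * (n + oddCot n 0 / 2 - cscSum n) := by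
  have hP := chordSum_one_pos (n := n) (by omega)
  rw [det_blockA1 hn, mul_eq_zero, or_iff_right (by positivity), mul_eq_zero,
    or_iff_right (by positivity), chordSum_two, chordSum_one, ← sub_eq_zero (b := 3 * m / 2 * _)]
  ring_nf

theorem firstMode_const_pos (hn : 2 ≤ n) :
    0 < (cscSum n * 3 / 4 - oddCot n 0 / 2) * (n / 2 + cscSum n / 4) := by
  have hP := chordSum_one_pos hn
  have hP' := chordSum_nonneg (n := n) 2
  rw [chordSum_one] at hP
  rw [chordSum_two] at hP'
  exact mul_pos (by linarith) (add_pos_of_nonneg_of_pos (by positivity) (by linarith))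

end ClosedForms

/-! ### Alternating Taylor bounds -/

section TaylorBounds

theorem nonneg_of_hasDerivAt_nonneg {f f' : ℝ → ℝ} (hf : ∀ x, HasDerivAt f (f' x) x) (h0 : f 0 = 0)
    (hf' : ∀ x, 0 ≤ x → 0 ≤ f' x) {x : ℝ} (hx : 0 ≤ x) : 0 ≤ f x := by
  have hmono : MonotoneOn f (Set.Ici 0) :=
    monotoneOn_of_hasDerivWithinAt_nonneg (convex_Ici 0)
      (fun y _ => (hf y).continuousAt.continuousWithinAt) (fun y _ => (hf y).hasDerivWithinAt)
      fun y hy => hf' y (interior_subset hy)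
  exact h0.symm.trans_le (hmono Set.self_mem_Ici hx hx)

/-- The sum of the first `k` terms of the Taylor series of the sine at `0`. -/
noncomputable def sinTaylor (k : ℕ) (x : ℝ) : ℝ :=
  ∑ i ∈ Finset.range k, (-1) ^ i * x ^ (2 * i + 1) / (2 * i + 1).factorial

/-- The sum of the first `k` terms of the Taylor series of the cosine at `0`. -/
noncomputable def cosTaylor (k : ℕ) (x : ℝ) : ℝ :=
  ∑ i ∈ Finset.range k, (-1) ^ i * x ^ (2 * i) / (2 * i).factorial

theorem hasDerivAt_sinTaylor (k : ℕ) (x : ℝ) : HasDerivAt (sinTaylor k) (cosTaylor k x) x := by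
  refine HasDerivAt.fun_sum fun i _ => ?_
  refine (((hasDerivAt_pow (2 * i + 1) x).const_mul _).div_const _).congr_deriv ?_
  rw [Nat.factorial_succ, Nat.add_sub_cancel]
  push_cast
  field_simp

theorem cosTaylor_succ (k : ℕ) (x : ℝ) : cosTaylor (k + 1) x = 1 + ∑ i ∈ Finset.range k,
    (-1) ^ (i + 1) * x ^ (2 * (i + 1)) / (2 * (i + 1)).factorial := by
  simp [cosTaylor, Finset.sum_range_succ', add_comm]

theorem hasDerivAt_cosTaylor_succ (k : ℕ) (x : ℝ) :
    HasDerivAt (cosTaylor (k + 1)) (-sinTaylor k x) x := by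
  rw [funext (cosTaylor_succ k), sinTaylor, ← Finset.sum_neg_distrib]
  refine (HasDerivAt.fun_sum fun i _ => ?_).const_add 1
  refine (((hasDerivAt_pow (2 * (i + 1)) x).const_mul _).div_const _).congr_deriv ?_
  rw [show 2 * (i + 1) = 2 * i + 1 + 1 by ring, Nat.factorial_succ (2 * i + 1),
    Nat.add_sub_cancel, pow_succ]
  push_cast
  field_simp

theorem neg_one_pow_mul_sin_sub_sinTaylor_nonneg_of_cos {k : ℕ}
    (h : ∀ x, 0 ≤ x → 0 ≤ (-1) ^ k * (Real.cos x - cosTaylor k x)) {x : ℝ} (hx : 0 ≤ x) :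
    0 ≤ (-1) ^ k * (Real.sin x - sinTaylor k x) :=
  nonneg_of_hasDerivAt_nonneg
    (fun y => ((Real.hasDerivAt_sin y).sub (hasDerivAt_sinTaylor k y)).const_mul _)
    (by simp [sinTaylor]) h hx

theorem neg_one_pow_mul_cos_sub_cosTaylor_nonneg (k : ℕ) {x : ℝ} (hx : 0 ≤ x) :
    0 ≤ (-1) ^ (k + 1) * (Real.cos x - cosTaylor (k + 1) x) := by
  induction k generalizing x with
  | zero => simp [cosTaylor, Real.cos_le_one]
  | succ k ih =>
    refine nonneg_of_hasDerivAt_nonneg (fun y => ((Real.hasDerivAt_cos y).sub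
      (hasDerivAt_cosTaylor_succ (k + 1) y)).const_mul _) (by simp [cosTaylor_succ])
      (fun y hy => ?_) hx
    have h := neg_one_pow_mul_sin_sub_sinTaylor_nonneg_of_cos (fun _ => ih) hy
    rw [pow_succ]
    linarith

theorem neg_one_pow_mul_sin_sub_sinTaylor_nonneg (k : ℕ) {x : ℝ} (hx : 0 ≤ x) :
    0 ≤ (-1) ^ (k + 1) * (Real.sin x - sinTaylor (k + 1) x) :=
  neg_one_pow_mul_sin_sub_sinTaylor_nonneg_of_cos
    (fun _ => neg_one_pow_mul_cos_sub_cosTaylor_nonneg k) hx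

/-- A rational function of `r` that is slightly smaller than `sin (π r)`: `3.141592` is within
`10⁻⁶` of `π`, and the sine is `1`-Lipschitz. -/
noncomputable def sinPiLower (r : ℝ) : ℝ := sinTaylor 4 (3.141592 * r) - 1e-6 * r

/-- The analogue of `sinPiLower` that is slightly larger than `sin (π r)`. -/
noncomputable def sinPiUpper (r : ℝ) : ℝ := sinTaylor 5 (3.141592 * r) + 1e-6 * r

/-- The analogue of `sinPiLower` that is slightly smaller than `cos (π r)`. -/
noncomputable def cosPiLower (r : ℝ) : ℝ := cosTaylor 4 (3.141592 * r) - 1e-6 * r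

/-- The analogue of `sinPiLower` that is slightly larger than `cos (π r)`. -/
noncomputable def cosPiUpper (r : ℝ) : ℝ := cosTaylor 5 (3.141592 * r) + 1e-6 * r

theorem abs_pi_mul_sub_le {r : ℝ} (hr : 0 ≤ r) : |Real.pi * r - 3.141592 * r| ≤ 1e-6 * r := by
  have hlower := Real.pi_gt_d6
  have hupper := Real.pi_lt_d6
  rw [← sub_mul, abs_mul, abs_of_nonneg hr]
  refine mul_le_mul_of_nonneg_right (abs_le.2 ⟨?_, ?_⟩) hr <;> linarith

theorem sin_pi_mul_mem_Icc {r : ℝ} (hr : 0 ≤ r) :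
    Real.sin (Real.pi * r) ∈ Set.Icc (sinPiLower r) (sinPiUpper r) := by
  have hlip := abs_le.1 ((Real.abs_sin_sub_sin_le _ _).trans (abs_pi_mul_sub_le hr))
  have hx : 0 ≤ 3.141592 * r := by positivity
  have hlower := neg_one_pow_mul_sin_sub_sinTaylor_nonneg 3 hx
  have hupper := neg_one_pow_mul_sin_sub_sinTaylor_nonneg 4 hx
  norm_num only at hlower hupper
  rw [sinPiLower, sinPiUpper]
  constructor <;> linarith

theorem cos_pi_mul_mem_Icc {r : ℝ} (hr : 0 ≤ r) :
    Real.cos (Real.pi * r) ∈ Set.Icc (cosPiLower r) (cosPiUpper r) := by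
  have hlip := abs_le.1 ((Real.abs_cos_sub_cos_le _ _).trans (abs_pi_mul_sub_le hr))
  have hx : 0 ≤ 3.141592 * r := by positivity
  have hlower := neg_one_pow_mul_cos_sub_cosTaylor_nonneg 3 hx
  have hupper := neg_one_pow_mul_cos_sub_cosTaylor_nonneg 4 hx
  norm_num only at hlower hupper
  rw [cosPiLower, cosPiUpper]
  constructor <;> linarith

theorem sinPiLower_pos {r : ℝ} (h0 : 0 < r) (hr : r ≤ 1 / 2) : 0 < sinPiLower r := by
  set x := 3.141592 * r with hx
  have : 0 < x := by positivity
  have hsq : x ^ 2 ≤ 5 / 2 := by nlinarith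
  have htaylor : sinTaylor 4 x = x * (1 - x ^ 2 / 6) + x ^ 5 / 120 * (1 - x ^ 2 / 42) := by
    simp only [sinTaylor, Finset.sum_range_succ, Finset.sum_range_zero, Nat.factorial]
    push_cast
    ring
  have hfirst : x * (1 / 2) ≤ x * (1 - x ^ 2 / 6) := by gcongr; linarith
  have hsecond : 0 ≤ x ^ 5 / 120 * (1 - x ^ 2 / 42) := mul_nonneg (by positivity) (by linarith)
  rw [sinPiLower, ← hx, htaylor]
  linarith

theorem inv_sin_pi_mul_mem_Icc {r : ℝ} (h0 : 0 ≤ r) (hr : r ≤ 1 / 2) :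
    (Real.sin (Real.pi * r))⁻¹ ∈ Set.Icc (sinPiUpper r)⁻¹ (sinPiLower r)⁻¹ := by
  rcases h0.eq_or_lt with rfl | h0
  · simp [sinPiUpper, sinPiLower, sinTaylor]
  · have hsin := sin_pi_mul_mem_Icc h0.le
    have hpos := sinPiLower_pos h0 hr
    exact ⟨inv_anti₀ (hpos.trans_le hsin.1) hsin.2, inv_anti₀ hpos hsin.1⟩

theorem cot_pi_mul_mem_Icc {r : ℝ} (h0 : 0 < r) (hr : r ≤ 1 / 2) (hcos : 0 ≤ cosPiLower r) :
    Real.cot (Real.pi * r) ∈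
      Set.Icc (cosPiLower r / sinPiUpper r) (cosPiUpper r / sinPiLower r) := by
  have hsin := sin_pi_mul_mem_Icc h0.le
  have hpos := sinPiLower_pos h0 hr
  have hcos' := cos_pi_mul_mem_Icc h0.le
  rw [Real.cot_eq_cos_div_sin]
  exact ⟨div_le_div₀ (hcos.trans hcos'.1) hcos'.1 (hpos.trans_le hsin.1) hsin.2,
    div_le_div₀ (hcos.trans (hcos'.1.trans hcos'.2)) hcos'.2 hpos hsin.1⟩

end TaylorBounds

section NumericalBounds

theorem sin_pi_mul_sub_div {n j : ℕ} (hj : j < n) :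
    Real.sin (Real.pi * ((n - j : ℕ) / n)) = Real.sin (Real.pi * (j / n)) := by
  have hn : (n : ℝ) ≠ 0 := Nat.cast_ne_zero.2 (by omega)
  rw [Nat.cast_sub hj.le, sub_div, div_self hn, mul_sub, mul_one, Real.sin_pi_sub]

theorem sin_pi_mul_min_div {n j : ℕ} (hj : j < n) :
    Real.sin (Real.pi * ((min j (n - j) : ℕ) / n)) = Real.sin (Real.pi * (j / n)) := by
  rcases min_choice j (n - j) with h | h
  · rw [h]
  · rw [h, sin_pi_mul_sub_div hj]

/-- Folding `j` to `min j (n - j)` keeps the argument in `[0, π / 2]`, where the Taylor bounds are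
sharp. -/
theorem cscSum_mem_Icc (n : ℕ) : cscSum n ∈ Set.Icc
    (∑ j ∈ Finset.range n, (sinPiUpper ((min j (n - j) : ℕ) / n))⁻¹)
    (∑ j ∈ Finset.range n, (sinPiLower ((min j (n - j) : ℕ) / n))⁻¹) := by
  have hterm (j : ℕ) (hj : j ∈ Finset.range n) : (Real.sin (Real.pi * (j / n)))⁻¹ ∈ Set.Icc
      (sinPiUpper ((min j (n - j) : ℕ) / n))⁻¹ (sinPiLower ((min j (n - j) : ℕ) / n))⁻¹ := by
    have hj := Finset.mem_range.1 hj
    have hn : (0 : ℝ) < n := Nat.cast_pos.2 (by omega)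
    have hle : ((min j (n - j) : ℕ) : ℝ) * 2 ≤ n := by
      rw [← Nat.cast_two, ← Nat.cast_mul, Nat.cast_le]
      omega
    rw [← sin_pi_mul_min_div hj]
    exact inv_sin_pi_mul_mem_Icc (by positivity) ((div_le_div_iff₀ hn two_pos).2 (by linarith))
  exact ⟨Finset.sum_le_sum fun j hj => (hterm j hj).1, Finset.sum_le_sum fun j hj => (hterm j hj).2⟩

theorem oddCot_mem_Icc {n l : ℕ} (hl : 2 * l + 1 ≤ n)
    (hcos : 0 ≤ cosPiLower ((2 * l + 1) / (2 * n))) : oddCot n l ∈ Set.Icc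
      (cosPiLower ((2 * l + 1) / (2 * n)) / sinPiUpper ((2 * l + 1) / (2 * n)))
      (cosPiUpper ((2 * l + 1) / (2 * n)) / sinPiLower ((2 * l + 1) / (2 * n))) := by
  have hl' : (2 * l + 1 : ℝ) ≤ n := mod_cast hl
  have hn : (0 : ℝ) < n := lt_of_lt_of_le (by positivity) hl'
  exact cot_pi_mul_mem_Icc (by positivity)
    ((div_le_div_iff₀ (by positivity) two_pos).2 (by linarith)) hcos

theorem trigSums_mem_Icc_three :
    cscSum 3 ∈ Set.Icc 2.309 2.311 ∧ oddCot 3 0 ∈ Set.Icc 1.731 1.733 := by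
  refine ⟨Set.Icc_subset_Icc ?_ ?_ (cscSum_mem_Icc 3),
    Set.Icc_subset_Icc ?_ ?_ (oddCot_mem_Icc (l := 0) (by norm_num) ?_)⟩ <;>
  norm_num [cosPiLower, cosPiUpper, cosTaylor, sinPiLower, sinPiUpper, sinTaylor,
    Finset.sum_range_succ, Nat.factorial]

theorem trigSums_mem_Icc_four :
    cscSum 4 ∈ Set.Icc 3.828 3.830 ∧
      oddCot 4 0 ∈ Set.Icc 2.414 2.415 ∧ oddCot 4 1 ∈ Set.Icc 0.414 0.415 := by
  refine ⟨Set.Icc_subset_Icc ?_ ?_ (cscSum_mem_Icc 4),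
    Set.Icc_subset_Icc ?_ ?_ (oddCot_mem_Icc (l := 0) (by norm_num) ?_),
    Set.Icc_subset_Icc ?_ ?_ (oddCot_mem_Icc (l := 1) (by norm_num) ?_)⟩ <;>
  norm_num [cosPiLower, cosPiUpper, cosTaylor, sinPiLower, sinPiUpper, sinTaylor,
    Finset.sum_range_succ, Nat.factorial]

theorem trigSums_mem_Icc_five :
    cscSum 5 ∈ Set.Icc 5.505 5.507 ∧
      oddCot 5 0 ∈ Set.Icc 3.077 3.078 ∧ oddCot 5 1 ∈ Set.Icc 0.726 0.727 := by
  refine ⟨Set.Icc_subset_Icc ?_ ?_ (cscSum_mem_Icc 5),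
    Set.Icc_subset_Icc ?_ ?_ (oddCot_mem_Icc (l := 0) (by norm_num) ?_),
    Set.Icc_subset_Icc ?_ ?_ (oddCot_mem_Icc (l := 1) (by norm_num) ?_)⟩ <;>
  norm_num [cosPiLower, cosPiUpper, cosTaylor, sinPiLower, sinPiUpper, sinTaylor,
    Finset.sum_range_succ, Nat.factorial]

theorem trigSums_mem_Icc_six :
    cscSum 6 ∈ Set.Icc 7.309 7.311 ∧ oddCot 6 0 ∈ Set.Icc 3.731 3.733 ∧
      oddCot 6 1 ∈ Set.Icc 0.999 1.001 ∧ oddCot 6 2 ∈ Set.Icc 0.267 0.269 := by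
  refine ⟨Set.Icc_subset_Icc ?_ ?_ (cscSum_mem_Icc 6),
    Set.Icc_subset_Icc ?_ ?_ (oddCot_mem_Icc (l := 0) (by norm_num) ?_),
    Set.Icc_subset_Icc ?_ ?_ (oddCot_mem_Icc (l := 1) (by norm_num) ?_),
    Set.Icc_subset_Icc ?_ ?_ (oddCot_mem_Icc (l := 2) (by norm_num) ?_)⟩ <;>
  norm_num [cosPiLower, cosPiUpper, cosTaylor, sinPiLower, sinPiUpper, sinTaylor,
    Finset.sum_range_succ, Nat.factorial]

theorem trigSums_mem_Icc_seven :
    cscSum 7 ∈ Set.Icc 9.218 9.220 ∧ oddCot 7 0 ∈ Set.Icc 4.381 4.382 ∧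
      oddCot 7 1 ∈ Set.Icc 1.253 1.255 ∧ oddCot 7 2 ∈ Set.Icc 0.481 0.482 := by
  refine ⟨Set.Icc_subset_Icc ?_ ?_ (cscSum_mem_Icc 7),
    Set.Icc_subset_Icc ?_ ?_ (oddCot_mem_Icc (l := 0) (by norm_num) ?_),
    Set.Icc_subset_Icc ?_ ?_ (oddCot_mem_Icc (l := 1) (by norm_num) ?_),
    Set.Icc_subset_Icc ?_ ?_ (oddCot_mem_Icc (l := 2) (by norm_num) ?_)⟩ <;>
  norm_num [cosPiLower, cosPiUpper, cosTaylor, sinPiLower, sinPiUpper, sinTaylor,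
    Finset.sum_range_succ, Nat.factorial]

theorem trigSums_mem_Icc_eight :
    cscSum 8 ∈ Set.Icc 11.219 11.221 ∧ oddCot 8 0 ∈ Set.Icc 5.027 5.028 ∧
      oddCot 8 1 ∈ Set.Icc 1.496 1.497 ∧ oddCot 8 2 ∈ Set.Icc 0.668 0.669 := by
  refine ⟨Set.Icc_subset_Icc ?_ ?_ (cscSum_mem_Icc 8),
    Set.Icc_subset_Icc ?_ ?_ (oddCot_mem_Icc (l := 0) (by norm_num) ?_),
    Set.Icc_subset_Icc ?_ ?_ (oddCot_mem_Icc (l := 1) (by norm_num) ?_),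
    Set.Icc_subset_Icc ?_ ?_ (oddCot_mem_Icc (l := 2) (by norm_num) ?_)⟩ <;>
  norm_num [cosPiLower, cosPiUpper, cosTaylor, sinPiLower, sinPiUpper, sinTaylor,
    Finset.sum_range_succ, Nat.factorial]

theorem trigSums_mem_Icc_nine :
    cscSum 9 ∈ Set.Icc 13.299 13.300 ∧ oddCot 9 0 ∈ Set.Icc 5.671 5.672 ∧
      oddCot 9 1 ∈ Set.Icc 1.731 1.733 ∧ oddCot 9 2 ∈ Set.Icc 0.838 0.840 := by
  refine ⟨Set.Icc_subset_Icc ?_ ?_ (cscSum_mem_Icc 9),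
    Set.Icc_subset_Icc ?_ ?_ (oddCot_mem_Icc (l := 0) (by norm_num) ?_),
    Set.Icc_subset_Icc ?_ ?_ (oddCot_mem_Icc (l := 1) (by norm_num) ?_),
    Set.Icc_subset_Icc ?_ ?_ (oddCot_mem_Icc (l := 2) (by norm_num) ?_)⟩ <;>
  norm_num [cosPiLower, cosPiUpper, cosTaylor, sinPiLower, sinPiUpper, sinTaylor,
    Finset.sum_range_succ, Nat.factorial]

theorem trigSums_mem_Icc_ten :
    cscSum 10 ∈ Set.Icc 15.449 15.451 ∧
      oddCot 10 0 ∈ Set.Icc 6.3137 6.3138 ∧ oddCot 10 1 ∈ Set.Icc 1.962 1.963 := by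
  refine ⟨Set.Icc_subset_Icc ?_ ?_ (cscSum_mem_Icc 10),
    Set.Icc_subset_Icc ?_ ?_ (oddCot_mem_Icc (l := 0) (by norm_num) ?_),
    Set.Icc_subset_Icc ?_ ?_ (oddCot_mem_Icc (l := 1) (by norm_num) ?_)⟩ <;>
  norm_num [cosPiLower, cosPiUpper, cosTaylor, sinPiLower, sinPiUpper, sinTaylor,
    Finset.sum_range_succ, Nat.factorial]

end NumericalBounds

/-! ### Signs of the mode conditions -/

section AsymptoticBounds

theorem inv_add_div_six_le_inv_sin {x : ℝ} (h0 : 0 < x) (h1 : x < Real.pi) :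
    x⁻¹ + x / 6 ≤ (Real.sin x)⁻¹ := by
  have hsin := neg_one_pow_mul_sin_sub_sinTaylor_nonneg 2 h0.le
  have htaylor : sinTaylor 3 x = x - x ^ 3 / 6 + x ^ 5 / 120 := by
    simp only [sinTaylor, Finset.sum_range_succ, Finset.sum_range_zero, Nat.factorial]
    push_cast
    ring
  have hle : Real.sin x ≤ x - x ^ 3 / 6 + x ^ 5 / 120 := by
    rw [htaylor] at hsin
    linarith
  have hsq : x ^ 2 ≤ 14 := by nlinarith [Real.pi_lt_d2]
  rw [← one_div (Real.sin x), le_div_iff₀ (Real.sin_pos_of_pos_of_lt_pi h0 h1)]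
  calc (x⁻¹ + x / 6) * Real.sin x
    _ ≤ (x⁻¹ + x / 6) * (x - x ^ 3 / 6 + x ^ 5 / 120) := by gcongr
    _ = 1 - x ^ 4 / 720 * (14 - x ^ 2) := by field_simp; ring
    _ ≤ 1 := sub_le_self _ (mul_nonneg (by positivity) (by linarith))

theorem cot_le_inv {x : ℝ} (h0 : 0 < x) (h1 : x < Real.pi / 2) : Real.cot x ≤ x⁻¹ := by
  have hcot : Real.cot x = (Real.tan x)⁻¹ := by
    rw [Real.cot_eq_cos_div_sin, Real.tan_eq_sin_div_cos, inv_div]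
  rw [hcot]
  exact inv_anti₀ h0 (Real.lt_tan h0 h1).le

theorem one_sub_sq_div_two_div_le_cot {x : ℝ} (h0 : 0 < x) (h1 : x < Real.pi / 2) :
    (1 - x ^ 2 / 2) / x ≤ Real.cot x := by
  have hsin := Real.sin_pos_of_pos_of_lt_pi h0 (by linarith)
  have hcos := Real.cos_pos_of_mem_Ioo ⟨by linarith, h1⟩
  rw [Real.cot_eq_cos_div_sin]
  calc (1 - x ^ 2 / 2) / x ≤ Real.cos x / x := by gcongr; exact Real.one_sub_sq_div_two_le_cos
    _ ≤ Real.cos x / Real.sin x := by gcongr; exact Real.sin_le h0.le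

theorem two_mul_sum_inv_sin_le_cscSum {n J : ℕ} (hJ : 2 * J < n) :
    2 * ∑ j ∈ Finset.Ico 1 (J + 1), (Real.sin (Real.pi * (j / n)))⁻¹ ≤ cscSum n := by
  have hreflect := Finset.sum_Ico_reflect
    (fun j : ℕ => (Real.sin (Real.pi * ((j : ℝ) / n)))⁻¹) 1 (m := J + 1) (n := n) (by omega)
  rw [Finset.sum_congr rfl fun j hj => by
    have hj := Finset.mem_Ico.1 hj
    rw [sin_pi_mul_sub_div (by omega)]] at hreflect
  rw [two_mul]
  nth_rewrite 2 [hreflect]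
  rw [cscSum, ← Finset.sum_union]
  · refine Finset.sum_le_sum_of_subset_of_nonneg (fun j hj => ?_) fun j hj _ => ?_
    · simp only [Finset.mem_union, Finset.mem_Ico, Finset.mem_range] at hj ⊢
      omega
    · rcases j.eq_zero_or_pos with rfl | hpos
      · simp
      · exact (inv_pos.2 (sin_pi_mul_div_pos hpos (Finset.mem_range.1 hj))).le
  · refine Finset.disjoint_left.2 fun j hj hj' => ?_
    simp only [Finset.mem_Ico] at hj hj'
    omega

theorem harmonic_add_sq_mul_le_cscSum {n J : ℕ} (hJ : 2 * J < n) :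
    2 * (n / Real.pi) * (harmonic J + J * (J + 1) / 12 * (Real.pi / n) ^ 2) ≤ cscSum n := by
  have hn : (0 : ℝ) < n := Nat.cast_pos.2 (by omega)
  have hpi := Real.pi_pos
  have hsum (J : ℕ) : 2 * (n / Real.pi) * (harmonic J + J * (J + 1) / 12 * (Real.pi / n) ^ 2) =
      2 * ∑ j ∈ Finset.Ico 1 (J + 1), ((Real.pi * (j / n))⁻¹ + Real.pi * (j / n) / 6) := by
    induction J with
    | zero => simp
    | succ J ih =>
      rw [Finset.sum_Ico_succ_top (by omega), mul_add (2 : ℝ), ← ih, harmonic_succ]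
      push_cast
      field_simp
      ring
  rw [hsum]
  refine le_trans ?_ (two_mul_sum_inv_sin_le_cscSum hJ)
  gcongr with j hj
  have hj := Finset.mem_Ico.1 hj
  have hj0 : (0 : ℝ) < j := Nat.cast_pos.2 hj.1
  have hjn : (j : ℝ) / n < 1 := (div_lt_one hn).2 (Nat.cast_lt.2 (by omega))
  exact inv_add_div_six_le_inv_sin (by positivity) (mul_lt_of_lt_one_right hpi hjn)

theorem pi_mul_oddCot_arg_lt {n l : ℕ} (hl : 2 * l + 1 < n) :
    Real.pi * ((2 * l + 1) / (2 * n)) < Real.pi / 2 := by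
  have hn : (0 : ℝ) < n := Nat.cast_pos.2 (by omega)
  have hl' : (2 * l + 1 : ℝ) < n := mod_cast hl
  rw [div_eq_mul_one_div Real.pi 2, mul_lt_mul_iff_right₀ Real.pi_pos,
    div_lt_div_iff₀ (by positivity) two_pos]
  linarith

theorem oddCot_zero_le {n : ℕ} (hn : 2 ≤ n) : oddCot n 0 ≤ 2 * (n / Real.pi) := by
  have : (0 : ℝ) < n := Nat.cast_pos.2 (by omega)
  refine (cot_le_inv (by positivity) (pi_mul_oddCot_arg_lt hn)).trans_eq ?_
  push_cast
  field_simp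
  ring

theorem le_oddCot_one {n : ℕ} (hn : 4 ≤ n) :
    2 * (n / Real.pi) * (1 / 3 - 3 / 8 * (Real.pi / n) ^ 2) ≤ oddCot n 1 := by
  have : (0 : ℝ) < n := Nat.cast_pos.2 (by omega)
  refine le_of_eq_of_le ?_ (one_sub_sq_div_two_div_le_cot (by positivity) (pi_mul_oddCot_arg_lt hn))
  push_cast
  field_simp
  ring

end AsymptoticBounds

section SecondMode

variable {n : ℕ}

/-- The hypotheses are homogeneous: `K` is the common scale of the three trigonometric sums. -/
theorem secondModeSign_pos_of_le {K σ τ : ℝ} (hK : 0 < K) (hS : K * σ ≤ cscSum n)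
    (hk : oddCot n 0 ≤ K) (hT : K * τ ≤ oddCot n 1) (hσ : 2 ≤ σ)
    (hτ : 0 ≤ τ) (h : 0 < 3 / 4 * σ ^ 2 - 45 / 16 * σ + 9 / 4 + 3 / 16 * σ * τ) :
    0 < secondModeSign n := by
  rw [secondModeSign]
  generalize cscSum n = S at *
  generalize oddCot n 0 = k at *
  generalize oddCot n 1 = t at *
  have hσK : 2 * K ≤ K * σ := by nlinarith
  have hk' : 0 ≤ (K - k) * (45 / 16 * S - 9 / 4 * (K + k)) :=
    mul_nonneg (by linarith) (by linarith)
  have ht' : 0 ≤ S * (t - K * τ) := mul_nonneg (by linarith) (by linarith)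
  have hS' : 0 ≤ (S - K * σ) * (3 / 4 * (S + K * σ) - 45 / 16 * K + 3 / 16 * (K * τ)) :=
    mul_nonneg (by linarith) (by nlinarith [mul_nonneg hK.le hτ])
  have hscale : 0 < K ^ 2 * (3 / 4 * σ ^ 2 - 45 / 16 * σ + 9 / 4 + 3 / 16 * σ * τ) := by positivity
  linarith

theorem secondModeSign_pos_of_harmonic {J : ℕ} (hn : 4 ≤ n) (hJ : 2 * J < n) {v σ τ : ℝ}
    (hv : v = Real.pi / n) (hσ : σ = harmonic J + J * (J + 1) / 12 * v ^ 2)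
    (hτ : τ = 1 / 3 - 3 / 8 * v ^ 2) (hσ2 : 2 ≤ σ) (hτ0 : 0 ≤ τ)
    (h : 0 < 3 / 4 * σ ^ 2 - 45 / 16 * σ + 9 / 4 + 3 / 16 * σ * τ) : 0 < secondModeSign n := by
  subst hv hσ hτ
  have : (0 : ℝ) < n := Nat.cast_pos.2 (by omega)
  exact secondModeSign_pos_of_le (by positivity)
    (harmonic_add_sq_mul_le_cscSum hJ) (oddCot_zero_le (by omega)) (le_oddCot_one hn) hσ2 hτ0 h

theorem secondModeSign_ten_pos : 0 < secondModeSign 10 := by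
  obtain ⟨⟨hS, -⟩, ⟨-, hk⟩, ht, -⟩ := trigSums_mem_Icc_ten
  rw [secondModeSign]
  nlinarith [mul_nonneg (sub_nonneg.2 hS) (sub_nonneg.2 hk)]

theorem pi_div_sq_le {n : ℕ} (hn : 11 ≤ n) : (Real.pi / n) ^ 2 ≤ 1 / 9 := by
  have hn0 : (11 : ℝ) ≤ n := mod_cast hn
  refine (pow_le_pow_left₀ (by positivity) (?_ : Real.pi / n ≤ 1 / 3) 2).trans_eq (by norm_num)
  rw [div_le_div_iff₀ (by linarith) (by norm_num)]
  linarith [Real.pi_lt_d2]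

theorem secondModeSign_pos_of_le_twelve (hn : 11 ≤ n) (hn' : n ≤ 12) : 0 < secondModeSign n := by
  have hn0 : (11 : ℝ) ≤ n := mod_cast hn
  have hn1 : (n : ℝ) ≤ 12 := mod_cast hn'
  have hle := pi_div_sq_le hn
  have hge : 0.0684 ≤ (Real.pi / n) ^ 2 := by
    refine le_trans (by norm_num : (0.0684 : ℝ) ≤ 0.2616 ^ 2) ?_
    gcongr
    rw [le_div_iff₀ (by linarith)]
    linarith [Real.pi_gt_d2]
  have hharm : ((harmonic 5 : ℚ) : ℝ) = 137 / 60 := by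
    norm_num [harmonic, Finset.sum_range_succ]
  refine secondModeSign_pos_of_harmonic (J := 5) (by omega) (by omega) rfl rfl rfl ?_ ?_ ?_ <;>
    rw [hharm] at * <;> nlinarith

theorem secondModeSign_pos_of_thirteen_le (hn : 13 ≤ n) : 0 < secondModeSign n := by
  have hle := pi_div_sq_le (by omega : 11 ≤ n)
  have hharm : ((harmonic 6 : ℚ) : ℝ) = 49 / 20 := by
    norm_num [harmonic, Finset.sum_range_succ]
  refine secondModeSign_pos_of_harmonic (J := 6) (by omega) (by omega) rfl rfl rfl ?_ ?_ ?_ <;>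
    rw [hharm] at * <;> nlinarith

theorem secondModeSign_pos (hn : 10 ≤ n) : 0 < secondModeSign n := by
  rcases (by omega : n = 10 ∨ 11 ≤ n ∧ n ≤ 12 ∨ 13 ≤ n) with rfl | ⟨h11, h12⟩ | h13
  · exact secondModeSign_ten_pos
  · exact secondModeSign_pos_of_le_twelve h11 h12
  · exact secondModeSign_pos_of_thirteen_le h13

theorem secondModeSign_neg_of_mem_Icc {S₁ S₂ k₁ k₂ t₁ t₂ : ℝ} (hS₁ : 0 ≤ S₁) (hk₁ : 0 ≤ k₁)
    (ht₂ : 0 ≤ t₂) (hS : cscSum n ∈ Set.Icc S₁ S₂) (hk : oddCot n 0 ∈ Set.Icc k₁ k₂)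
    (ht : oddCot n 1 ∈ Set.Icc t₁ t₂)
    (h : 3 / 4 * S₂ ^ 2 - 45 / 16 * S₁ * k₁ + 9 / 4 * k₂ ^ 2 + 3 / 16 * S₂ * t₂ < 0) :
    secondModeSign n < 0 := by
  rw [secondModeSign]
  have hS0 : 0 ≤ cscSum n := hS₁.trans hS.1
  have hk0 : 0 ≤ oddCot n 0 := hk₁.trans hk.1
  have hSS : cscSum n ^ 2 ≤ S₂ ^ 2 := pow_le_pow_left₀ hS0 hS.2 2
  have hSk : S₁ * k₁ ≤ cscSum n * oddCot n 0 := mul_le_mul hS.1 hk.1 hk₁ hS0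
  have hkk : oddCot n 0 ^ 2 ≤ k₂ ^ 2 := pow_le_pow_left₀ hk0 hk.2 2
  have hSt : cscSum n * oddCot n 1 ≤ S₂ * t₂ :=
    (mul_le_mul_of_nonneg_left ht.2 hS0).trans (mul_le_mul_of_nonneg_right hS.2 ht₂)
  linarith

theorem secondModeSign_neg (hn : 4 ≤ n) (hn' : n ≤ 9) : secondModeSign n < 0 := by
  interval_cases n
  · obtain ⟨hS, hk, ht⟩ := trigSums_mem_Icc_four
    exact secondModeSign_neg_of_mem_Icc (by norm_num) (by norm_num) (by norm_num) hS hk ht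
      (by norm_num)
  · obtain ⟨hS, hk, ht⟩ := trigSums_mem_Icc_five
    exact secondModeSign_neg_of_mem_Icc (by norm_num) (by norm_num) (by norm_num) hS hk ht
      (by norm_num)
  · obtain ⟨hS, hk, ht, -⟩ := trigSums_mem_Icc_six
    exact secondModeSign_neg_of_mem_Icc (by norm_num) (by norm_num) (by norm_num) hS hk ht
      (by norm_num)
  · obtain ⟨hS, hk, ht, -⟩ := trigSums_mem_Icc_seven
    exact secondModeSign_neg_of_mem_Icc (by norm_num) (by norm_num) (by norm_num) hS hk ht
      (by norm_num)
  · obtain ⟨hS, hk, ht, -⟩ := trigSums_mem_Icc_eight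
    exact secondModeSign_neg_of_mem_Icc (by norm_num) (by norm_num) (by norm_num) hS hk ht
      (by norm_num)
  · obtain ⟨hS, hk, ht, -⟩ := trigSums_mem_Icc_nine
    exact secondModeSign_neg_of_mem_Icc (by norm_num) (by norm_num) (by norm_num) hS hk ht
      (by norm_num)

end SecondMode

section ModeSigns

variable {n : ℕ}

theorem cscSum_lt (hn : 3 ≤ n) (hn' : n ≤ 6) : cscSum n < n + oddCot n 0 / 2 := by
  interval_cases n <;> push_cast
  · obtain ⟨⟨-, hS⟩, hk, -⟩ := trigSums_mem_Icc_three
    linarith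
  · obtain ⟨⟨-, hS⟩, ⟨hk, -⟩, -⟩ := trigSums_mem_Icc_four
    linarith
  · obtain ⟨⟨-, hS⟩, ⟨hk, -⟩, -⟩ := trigSums_mem_Icc_five
    linarith
  · obtain ⟨⟨-, hS⟩, ⟨hk, -⟩, -⟩ := trigSums_mem_Icc_six
    linarith

theorem lt_cscSum_of_nine_le (hn : 9 ≤ n) : n + oddCot n 0 / 2 < cscSum n := by
  have hn0 : (9 : ℝ) ≤ n := mod_cast hn
  have hpi := Real.pi_pos
  have hS := harmonic_add_sq_mul_le_cscSum (by omega : 2 * 4 < n)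
  have hharm : ((harmonic 4 : ℚ) : ℝ) = 25 / 12 := by
    norm_num [harmonic, Finset.sum_range_succ]
  have hsq : 0 < n / Real.pi * (Real.pi / n) ^ 2 := by positivity
  have hn_lt : (n : ℝ) < n / Real.pi * 3.15 := by
    rw [div_mul_eq_mul_div, lt_div_iff₀ hpi]
    gcongr
    exact Real.pi_lt_d2
  rw [hharm] at hS
  linarith [oddCot_zero_le (by omega : 2 ≤ n)]

theorem lt_cscSum (hn : 7 ≤ n) : n + oddCot n 0 / 2 < cscSum n := by
  rcases (by omega : n = 7 ∨ n = 8 ∨ 9 ≤ n) with rfl | rfl | hn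
  · obtain ⟨⟨hS, -⟩, ⟨-, hk⟩, -⟩ := trigSums_mem_Icc_seven
    push_cast
    linarith
  · obtain ⟨⟨hS, -⟩, ⟨-, hk⟩, -⟩ := trigSums_mem_Icc_eight
    push_cast
    linarith
  · exact lt_cscSum_of_nine_le hn

variable [NeZero n]

theorem singularMass_two_pos (hn : 10 ≤ n) : 0 < singularMass n 2 :=
  (singularMass_two_pos_iff (by omega)).2 (secondModeSign_pos hn)

theorem singularMass_two_nonpos (hn : 4 ≤ n) (hn' : n ≤ 9) : singularMass n 2 ≤ 0 :=
  not_lt.1 fun h => (secondModeSign_neg hn hn').not_gt ((singularMass_two_pos_iff hn).1 h)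

theorem singularMass_three_pos_of_le_nine (hn : 6 ≤ n) (hn' : n ≤ 9) : 0 < singularMass n 3 := by
  refine pos_of_mul_pos_right (lt_of_lt_of_le ?_ (le_singularMass_three hn)) (by norm_num)
  interval_cases n
  · obtain ⟨⟨hS, -⟩, ⟨-, hk⟩, ⟨-, ht⟩, hu, -⟩ := trigSums_mem_Icc_six
    linarith
  · obtain ⟨⟨hS, -⟩, ⟨-, hk⟩, ⟨-, ht⟩, hu, -⟩ := trigSums_mem_Icc_seven
    linarith
  · obtain ⟨⟨hS, -⟩, ⟨-, hk⟩, ⟨-, ht⟩, hu, -⟩ := trigSums_mem_Icc_eight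
    linarith
  · obtain ⟨⟨hS, -⟩, ⟨-, hk⟩, ⟨-, ht⟩, hu, -⟩ := trigSums_mem_Icc_nine
    linarith

theorem singularMass_pos {l : ℕ} (hl : 3 ≤ l) (hl' : 2 * l ≤ n) : 0 < singularMass n l := by
  rcases (by omega : n ≤ 9 ∨ 10 ≤ n) with hn | hn
  · have hpos := singularMass_three_pos_of_le_nine (by omega : 6 ≤ n) hn
    rcases hl.eq_or_lt with rfl | hlt
    · exact hpos
    · exact hpos.trans (singularMass_lt_of_lt (by norm_num) hlt hl')
  · exact (singularMass_two_pos hn).trans (singularMass_lt_of_lt (by norm_num) hl hl')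

end ModeSigns

/-! ### The degeneracy values -/

section DegeneracyValues

variable {n : ℕ} [NeZero n] {m : ℝ}

/-- The only real value of the central mass at which the block of the mode `l` can be singular; it
is a degeneracy value when it is positive. -/
noncomputable def modeMass (n : ℕ) [NeZero n] (l : ℕ) : ℝ :=
  if l = 1 then (cscSum n * 3 / 4 - oddCot n 0 / 2) * (n / 2 + cscSum n / 4) /
    (3 / 2 * (n + oddCot n 0 / 2 - cscSum n))
  else singularMass n l

theorem modeMass_of_two_le {l : ℕ} (hl : 2 ≤ l) : modeMass n l = singularMass n l :=
  if_neg (by omega)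

omit [NeZero n] in
theorem cscSum_ne (hn : 3 ≤ n) : cscSum n ≠ n + oddCot n 0 / 2 := by
  rcases le_or_gt n 6 with h | h
  · exact (cscSum_lt hn h).ne
  · exact (lt_cscSum h).ne'

theorem modeDet_eq_zero_iff (hn : 3 ≤ n) {l : ℕ} (hl : 1 ≤ l) (hl' : l ≤ n / 2) (hm : 0 < m) :
    modeDet n m l = 0 ↔ m = modeMass n l := by
  rcases hl.eq_or_lt with rfl | hl
  · have hne : 3 / 2 * (n + oddCot n 0 / 2 - cscSum n) ≠ 0 :=
      mul_ne_zero (by norm_num) (sub_ne_zero.2 (cscSum_ne hn).symm)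
    rw [modeDet, if_pos rfl, det_blockA1_eq_zero_iff hn hm, modeMass, if_pos rfl, eq_div_iff hne,
      eq_comm]
    ring_nf
  · rw [modeDet, if_neg (by omega), det_blockA_eq_zero_iff hl (by omega), modeMass_of_two_le hl]

theorem modeMass_one_pos_iff (hn : 3 ≤ n) : 0 < modeMass n 1 ↔ n ≤ 6 := by
  rw [modeMass, if_pos rfl, div_pos_iff_of_pos_left (firstMode_const_pos (by omega)),
    mul_pos_iff_of_pos_left (by norm_num), sub_pos]
  exact ⟨fun h => not_lt.1 fun hn' => h.not_gt (lt_cscSum hn'), cscSum_lt hn⟩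

theorem modeMass_two_pos_iff (hn : 4 ≤ n) : 0 < modeMass n 2 ↔ 10 ≤ n := by
  rw [modeMass_of_two_le le_rfl, Nat.cast_two]
  refine ⟨fun h => ?_, singularMass_two_pos⟩
  by_contra! hn'
  exact (singularMass_two_nonpos hn (by omega)).not_gt h

theorem mem_degenerateModes_iff_modeMass_pos (hn : 3 ≤ n) {l : ℕ} :
    l ∈ degenerateModes n ↔ 1 ≤ l ∧ l ≤ n / 2 ∧ 0 < modeMass n l := by
  refine and_congr_right fun hl => and_congr_right fun hl' => ⟨?_, fun h => ?_⟩
  · rintro ⟨m, hm, hdet⟩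
    rwa [← (modeDet_eq_zero_iff hn hl hl' hm).1 hdet]
  · exact ⟨_, h, (modeDet_eq_zero_iff hn hl hl' h).2 rfl⟩

theorem mem_degenerateModes_iff (hn : 3 ≤ n) {l : ℕ} :
    l ∈ degenerateModes n ↔ 1 ≤ l ∧ l ≤ n / 2 ∧ (l = 1 → n ≤ 6) ∧ (l = 2 → 10 ≤ n) := by
  rw [mem_degenerateModes_iff_modeMass_pos hn]
  refine and_congr_right fun hl => and_congr_right fun hl' => ?_
  rcases (by omega : l = 1 ∨ l = 2 ∨ 3 ≤ l) with rfl | rfl | hl3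
  · simp [modeMass_one_pos_iff hn]
  · simp [modeMass_two_pos_iff (by omega : 4 ≤ n)]
  · rw [modeMass_of_two_le (by omega)]
    exact iff_of_true (singularMass_pos hl3 (by omega)) (by omega)

theorem degenerate_iff_modeDet_eq_zero (hn : 3 ≤ n) :
    Degenerate n m ↔ ∃ l, 1 ≤ l ∧ l ≤ n / 2 ∧ modeDet n m l = 0 := by
  rw [degenerate_iff hn]
  constructor
  · rintro (h | ⟨l, hl, hl', h⟩)
    · exact ⟨1, le_rfl, by omega, by rwa [modeDet, if_pos rfl]⟩
    · exact ⟨l, by omega, hl', by rwa [modeDet, if_neg (by omega)]⟩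
  · rintro ⟨l, hl, hl', h⟩
    rw [modeDet] at h
    split_ifs at h with hl1
    · exact Or.inl h
    · exact Or.inr ⟨l, by omega, hl', h⟩

theorem degeneracyValues_eq_image (hn : 3 ≤ n) :
    degeneracyValues n = modeMass n '' degenerateModes n := by
  ext m
  simp only [degeneracyValues, Set.mem_ofPred_eq, degenerate_iff_modeDet_eq_zero hn, Set.mem_image,
    mem_degenerateModes_iff_modeMass_pos hn]
  constructor
  · rintro ⟨hm, l, hl, hl', hdet⟩
    have hmass := (modeDet_eq_zero_iff hn hl hl' hm).1 hdet
    exact ⟨l, ⟨hl, hl', hmass ▸ hm⟩, hmass.symm⟩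
  · rintro ⟨l, ⟨hl, hl', hpos⟩, rfl⟩
    exact ⟨hpos, l, hl, hl', (modeDet_eq_zero_iff hn hl hl' hpos).2 rfl⟩

theorem singularMass_six_three_lt_one : singularMass 6 3 < 1 := by
  have hsymm : chordSum 6 (3 + 1) = chordSum 6 (3 - 1) := by
    rw [show (3 + 1 : ZMod 6) = -(3 - 1) by decide, chordSum_neg]
  obtain ⟨⟨-, hS⟩, ⟨hk₀, -⟩, ⟨hk₁, -⟩, -, hk₂⟩ := trigSums_mem_Icc_six
  rw [singularMass, hsymm, sub_self, inverseChordSum_three (by norm_num),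
    chordSum_three (by norm_num), chordSum_one, zero_pow two_ne_zero, zero_div]
  linarith

theorem one_le_modeMass_six_one : 1 ≤ modeMass 6 1 := by
  obtain ⟨⟨hS, hS'⟩, ⟨hk, hk'⟩, -⟩ := trigSums_mem_Icc_six
  rw [modeMass, if_pos rfl, one_le_div (by push_cast; linarith)]
  push_cast
  nlinarith

theorem modeMass_ne_of_lt (hn : 3 ≤ n) {l i : ℕ} (hl : l ∈ degenerateModes n)
    (hi : i ∈ degenerateModes n) (hli : l < i) : modeMass n l ≠ modeMass n i := by
  obtain ⟨hl1, -, hl6, -⟩ := (mem_degenerateModes_iff hn).1 hl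
  obtain ⟨-, hi', -, hi10⟩ := (mem_degenerateModes_iff hn).1 hi
  rw [modeMass_of_two_le (l := i) (by omega)]
  rcases hl1.eq_or_lt with rfl | hl2
  · obtain ⟨rfl, rfl⟩ : n = 6 ∧ i = 3 := by omega
    exact (singularMass_six_three_lt_one.trans_le one_le_modeMass_six_one).ne'
  · rw [modeMass_of_two_le hl2]
    exact (singularMass_lt_of_lt hl1 hli (by omega)).ne

theorem modeMass_injOn (hn : 3 ≤ n) : Set.InjOn (modeMass n) (degenerateModes n) := by
  intro l hl i hi h
  by_contra hne
  rcases lt_or_gt_of_ne hne with hlt | hlt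
  · exact modeMass_ne_of_lt hn hl hi hlt h
  · exact modeMass_ne_of_lt hn hi hl hlt h.symm

end DegeneracyValues

section Counting

variable {n : ℕ} [NeZero n]

theorem ncard_degeneracyValues (hn : 3 ≤ n) :
    (degeneracyValues n).ncard = (degenerateModes n).ncard := by
  rw [degeneracyValues_eq_image hn, Set.InjOn.ncard_image (modeMass_injOn hn)]

theorem finite_degeneracyValues (hn : 3 ≤ n) : (degeneracyValues n).Finite := by
  rw [degeneracyValues_eq_image hn]
  exact ((Set.finite_Iic (n / 2)).subset fun l hl => hl.2.1).image _

theorem degenerateModes_of_le_five (hn : 3 ≤ n) (hn' : n ≤ 5) : degenerateModes n = {1} := by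
  ext l
  rw [mem_degenerateModes_iff hn, Set.mem_singleton_iff]
  omega

theorem degenerateModes_six : degenerateModes 6 = {1, 3} := by
  ext l
  rw [mem_degenerateModes_iff (by norm_num), Set.mem_insert_iff, Set.mem_singleton_iff]
  omega

theorem degenerateModes_of_le_nine (hn : 7 ≤ n) (hn' : n ≤ 9) :
    degenerateModes n = Finset.Icc 3 (n / 2) := by
  ext l
  rw [mem_degenerateModes_iff (by omega), Finset.coe_Icc, Set.mem_Icc]
  omega

theorem degenerateModes_of_ten_le (hn : 10 ≤ n) :
    degenerateModes n = Finset.Icc 2 (n / 2) := by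
  ext l
  rw [mem_degenerateModes_iff (by omega), Finset.coe_Icc, Set.mem_Icc]
  omega

theorem ncard_degeneracyValues_of_le_five (hn : 3 ≤ n) (hn' : n ≤ 5) :
    (degeneracyValues n).ncard = 1 := by
  rw [ncard_degeneracyValues hn, degenerateModes_of_le_five hn hn', Set.ncard_singleton]

theorem ncard_degeneracyValues_of_le_six (hn : 4 ≤ n) (hn' : n ≤ 6) :
    (degeneracyValues n).ncard = n / 2 - 1 := by
  rcases hn'.eq_or_lt with rfl | hn'
  · rw [ncard_degeneracyValues (by norm_num), degenerateModes_six, Set.ncard_pair (by norm_num)]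
  · rw [ncard_degeneracyValues_of_le_five (by omega) (by omega)]
    omega

theorem ncard_degeneracyValues_of_le_nine (hn : 7 ≤ n) (hn' : n ≤ 9) :
    (degeneracyValues n).ncard = n / 2 - 2 := by
  rw [ncard_degeneracyValues (by omega), degenerateModes_of_le_nine hn hn', Set.ncard_coe_finset,
    Nat.card_Icc]
  omega

theorem ncard_degeneracyValues_of_ten_le (hn : 10 ≤ n) :
    (degeneracyValues n).ncard = n / 2 - 1 := by
  rw [ncard_degeneracyValues (by omega), degenerateModes_of_ten_le hn, Set.ncard_coe_finset,
    Nat.card_Icc]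
  omega

theorem ncard_degeneracyValues_of_seven_le (hn : 7 ≤ n) :
    (degeneracyValues n).ncard = n / 2 - if n ≤ 9 then 2 else 1 := by
  split_ifs with hn'
  · exact ncard_degeneracyValues_of_le_nine hn hn'
  · exact ncard_degeneracyValues_of_ten_le (by omega)

theorem ncard_degeneracyValues_increasing (hn : 7 ≤ n) :
    (degeneracyValues n).ncard ≤ (degeneracyValues (n + 1)).ncard ∧
      (degeneracyValues n).ncard < (degeneracyValues (n + 2)).ncard := by
  rw [ncard_degeneracyValues_of_seven_le hn, ncard_degeneracyValues_of_seven_le (by omega),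
    ncard_degeneracyValues_of_seven_le (by omega)]
  split_ifs <;> omega

end Counting

section ModeDeterminants

variable {n : ℕ} [NeZero n]

theorem subsingleton_det_blockA_eq_zero {l : ℕ} (hl : 2 ≤ l) (hl' : l ≤ n / 2) :
    {m : ℝ | 0 < m ∧ (blockA n m l).det = 0}.Subsingleton := by
  rintro m₁ ⟨-, h₁⟩ m₂ ⟨-, h₂⟩
  rw [(det_blockA_eq_zero_iff hl (by omega)).1 h₁, (det_blockA_eq_zero_iff hl (by omega)).1 h₂]

theorem det_blockA1_eq_zero_iff_eq_modeMass (hn : 3 ≤ n) {m : ℝ} (hm : 0 < m) :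
    (blockA1 n m).det = 0 ↔ m = modeMass n 1 := by
  rw [← modeDet_eq_zero_iff hn le_rfl (by omega) hm, modeDet, if_pos rfl]

theorem existsUnique_det_blockA1_eq_zero (hn : 3 ≤ n) (hn' : n ≤ 6) :
    ∃! m : ℝ, 0 < m ∧ (blockA1 n m).det = 0 := by
  have hpos := (modeMass_one_pos_iff hn).2 hn'
  exact ⟨modeMass n 1, ⟨hpos, (det_blockA1_eq_zero_iff_eq_modeMass hn hpos).2 rfl⟩,
    fun m hm => (det_blockA1_eq_zero_iff_eq_modeMass hn hm.1).1 hm.2⟩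

theorem det_blockA1_ne_zero (hn : 7 ≤ n) {m : ℝ} (hm : 0 < m) : (blockA1 n m).det ≠ 0 := by
  rw [Ne, det_blockA1_eq_zero_iff_eq_modeMass (by omega) hm]
  rintro rfl
  have := (modeMass_one_pos_iff (by omega)).1 hm
  omega

end ModeDeterminants

theorem mainTheorem1 :
    (∀ (n : ℕ) [NeZero n], 3 ≤ n →
      -- (1) block structure in the basis adapted to the dihedral group
      (IsSymmetryAdapted n ∧
        (∃ b : Module.Basis (AdaptedIndex n) ℝ (Config n),
          (∀ x : AdaptedIndex n, b x = blockVector n x.1 x.2) ∧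
          ∀ m : ℝ, 0 < m →
            LinearMap.toMatrix b b (hess n m : Config n →ₗ[ℝ] Config n) =
              Matrix.blockDiagonal' (hessBlock n m)) ∧
        (∀ m : ℝ, 0 < m →
          scalarBlock n m (modeV n 0) = 0 ∧ scalarBlock n m (modeW n 0) = 0 ∧
          (Even n → blockA n m (n / 2) =
            Matrix.diagonal
              ![scalarBlock n m (modeV n (n / 2)), scalarBlock n m (modeW n (n / 2))]))) ∧
      -- (2) degeneracy criterion
      (∀ m : ℝ, 0 < m →
        (Degenerate n m ↔
          (blockA1 n m).det = 0 ∨ ∃ l : ℕ, 2 ≤ l ∧ l ≤ n / 2 ∧ (blockA n m l).det = 0)) ∧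
      -- (3) the modes `l ≥ 2`
      (∀ l : ℕ, 2 ≤ l → l ≤ n / 2 →
        {m : ℝ | 0 < m ∧ (blockA n m l).det = 0}.Subsingleton) ∧
      -- (4) the mode `l = 1`
      (n ≤ 6 → ∃! m : ℝ, 0 < m ∧ (blockA1 n m).det = 0) ∧
      (7 ≤ n → ∀ m : ℝ, 0 < m → (blockA1 n m).det ≠ 0) ∧
      -- (5) the number of degeneracy values
      (degeneracyValues n).Finite ∧
      (degeneracyValues n).ncard = (degenerateModes n).ncard ∧
      (n = 3 → (degeneracyValues n).ncard = 1) ∧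
      (4 ≤ n → n ≤ 6 → (degeneracyValues n).ncard = n / 2 - 1) ∧
      (7 ≤ n → n ≤ 9 → (degeneracyValues n).ncard = n / 2 - 2) ∧
      (10 ≤ n → (degeneracyValues n).ncard = n / 2 - 1)) ∧
    (∀ (n : ℕ) [NeZero n], 7 ≤ n →
      (degeneracyValues n).ncard ≤ (degeneracyValues (n + 1)).ncard ∧
      (degeneracyValues n).ncard < (degeneracyValues (n + 2)).ncard) := by
  refine ⟨fun n _ hn => ⟨⟨isSymmetryAdapted, ?basis, ?scalars⟩, ?criterion, ?modes, ?firstMode,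
    ?firstModeLarge, finite_degeneracyValues hn, ncard_degeneracyValues hn, ?three,
    ncard_degeneracyValues_of_le_six, ncard_degeneracyValues_of_le_nine,
    ncard_degeneracyValues_of_ten_le⟩, fun n _ hn => ncard_degeneracyValues_increasing hn⟩
  case basis => exact ⟨adaptedBasis hn, adaptedBasis_apply hn, fun m _ => toMatrix_hess hn⟩
  case scalars =>
    exact fun m _ => ⟨scalarBlock_modeV_zero (by omega), scalarBlock_modeW_zero (by omega),
      fun heven => blockA_half hn (Nat.two_mul_div_two_of_even heven)⟩
  case criterion => exact fun m _ => degenerate_iff hn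
  case modes => exact fun l hl hl' => subsingleton_det_blockA_eq_zero hl hl'
  case firstMode => exact existsUnique_det_blockA1_eq_zero hn
  case firstModeLarge => exact fun hn' m hm => det_blockA1_ne_zero hn' hm
  case three => exact fun h => ncard_degeneracyValues_of_le_five hn (by omega)
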